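/- **Conventions.** A *monoid* $A$ is commutative, written additively, with group completion $A^{\rm gp}$; its *rank* is the rank of $A^{\rm gp}$, its *dual* is $A^\vee=\mathrm{Hom}(A,\mathbb N)$, and it is *torsion-free* if $A^{\rm gp}$ is. It is *toric* if it is finitely generated, integral ($A\to A^{\rm gp}$ is injective), saturated ($p\in A^{\rm gp}$, $m\ge1$, $mp\in A$ imply $p\in A$), torsion-free, and sharp ($p+q=0$ implies $p=0$). A *face* of $A$ is a submonoid $F$ such that $p+q\in F$ implies $p,q\in F$. For a submonoid $S$, $A/S$ is the quotient of $A$ by: $p\sim p'$ iff $p+q=p'+q'$ for some $q,q'\in S$. Let $Q$ be toric. $X_Q$ is the set of monoid morphisms $x:Q\to([0,\infty),\cdot)$, $\lambda_q(x)=x(q)$, with the weakest topology making all $\lambda_q$ continuous; $\delta_0\in X_Q$ is given by $\delta_0(0)=1$, $\delta_0(q)=0$ for $q\ne0$. In $X_Q\times\mathbb R^n$, with coordinates $z=(z_1,\dots,z_n)$ on $\mathbb R^n$, the *interior* is the set of $(x,z)$ with all $\lambda_q(x)>0$. A map to a normed space is *smooth* near a point $x$ if near $x$ it is a $C^\infty$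 function, on an open subset of $\mathbb R^s\times\mathbb R^n$, of finitely many $\lambda_{q_1},\dots,\lambda_{q_s}$ and of $z$. A function $f$ to $[0,\infty)$ is *interior* if near each point of its domain $f=\lambda_p\cdot h$ for some $p\in Q$ and some smooth $h>0$. A map $\varphi$ from an open subset of $X_P\times\mathbb R^m$ to $X_Q\times\mathbb R^n$ is *interior* if it is continuous, each $\lambda_q\circ\varphi$ is interior, and the $\mathbb R^n$-component of $\varphi$ is smooth. Let $C^\infty_x$ be the algebra of germs at $x$ of smooth real functions, and $\mathcal I_x$ the multiplicative monoid of germs at $x$ of interior functions to $[0,\infty)$. The *b-tangent space* ${}^bT_x$ is the space of pairs $(v,v')$ of a derivation $v:C^\infty_x\to\mathbb R$ at $x$ and a monoid morphism $v':\mathcal I_x\to(\mathbb R,+)$ with $v'(\exp a)=v(a)$ and $v(b)=b(x)v'(b)$ for $a\in C_x^\infty$, $b\in\mathcal I_x$; ${}^bT^*_x$ is its dual. For $f$ interior, ${}^b\mathrm df|_x\in{}^bT_x^*$ is $(v,v')\mapsto v'([f])$ (so ${}^b\mathrm df=\mathrm d\log f$), and for $h$ smooth, $\mathrm dh|_x$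 is $(v,v')\mapsto v([h])$. Let $\tilde M_x$ be the monoid of morphisms $\alpha:\mathcal I_x\to\mathbb N$ vanishing on germs $c$ with $c(x)>0$; an interior map $\varphi$ induces $\tilde M_x\varphi:\tilde M_x\to\tilde M_{\varphi(x)}$, $\alpha\mapsto\alpha\circ\varphi^*$. The *depth* of $(x,z)\in X_Q\times\mathbb R^n$ is $\operatorname{rank}Q-\operatorname{rank}\{p\in Q:\lambda_p(x)\neq0\}$; the sets $S^d$ of points of depth $d$ are locally embedded submanifolds. An interior map $\varphi$ is an *interior immersion* if for every $x$ in its domain (i) the derivative at $x$ of $\varphi$ restricted to the depth stratum through $x$ is injective, (ii) $\tilde M_x\varphi$ is injective, and (iii) $\tilde M_{\varphi(x)}/\operatorname{im}(\tilde M_x\varphi)$ is torsion-free. It is an *interior embedding* if moreover it is a homeomorphism onto its image. **Theorem.** Let $Q$ be a toric monoid, $V$ an open neighbourhood of $(\delta_0,0)$ in $X_Q\times\mathbb R^n$, $f_i,g_i:V\to[0,\infty)$ interior for $i=1,\dots,k$ with $f_i(\delta_0,0)=g_i(\delta_0,0)$, and $h_j:V\to\mathbb R$ smooth for $j=1,\dots,l$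 with $h_j(\delta_0,0)=0$, where $k,l\ge0$. Suppose that the $k+l$ vectors ${}^b\mathrm df_i|_{(\delta_0,0)}-{}^b\mathrm dg_i|_{(\delta_0,0)}$ and $\mathrm dh_j|_{(\delta_0,0)}$ are linearly independent in ${}^bT^*_{(\delta_0,0)}V$. Let $V^\circ$ be the set of points of $V$ in the interior, and let $X$ be the closure in $V$ of $$X^\circ=\{v\in V^\circ: f_i(v)=g_i(v)\ (1\le i\le k),\ h_j(v)=0\ (1\le j\le l)\}.$$ The linear map $(Q^{\rm gp}\otimes_{\mathbb Z}\mathbb R)\oplus\mathbb R^n\to{}^bT^*_{(\delta_0,0)}V$ taking $q\in Q$ to ${}^b\mathrm d\lambda_q|_{(\delta_0,0)}$ and the $a$-th basis vector of $\mathbb R^n$ to $\mathrm dz_a|_{(\delta_0,0)}$ is an isomorphism, and under it ${}^b\mathrm df_i|_{(\delta_0,0)}-{}^b\mathrm dg_i|_{(\delta_0,0)}=\beta_i\oplus\gamma_i$ with $\beta_i\in Q^{\rm gp}\subseteq Q^{\rm gp}\otimes_{\mathbb Z}\mathbb R$ and $\gamma_i\in\mathbb R^n$. Write $B=\{\rho\in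 Q^\vee:\rho(\beta_i)=0\text{ for }i=1,\dots,k\}$, where $\rho$ is extended to $Q^{\rm gp}\to\mathbb Z$. Then: 1. Suppose $(\delta_0,0)\in X$. Then there exist a toric monoid $P$, an $m\ge0$ with $\operatorname{rank}P+m=\operatorname{rank}Q+n-k-l$, an open neighbourhood $U$ of $(\delta_0,0)$ in $X_P\times\mathbb R^m$, an interior embedding $\varphi:U\to V$ with $\varphi(\delta_0,0)=(\delta_0,0)$, and an open neighbourhood $V'$ of $(\delta_0,0)$ in $V$ such that $\varphi(U)=X\cap V'$. Moreover there is an isomorphism $P^\vee\cong B$ under which the inclusion $P^\vee\cong B\hookrightarrow Q^\vee$ is identified with $\tilde M_{(\delta_0,0)}\varphi:\tilde M_{(\delta_0,0)}U\to\tilde M_{(\delta_0,0)}V$, via the isomorphisms $\tilde M_{(\delta_0,0)}U\cong P^\vee$ and $\tilde M_{(\delta_0,0)}V\cong Q^\vee$ given by $\alpha\mapsto(q\mapsto\alpha([\lambda_q]))$. 2. Suppose (without assuming $(\delta_0,0)\in X$) that $\beta_1,\dots,\beta_k$ are linearly independent over $\mathbb R$ in $Q^{\rm gp}\otimes_{\mathbb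 Z}\mathbb R$. Then $(\delta_0,0)\in X$ if and only if $B$ is not contained in any proper face $F\subsetneq Q^\vee$. -/

import Mathlib

open Filter Topology
open scoped ContDiff TensorProduct

noncomputable section

namespace GCorners

/-! ### Monoids -/

/-- The group completion `A^gp` of a commutative monoid. -/
abbrev Gp (A : Type*) [AddCommMonoid A] : Type _ := Algebra.GrothendieckAddGroup A

/-- The canonical morphism `A → A^gp`. -/
abbrev toGp (A : Type*) [AddCommMonoid A] : A →+ Gp A := Algebra.GrothendieckAddGroup.of

/-- The rank of a monoid: the rank of the abelian group `A^gp`. -/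
def rank (A : Type*) [AddCommMonoid A] : ℕ := Module.finrank ℤ (Gp A)

/-- Toric monoids: finitely generated, integral, saturated, torsion-free and sharp. -/
class IsToric (Q : Type*) [AddCommMonoid Q] : Prop where
  fg : AddMonoid.FG Q
  integral : Function.Injective (toGp Q)
  saturated : ∀ (m : ℕ) (p : Gp Q), 0 < m →
    m • p ∈ AddMonoidHom.mrange (toGp Q) → p ∈ AddMonoidHom.mrange (toGp Q)
  torsionFree : IsAddTorsionFree (Gp Q)
  sharp : ∀ p q : Q, p + q = 0 → p = 0

/-- A face of a monoid: a submonoid `F` such that `p + q ∈ F` forces `p, q ∈ F`. -/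
def IsFace {A : Type*} [AddCommMonoid A] (F : AddSubmonoid A) : Prop :=
  ∀ p q : A, p + q ∈ F → p ∈ F ∧ q ∈ F

/-- The congruence of a submonoid `S` of `A`: `p ~ p'` iff `p + q = p' + q'` for some
`q, q' ∈ S`. Its quotient is the quotient monoid `A / S`. -/
def quotCon {A : Type*} [AddCommMonoid A] (S : AddSubmonoid A) : AddCon A where
  r p p' := ∃ q ∈ S, ∃ q' ∈ S, p + q = p' + q'
  iseqv :=
    { refl := fun p => ⟨0, S.zero_mem, 0, S.zero_mem, rfl⟩
      symm := by
        rintro p p' ⟨q, hq, q', hq', h⟩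
        exact ⟨q', hq', q, hq, h.symm⟩
      trans := by
        rintro p p' p'' ⟨q, hq, q', hq', h⟩ ⟨r, hr, r', hr', h'⟩
        refine ⟨q + r, S.add_mem hq hr, r' + q', S.add_mem hr' hq', ?_⟩
        rw [← add_assoc, h, add_right_comm, h', add_assoc] }
  add' := by
    rintro a b c d ⟨q, hq, q', hq', h⟩ ⟨r, hr, r', hr', h'⟩
    refine ⟨q + r, S.add_mem hq hr, q' + r', S.add_mem hq' hr', ?_⟩
    rw [add_add_add_comm, h, h', add_add_add_comm]

/-- A morphism `ρ : Q → ℕ`, extended to `Q^gp → ℤ`. -/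
def extendDual {Q : Type*} [AddCommMonoid Q] (ρ : Q →+ ℕ) : Gp Q →+ ℤ :=
  Algebra.GrothendieckAddGroup.lift ((Nat.castAddMonoidHom ℤ).comp ρ)

/-- The submonoid `{ρ ∈ Q^∨ : ρ(β_i) = 0 for all i}` of the dual monoid
`Q^∨ = Hom(Q, ℕ)`. -/
def annihilator {Q : Type*} [AddCommMonoid Q] {k : ℕ} (β : Fin k → Gp Q) :
    AddSubmonoid (Q →+ ℕ) where
  carrier := {ρ | ∀ i, extendDual ρ (β i) = 0}
  zero_mem' := by
    intro i
    have : extendDual (0 : Q →+ ℕ) = 0 := by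
      apply Algebra.GrothendieckAddGroup.lift.symm.injective
      rw [extendDual, Equiv.symm_apply_apply]
      rfl
    rw [this]; rfl
  add_mem' := by
    intro a b ha hb i
    have h1 : ∀ c : Q →+ ℕ, (extendDual c).comp (toGp Q) = (Nat.castAddMonoidHom ℤ).comp c :=
      fun c => Algebra.GrothendieckAddGroup.lift.symm_apply_apply _
    have : extendDual (a + b) = extendDual a + extendDual b := by
      apply Algebra.GrothendieckAddGroup.lift.symm.injective
      change (extendDual (a + b)).comp (toGp Q) = (extendDual a + extendDual b).comp (toGp Q)
      rw [AddMonoidHom.add_comp, h1, h1, h1, AddMonoidHom.comp_add]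
    rw [this, AddMonoidHom.add_apply, ha i, hb i, add_zero]

/-! ### The model spaces -/

/-- The space `X_Q` of monoid morphisms `x : (Q, +) → ([0, ∞), ·)`. As a subspace of `Q → ℝ`
with the product topology it has the weakest topology for which every `λ_q : x ↦ x q` is
continuous. -/
abbrev XSpace (Q : Type*) [AddCommMonoid Q] : Type _ :=
  {x : Q → ℝ // (∀ p, 0 ≤ x p) ∧ x 0 = 1 ∧ ∀ p q, x (p + q) = x p * x q}

/-- The model space `X_Q × ℝⁿ`. -/
abbrev Model (Q : Type*) [AddCommMonoid Q] (n : ℕ) : Type _ := XSpace Q × (Fin n → ℝ)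

section Models

variable {Q : Type*} [AddCommMonoid Q] {n : ℕ}

/-- The function `λ_q : X_Q × ℝⁿ → [0, ∞)`. -/
def lam (q : Q) (u : Model Q n) : ℝ := u.1.1 q

/-- The interior `X_Q° × ℝⁿ`, where `X_Q°` is the set of morphisms `Q → (0, ∞)`. -/
def interiorSet (Q : Type*) [AddCommMonoid Q] (n : ℕ) : Set (Model Q n) :=
  {u | ∀ q : Q, 0 < lam q u}

open Classical in
/-- The vertex `δ₀ ∈ X_Q`, with `δ₀(0) = 1` and `δ₀(q) = 0` for `q ≠ 0`. -/
def vertex (Q : Type*) [AddCommMonoid Q] [IsToric Q] : XSpace Q :=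
  ⟨fun q => if q = 0 then 1 else 0, by
    refine ⟨fun p => ?_, if_pos rfl, fun p q => ?_⟩
    · dsimp only
      split_ifs <;> norm_num
    · dsimp only
      by_cases hp : p = 0
      · simp [hp]
      · have : p + q ≠ 0 := fun h => hp (IsToric.sharp p q h)
        simp [hp, this]⟩

/-- The point `(δ₀, 0)` of `X_Q × ℝⁿ`. -/
def origin (Q : Type*) [AddCommMonoid Q] [IsToric Q] (n : ℕ) : Model Q n := (vertex Q, 0)

/-! ### Smooth functions and interior functions -/

/-- The coordinates `((λ_q)_{q ∈ s}, z)` on `X_Q × ℝⁿ`, for a finite set `s ⊆ Q`. -/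
def coords (s : Finset Q) (u : Model Q n) : (s → ℝ) × (Fin n → ℝ) := (fun q => lam q.1 u, u.2)

/-- Near `x`, the map `f` is a smooth function of `(λ_q)_{q ∈ s}` and `z`, where smooth means
smooth on an open subset of `ℝ^s × ℝⁿ`. -/
def SmoothVia (s : Finset Q) {E : Type*} [NormedAddCommGroup E] [NormedSpace ℝ E]
    (f : Model Q n → E) (x : Model Q n) : Prop :=
  ∃ (W : Set ((s → ℝ) × (Fin n → ℝ))) (g : (s → ℝ) × (Fin n → ℝ) → E),
    IsOpen W ∧ ContDiffOn ℝ ∞ g W ∧ ∀ᶠ u in 𝓝 x, coords s u ∈ W ∧ f u = g (coords s u)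

/-- The map `f` is smooth near the point `x` of `X_Q × ℝⁿ`. -/
def SmoothAt {E : Type*} [NormedAddCommGroup E] [NormedSpace ℝ E]
    (f : Model Q n → E) (x : Model Q n) : Prop :=
  ∃ s : Finset Q, SmoothVia s f x

/-- The function `f` is, near `x`, an interior function to `[0, ∞)`: it equals `λ_p · h` near
`x` for some `p ∈ Q` and some smooth positive `h`. -/
def InteriorAt (f : Model Q n → ℝ) (x : Model Q n) : Prop :=
  ∃ (p : Q) (h : Model Q n → ℝ), SmoothAt h x ∧ ∀ᶠ u in 𝓝 x, 0 < h u ∧ f u = lam p u * h u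

/-- The map `φ : X_P × ℝᵐ → X_Q × ℝⁿ` is, near `x`, an interior map of manifolds with
g-corners. -/
structure InteriorMapAt {P : Type*} [AddCommMonoid P] {m : ℕ} (φ : Model P m → Model Q n)
    (x : Model P m) : Prop where
  continuousAt : ContinuousAt φ x
  interior : ∀ q : Q, InteriorAt (fun u => lam q (φ u)) x
  smooth : SmoothAt (fun u => (φ u).2) x

set_option linter.unusedSectionVars false

variable {E F : Type*} [NormedAddCommGroup E] [NormedSpace ℝ E]
  [NormedAddCommGroup F] [NormedSpace ℝ F] {x : Model Q n}

/-- The projection `ℝ^t × ℝⁿ → ℝ^s × ℝⁿ` for `s ⊆ t`. -/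
def restrictCoords {s t : Finset Q} (hst : s ⊆ t) (n : ℕ) (y : (t → ℝ) × (Fin n → ℝ)) :
    (s → ℝ) × (Fin n → ℝ) := (fun q => y.1 ⟨q.1, hst q.2⟩, y.2)

theorem contDiff_restrictCoords {s t : Finset Q} (hst : s ⊆ t) :
    ContDiff ℝ ∞ (restrictCoords hst n) := by
  unfold restrictCoords
  fun_prop

theorem SmoothVia.mono {s t : Finset Q} (hst : s ⊆ t) {f : Model Q n → E}
    (hf : SmoothVia s f x) : SmoothVia t f x := by
  obtain ⟨W, g, hW, hg, h⟩ := hf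
  refine ⟨restrictCoords hst n ⁻¹' W, g ∘ restrictCoords hst n,
    hW.preimage (contDiff_restrictCoords hst).continuous,
    hg.comp (contDiff_restrictCoords hst).contDiffOn (fun _ hy => hy), ?_⟩
  exact h

theorem SmoothAt.congr {f f' : Model Q n → E} (hf : SmoothAt f x) (h : f' =ᶠ[𝓝 x] f) :
    SmoothAt f' x := by
  obtain ⟨s, W, g, hW, hg, hfg⟩ := hf
  refine ⟨s, W, g, hW, hg, ?_⟩
  filter_upwards [hfg, h] with u hu hu'
  exact ⟨hu.1, hu'.trans hu.2⟩

theorem SmoothAt.comp {f : Model Q n → E} (hf : SmoothAt f x) {O : Set E} (hO : IsOpen O)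
    {G : E → F} (hG : ContDiffOn ℝ ∞ G O) (hx : f x ∈ O) : SmoothAt (fun u => G (f u)) x := by
  obtain ⟨s, W, g, hW, hg, hfg⟩ := hf
  have hcont : Continuous (coords s : Model Q n → _) := by
    exact (continuous_pi fun q : s => (continuous_apply q.1).comp
      (continuous_subtype_val.comp continuous_fst)).prodMk continuous_snd
  have hopen : IsOpen (W ∩ g ⁻¹' O) := hg.continuousOn.isOpen_inter_preimage hW hO
  refine ⟨s, W ∩ g ⁻¹' O, G ∘ g, hopen, ?_, ?_⟩
  · exact hG.comp (hg.mono Set.inter_subset_left) (fun y hy => hy.2)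
  · have hx' := hfg.self_of_nhds
    have : coords s x ∈ W ∩ g ⁻¹' O := ⟨hx'.1, by
      change g (coords s x) ∈ O
      rw [← hx'.2]; exact hx⟩
    filter_upwards [hfg, hcont.continuousAt.preimage_mem_nhds (hopen.mem_nhds this)] with u hu hu'
    exact ⟨hu', by rw [hu.2]; rfl⟩

theorem SmoothAt.prodMk {f : Model Q n → E} {f' : Model Q n → F} (hf : SmoothAt f x)
    (hf' : SmoothAt f' x) : SmoothAt (fun u => (f u, f' u)) x := by
  classical
  obtain ⟨s, hs⟩ := hf
  obtain ⟨s', hs'⟩ := hf'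
  obtain ⟨W, g, hW, hg, h⟩ := hs.mono (Finset.subset_union_left (s₂ := s'))
  obtain ⟨W', g', hW', hg', h'⟩ := hs'.mono (Finset.subset_union_right (s₁ := s))
  refine ⟨s ∪ s', W ∩ W', fun y => (g y, g' y), hW.inter hW',
    (hg.mono Set.inter_subset_left).prodMk (hg'.mono Set.inter_subset_right), ?_⟩
  filter_upwards [h, h'] with u hu hu'
  exact ⟨⟨hu.1, hu'.1⟩, by rw [hu.2, hu'.2]⟩

theorem SmoothAt.pi {ι : Type*} [Fintype ι] {f : ι → Model Q n → ℝ}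
    (hf : ∀ i, SmoothAt (f i) x) : SmoothAt (fun u i => f i u) x := by
  classical
  choose s hs using hf
  have hs' : ∀ i, SmoothVia (Finset.univ.biUnion s) (f i) x := fun i =>
    (hs i).mono (Finset.subset_biUnion_of_mem s (Finset.mem_univ i))
  choose W g hW hg h using hs'
  refine ⟨_, ⋂ i, W i, fun y i => g i y, isOpen_iInter_of_finite hW,
    contDiffOn_pi.2 fun i => (hg i).mono (Set.iInter_subset _ i), ?_⟩
  filter_upwards [eventually_all.2 h] with u hu
  exact ⟨Set.mem_iInter.2 fun i => (hu i).1, funext fun i => (hu i).2⟩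

theorem smoothAt_const (c : E) : SmoothAt (fun _ : Model Q n => c) x :=
  ⟨∅, Set.univ, fun _ => c, isOpen_univ, contDiffOn_const, by simp⟩

theorem smoothAt_lam (q : Q) : SmoothAt (lam q : Model Q n → ℝ) x := by
  refine ⟨{q}, Set.univ, fun y => y.1 ⟨q, Finset.mem_singleton_self q⟩, isOpen_univ, ?_, ?_⟩
  · fun_prop
  · exact Eventually.of_forall fun u => ⟨trivial, rfl⟩

theorem smoothAt_snd : SmoothAt (fun u : Model Q n => u.2) x :=
  ⟨∅, Set.univ, fun y => y.2, isOpen_univ, contDiff_snd.contDiffOn,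
    Eventually.of_forall fun _ => ⟨trivial, rfl⟩⟩

theorem smoothAt_coord (a : Fin n) : SmoothAt (fun u : Model Q n => u.2 a) x :=
  smoothAt_snd.comp isOpen_univ
    (G := fun z : Fin n → ℝ => z a) (contDiff_apply ℝ ℝ a).contDiffOn trivial

theorem SmoothAt.add {f f' : Model Q n → ℝ} (hf : SmoothAt f x) (hf' : SmoothAt f' x) :
    SmoothAt (fun u => f u + f' u) x :=
  (hf.prodMk hf').comp isOpen_univ (G := fun y : ℝ × ℝ => y.1 + y.2) (by fun_prop) trivial

theorem SmoothAt.mul {f f' : Model Q n → ℝ} (hf : SmoothAt f x) (hf' : SmoothAt f' x) :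
    SmoothAt (fun u => f u * f' u) x :=
  (hf.prodMk hf').comp isOpen_univ (G := fun y : ℝ × ℝ => y.1 * y.2) (by fun_prop) trivial

theorem SmoothAt.exp {f : Model Q n → ℝ} (hf : SmoothAt f x) :
    SmoothAt (fun u => Real.exp (f u)) x :=
  hf.comp isOpen_univ (G := Real.exp) Real.contDiff_exp.contDiffOn trivial

theorem lam_zero (u : Model Q n) : lam 0 u = 1 := u.1.2.2.1

theorem lam_add (p q : Q) (u : Model Q n) : lam (p + q) u = lam p u * lam q u := u.1.2.2.2 p q

theorem InteriorAt.smoothAt {f : Model Q n → ℝ} (hf : InteriorAt f x) : SmoothAt f x := by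
  obtain ⟨p, h, hh, hf⟩ := hf
  exact ((smoothAt_lam p).mul hh).congr (hf.mono fun u hu => hu.2)

theorem InteriorAt.congr {f f' : Model Q n → ℝ} (hf : InteriorAt f x) (h : f' =ᶠ[𝓝 x] f) :
    InteriorAt f' x := by
  obtain ⟨p, g, hg, hfg⟩ := hf
  refine ⟨p, g, hg, ?_⟩
  filter_upwards [hfg, h] with u hu hu'
  exact ⟨hu.1, hu'.trans hu.2⟩

theorem interiorAt_lam (q : Q) : InteriorAt (lam q : Model Q n → ℝ) x :=
  ⟨q, fun _ => 1, smoothAt_const 1, by simp⟩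

theorem SmoothAt.interiorAt {f : Model Q n → ℝ} (hf : SmoothAt f x)
    (hpos : ∀ᶠ u in 𝓝 x, 0 < f u) : InteriorAt f x :=
  ⟨0, f, hf, hpos.mono fun u hu => ⟨hu, by rw [lam_zero, one_mul]⟩⟩

theorem InteriorAt.mul {f f' : Model Q n → ℝ} (hf : InteriorAt f x) (hf' : InteriorAt f' x) :
    InteriorAt (fun u => f u * f' u) x := by
  obtain ⟨p, h, hh, hfh⟩ := hf
  obtain ⟨p', h', hh', hfh'⟩ := hf'
  refine ⟨p + p', _, hh.mul hh', ?_⟩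
  filter_upwards [hfh, hfh'] with u hu hu'
  refine ⟨mul_pos hu.1 hu'.1, ?_⟩
  rw [hu.2, hu'.2, lam_add]
  ring

/-! Pull-backs along interior maps. -/

section Pullback

variable {P : Type*} [AddCommMonoid P] {m : ℕ} {φ : Model P m → Model Q n} {y : Model P m}

theorem SmoothAt.pullback {f : Model Q n → E} (hφ : InteriorMapAt φ y)
    (hf : SmoothAt f (φ y)) : SmoothAt (fun u => f (φ u)) y := by
  obtain ⟨s, W, g, hW, hg, hfg⟩ := hf
  have h1 : SmoothAt (fun u => coords s (φ u)) y :=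
    (SmoothAt.pi (f := fun (q : s) u => lam q.1 (φ u))
      fun q => (hφ.interior q.1).smoothAt).prodMk hφ.smooth
  refine (h1.comp hW hg hfg.self_of_nhds.1).congr ?_
  filter_upwards [hφ.continuousAt.eventually hfg] with u hu
  exact hu.2

theorem InteriorAt.pullback {f : Model Q n → ℝ} (hφ : InteriorMapAt φ y)
    (hf : InteriorAt f (φ y)) : InteriorAt (fun u => f (φ u)) y := by
  obtain ⟨p, h, hh, hfh⟩ := hf
  have h1 : InteriorAt (fun u => h (φ u)) y := (hh.pullback hφ).interiorAt
    ((hφ.continuousAt.eventually hfh).mono fun u hu => hu.1)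
  refine ((hφ.interior p).mul h1).congr ?_
  filter_upwards [hφ.continuousAt.eventually hfh] with u hu
  exact hu.2

end Pullback

/-! ### Germs and b-tangent spaces -/

/-- The space `C^∞_x` of germs at `x` of smooth real functions. -/
def smoothGerm (x : Model Q n) : Submodule ℝ (Germ (𝓝 x) ℝ) where
  carrier := {a | ∃ f : Model Q n → ℝ, SmoothAt f x ∧ a = (f : Germ (𝓝 x) ℝ)}
  zero_mem' := ⟨fun _ => 0, smoothAt_const 0, rfl⟩
  add_mem' := by
    rintro _ _ ⟨f, hf, rfl⟩ ⟨f', hf', rfl⟩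
    exact ⟨_, hf.add hf', rfl⟩
  smul_mem' := by
    rintro c _ ⟨f, hf, rfl⟩
    exact ⟨_, (smoothAt_const c).mul hf, rfl⟩

theorem smoothGerm_mul {a b : Germ (𝓝 x) ℝ} (ha : a ∈ smoothGerm x) (hb : b ∈ smoothGerm x) :
    a * b ∈ smoothGerm x := by
  obtain ⟨f, hf, rfl⟩ := ha
  obtain ⟨f', hf', rfl⟩ := hb
  exact ⟨_, hf.mul hf', rfl⟩

/-- The monoid `I_x` (under multiplication) of germs at `x` of interior functions to
`[0, ∞)`. -/
def interiorGerm (x : Model Q n) : Submonoid (Germ (𝓝 x) ℝ) where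
  carrier := {a | ∃ f : Model Q n → ℝ, InteriorAt f x ∧ a = (f : Germ (𝓝 x) ℝ)}
  one_mem' := ⟨fun _ => 1,
    (smoothAt_const 1).interiorAt (Eventually.of_forall fun _ => one_pos), rfl⟩
  mul_mem' := by
    rintro _ _ ⟨f, hf, rfl⟩ ⟨f', hf', rfl⟩
    exact ⟨_, hf.mul hf', rfl⟩

theorem interiorGerm_le_smoothGerm {a : Germ (𝓝 x) ℝ} (ha : a ∈ interiorGerm x) :
    a ∈ smoothGerm x := by
  obtain ⟨f, hf, rfl⟩ := ha
  exact ⟨f, hf.smoothAt, rfl⟩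

theorem exp_mem_interiorGerm {a : Germ (𝓝 x) ℝ} (ha : a ∈ smoothGerm x) :
    a.map Real.exp ∈ interiorGerm x := by
  obtain ⟨f, hf, rfl⟩ := ha
  exact ⟨_, hf.exp.interiorAt (Eventually.of_forall fun _ => Real.exp_pos _), rfl⟩

/-- The germ of a smooth function. -/
def SmoothAt.germ {f : Model Q n → ℝ} (hf : SmoothAt f x) : smoothGerm x := ⟨f, f, hf, rfl⟩

/-- The germ of an interior function, in the monoid `I_x` written additively. -/
def InteriorAt.germ {f : Model Q n → ℝ} (hf : InteriorAt f x) : Additive (interiorGerm x) :=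
  Additive.ofMul ⟨f, f, hf, rfl⟩

/-- `v : C^∞_x → ℝ` is a derivation at `x`. -/
def IsDerivation (v : smoothGerm x →ₗ[ℝ] ℝ) : Prop :=
  ∀ a b : smoothGerm x, v ⟨a.1 * b.1, smoothGerm_mul a.2 b.2⟩ =
    v a * b.1.value + a.1.value * v b

/-- The b-tangent space at `x`: pairs `(v, v')` of a derivation `v : C^∞_x → ℝ` at `x` and a
monoid morphism `v' : I_x → (ℝ, +)`, such that `v'(exp a) = v(a)` for `a ∈ C^∞_x` and
`v(b) = b(x) v'(b)` for `b ∈ I_x`. -/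
def BTangent (x : Model Q n) :
    Submodule ℝ ((smoothGerm x →ₗ[ℝ] ℝ) × (Additive (interiorGerm x) →+ ℝ)) where
  carrier := {w | IsDerivation w.1 ∧
    (∀ a : smoothGerm x,
      w.2 (Additive.ofMul ⟨a.1.map Real.exp, exp_mem_interiorGerm a.2⟩) = w.1 a) ∧
    (∀ b : interiorGerm x,
      w.1 ⟨b.1, interiorGerm_le_smoothGerm b.2⟩ = b.1.value * w.2 (Additive.ofMul b))}
  zero_mem' := by
    refine ⟨fun a b => ?_, fun a => ?_, fun b => ?_⟩ <;> simp
  add_mem' := by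
    rintro w w' ⟨h1, h2, h3⟩ ⟨h1', h2', h3'⟩
    refine ⟨fun a b => ?_, fun a => ?_, fun b => ?_⟩
    · have := h1 a b
      have := h1' a b
      simp only [Prod.fst_add, LinearMap.add_apply] at *
      linarith
    · simp only [Prod.fst_add, Prod.snd_add, LinearMap.add_apply, AddMonoidHom.add_apply, h2, h2']
    · simp only [Prod.fst_add, Prod.snd_add, LinearMap.add_apply, AddMonoidHom.add_apply, h3, h3']
      ring
  smul_mem' := by
    rintro c w ⟨h1, h2, h3⟩
    refine ⟨fun a b => ?_, fun a => ?_, fun b => ?_⟩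
    · have := h1 a b
      simp only [Prod.smul_fst, LinearMap.smul_apply, smul_eq_mul] at *
      rw [this]
      ring
    · simp only [Prod.smul_fst, Prod.smul_snd, LinearMap.smul_apply, AddMonoidHom.smul_apply, h2]
    · simp only [Prod.smul_fst, Prod.smul_snd, LinearMap.smul_apply, AddMonoidHom.smul_apply, h3,
        smul_eq_mul]
      ring

/-- The b-cotangent space at `x`. -/
abbrev BCotangent (x : Model Q n) : Type _ := Module.Dual ℝ (BTangent x)

/-- The b-cotangent vector `(v, v') ↦ v'(b)` of a germ `b` of interior functions. -/
def bdiffGerm (b : Additive (interiorGerm x)) : BCotangent x where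
  toFun w := w.1.2 b
  map_add' _ _ := rfl
  map_smul' _ _ := rfl

/-- The differential `ᵇdf|_x = d log f|_x` of an interior function `f` to `[0, ∞)`, as a
b-cotangent vector. -/
def bdiff {f : Model Q n → ℝ} (hf : InteriorAt f x) : BCotangent x := bdiffGerm hf.germ

/-- The differential `dh|_x` of a smooth function, as a b-cotangent vector: `(v, v') ↦ v(h)`. -/
def ddiff {h : Model Q n → ℝ} (hh : SmoothAt h x) : BCotangent x where
  toFun w := w.1.1 hh.germ
  map_add' _ _ := rfl
  map_smul' _ _ := rfl

/-- The morphism `q ↦ [λ_q]` from `Q` to `I_x`. -/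
def lamGerm (x : Model Q n) : Q →+ Additive (interiorGerm x) where
  toFun q := (interiorAt_lam (x := x) q).germ
  map_zero' := by
    apply Additive.toMul.injective
    apply Subtype.ext
    change ((lam 0 : Model Q n → ℝ) : Germ (𝓝 x) ℝ) = ((fun _ => 1 : Model Q n → ℝ) : Germ _ ℝ)
    congr 1
    exact funext lam_zero
  map_add' p q := by
    apply Additive.toMul.injective
    apply Subtype.ext
    change ((lam (p + q) : Model Q n → ℝ) : Germ (𝓝 x) ℝ) =
      ((fun u => lam p u * lam q u : Model Q n → ℝ) : Germ _ ℝ)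
    congr 1
    exact funext (lam_add p q)

/-- The morphism `q ↦ ᵇdλ_q|_x`. -/
def bdiffLam (x : Model Q n) : Q →+ BCotangent x where
  toFun q := bdiff (interiorAt_lam (x := x) q)
  map_zero' := by
    ext w
    exact (congrArg w.1.2 (lamGerm x).map_zero).trans w.1.2.map_zero
  map_add' p q := by
    ext w
    exact (congrArg w.1.2 ((lamGerm x).map_add p q)).trans (w.1.2.map_add _ _)

/-- The map `(Q ⊗ ℝ) ⊕ ℝⁿ → ᵇT*_x`, taking `[q]` to `ᵇdλ_q|_x` and the `a`-th basis vector of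
`ℝⁿ` to `dz_a|_x`. -/
def bCotangentMap (x : Model Q n) : (ℝ ⊗[ℤ] Gp Q) × (Fin n → ℝ) →ₗ[ℝ] BCotangent x :=
  LinearMap.coprod
    (LinearMap.liftBaseChange ℝ
      (Algebra.GrothendieckAddGroup.lift (bdiffLam x)).toIntLinearMap)
    (Fintype.linearCombination ℝ fun a => ddiff (smoothAt_coord (x := x) a))

/-! ### The monoids `M̃_x` -/

/-- The monoid `M̃_x` of monoid morphisms `α : I_x → ℕ` which vanish on germs `c` with
`c(x) > 0`. -/
def cornerMonoid (x : Model Q n) : AddSubmonoid (Additive (interiorGerm x) →+ ℕ) where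
  carrier := {α | ∀ c : interiorGerm x, 0 < c.1.value → α (Additive.ofMul c) = 0}
  zero_mem' _ _ := rfl
  add_mem' := by
    intro a b ha hb c hc
    rw [AddMonoidHom.add_apply, ha c hc, hb c hc]

/-- The identification `M̃_x → Q^∨` for `x = (δ₀, 0)`, taking `α` to `q ↦ α([λ_q])`. -/
def toDual (x : Model Q n) : cornerMonoid x →+ (Q →+ ℕ) where
  toFun α := α.1.comp (lamGerm x)
  map_zero' := rfl
  map_add' _ _ := rfl

/-! ### Depth strata -/

/-- The monoid of `p ∈ Q` with `λ_p(u) ≠ 0`. -/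
def supp (u : Model Q n) : AddSubmonoid Q where
  carrier := {p | lam p u ≠ 0}
  zero_mem' := by
    change lam 0 u ≠ 0
    rw [lam_zero]
    exact one_ne_zero
  add_mem' := by
    intro p q hp hq
    change lam (p + q) u ≠ 0
    rw [lam_add]
    exact mul_ne_zero hp hq

/-- The depth of a point of `X_Q × ℝⁿ`. -/
def depth (u : Model Q n) : ℤ := (rank Q : ℤ) - rank (supp u)

/-- The tangent space at `x` of the depth stratum through `x`. This stratum is locally an
embedded submanifold, whose smooth functions are the restrictions of smooth functions; so its
tangent vectors at `x` are the derivations of `C^∞_x` which vanish on germs of functions that are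
zero on the stratum. -/
def stratumTangent (x : Model Q n) : Submodule ℝ (smoothGerm x →ₗ[ℝ] ℝ) where
  carrier := {v | IsDerivation v ∧ ∀ (h : Model Q n → ℝ) (hh : SmoothAt h x),
    (∀ᶠ u in 𝓝 x, depth u = depth x → h u = 0) → v hh.germ = 0}
  zero_mem' := by
    refine ⟨fun a b => ?_, fun h hh _ => rfl⟩
    simp
  add_mem' := by
    rintro w w' ⟨h1, h2⟩ ⟨h1', h2'⟩
    refine ⟨fun a b => ?_, fun h hh hz => ?_⟩
    · rw [LinearMap.add_apply, h1, h1', LinearMap.add_apply, LinearMap.add_apply]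
      ring
    · rw [LinearMap.add_apply, h2 h hh hz, h2' h hh hz, add_zero]
  smul_mem' := by
    rintro c w ⟨h1, h2⟩
    refine ⟨fun a b => ?_, fun h hh hz => ?_⟩
    · simp only [LinearMap.smul_apply, h1 a b, smul_eq_mul]
      ring
    · rw [LinearMap.smul_apply, h2 h hh hz, smul_zero]

/-! ### Interior immersions and embeddings -/

section Maps

variable {P : Type*} [AddCommMonoid P] {m : ℕ} {φ : Model P m → Model Q n} {y : Model P m}

theorem pullback_smoothGerm (hφ : InteriorMapAt φ y) {a : Germ (𝓝 (φ y)) ℝ}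
    (ha : a ∈ smoothGerm (φ y)) : a.compTendsto φ hφ.continuousAt ∈ smoothGerm y := by
  obtain ⟨f, hf, rfl⟩ := ha
  exact ⟨_, hf.pullback hφ, rfl⟩

theorem pullback_interiorGerm (hφ : InteriorMapAt φ y) {a : Germ (𝓝 (φ y)) ℝ}
    (ha : a ∈ interiorGerm (φ y)) : a.compTendsto φ hφ.continuousAt ∈ interiorGerm y := by
  obtain ⟨f, hf, rfl⟩ := ha
  exact ⟨_, hf.pullback hφ, rfl⟩

/-- The pull-back `φ* : C^∞_{φ(y)} → C^∞_y`, `[f] ↦ [f ∘ φ]`. -/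
def pullSmooth (hφ : InteriorMapAt φ y) : smoothGerm (φ y) →ₗ[ℝ] smoothGerm y where
  toFun a := ⟨a.1.compTendsto φ hφ.continuousAt, pullback_smoothGerm hφ a.2⟩
  map_add' := by
    rintro ⟨_, f, hf, rfl⟩ ⟨_, f', hf', rfl⟩
    rfl
  map_smul' := by
    rintro c ⟨_, f, hf, rfl⟩
    rfl

/-- The pull-back `φ* : I_{φ(y)} → I_y`, `[c] ↦ [c ∘ φ]`. -/
def pullInterior (hφ : InteriorMapAt φ y) :
    Additive (interiorGerm (φ y)) →+ Additive (interiorGerm y) :=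
  MonoidHom.toAdditive
    { toFun := fun a =>
        (⟨a.1.compTendsto φ hφ.continuousAt, pullback_interiorGerm hφ a.2⟩ : interiorGerm y)
      map_one' := rfl
      map_mul' := by
        rintro ⟨_, f, hf, rfl⟩ ⟨_, f', hf', rfl⟩
        rfl }

/-- The morphism `M̃_y φ : M̃_y → M̃_{φ(y)}`, `α ↦ α ∘ φ*`. -/
def cornerMap (hφ : InteriorMapAt φ y) : cornerMonoid y →+ cornerMonoid (φ y) where
  toFun α := ⟨α.1.comp (pullInterior hφ), by
    rintro ⟨_, f, hf, rfl⟩ hc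
    exact α.2 _ hc⟩
  map_zero' := rfl
  map_add' _ _ := rfl

/-- The map `φ` is an interior immersion at `y`: it is an interior map near `y`, and
(i) its differential on tangent spaces of depth strata (acting on derivations by `v ↦ v ∘ φ*`) is
injective; (ii) `M̃_y φ` is injective; (iii) the quotient monoid of `M̃_{φ(y)}` by the image of
`M̃_y φ` is torsion-free, i.e. its group completion is torsion-free. -/
def InteriorImmersionAt (φ : Model P m → Model Q n) (y : Model P m) : Prop :=
  ∃ hφ : InteriorMapAt φ y,
    Set.InjOn (fun v : smoothGerm y →ₗ[ℝ] ℝ => v ∘ₗ pullSmooth hφ) (stratumTangent y) ∧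
    Function.Injective (cornerMap hφ) ∧
    IsAddTorsionFree (Gp (quotCon (AddMonoidHom.mrange (cornerMap hφ))).Quotient)

/-- The restriction of `φ` to the open set `U` is an interior embedding: an interior immersion
which is a homeomorphism onto its image. -/
def IsInteriorEmbeddingOn (φ : Model P m → Model Q n) (U : Set (Model P m)) : Prop :=
  (∀ y ∈ U, InteriorImmersionAt φ y) ∧ IsEmbedding (U.domRestrict φ)

end Maps

end Models

/-- The set `X° = {v ∈ V° : f_i(v) = g_i(v), h_j(v) = 0}`. -/
def interiorSolutions {Q : Type*} [AddCommMonoid Q] {n k l : ℕ} (V : Set (Model Q n))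
    (f g : Fin k → Model Q n → ℝ) (h : Fin l → Model Q n → ℝ) : Set (Model Q n) :=
  {v | v ∈ V ∧ v ∈ interiorSet Q n ∧ (∀ i, f i v = g i v) ∧ ∀ j, h j v = 0}

/-- The closure `X` of `X°` in `V`. -/
def solutions {Q : Type*} [AddCommMonoid Q] {n k l : ℕ} (V : Set (Model Q n))
    (f g : Fin k → Model Q n → ℝ) (h : Fin l → Model Q n → ℝ) : Set (Model Q n) :=
  closure (interiorSolutions V f g h) ∩ V

end GCorners

end

universe u

open GCorners

noncomputable section

set_option linter.unusedSectionVars false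

namespace GCorners

/-! ### Group completions -/

section Gp

variable {A : Type*} [AddCommMonoid A]

/-! Near the vertex write f_i = λ_{p_i}·a_i and g_i = λ_{q_i}·b_i with a_i, b_i smooth and positive.
In the interior, f_i = g_i reads log λ_{β_i} + H_i = 0 with β_i = p_i − q_i and H_i = log a_i − log
b_i (`exists_equations`). Since λ_q vanishes at the vertex for q ≠ 0, the b-differential of this
equation there is β_i ⊕ ∂_z H_i, and the dh_j have only a z-part.

The β_i may be dependent. Choose a basis β_{a(t)} of their real span and write β_i = Σ c_{it}
β_{a(t)}. The remaining equations become smooth ones, H_i − Σ c_{it} H_{a(t)} = 0, whose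
z-differentials are independent together with those of the h_j (`linearIndependent_reduce`). With
morphisms e_t : Q^gp → ℝ dual to the β_{a(t)}, the substitution λ_s ↦ λ_s·exp(Σ_t e_t(s) H_{a(t)}),
completed by the smooth equations and complementary linear functions of z, is a local diffeomorphism
of ℝ^S × ℝⁿ (`exists_straightening`). It multiplies a point of X_Q by the exponential of a morphism,
so it respects X_Q, and it turns the equations into λ_{β_{a(t)}} = 1 and the vanishing of some real
coordinates.

The straightened problem is about monoids only. Let P be the saturation of the image of Q in Q^gp
modulo the elements lying in the real span of the β_i (`exists_quotient_monoid`). Interior solutions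
are the morphisms to (0, ∞) that factor through P. As X_P is closed in X_Q
(`isClosedEmbedding_xmap`) and its interior is dense (`dense_interiorSet`), the closure of the
interior solutions is X_P times a Euclidean factor (`Straightening.image_param`). Morphisms Q → ℕ
killing the β_i descend to P, which identifies P^∨ with B.

P is sharp exactly when no nonzero q ∈ Q lies in the real span of the β_i. If the vertex is in X, a
relation q = Σ c_i β_i gives λ_q = exp(−Σ c_i H_i) on interior solutions, hence at the vertex, so q
= 0; the case q = 0 also shows that the smooth equations hold at the vertex (`lam_origin_eq_exp`).
By duality, sharpness means that B lies in no proper face (`eq_top_of_annihilator_le`,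
`eq_zero_of_not_annihilator_le`). For independent β_i no equations are left over, so the same
parametrization then puts the vertex in X. -/

theorem exists_toGp_sub (x : Gp A) : ∃ a b : A, x = toGp A a - toGp A b := by
  induction x using AddLocalization.ind with
  | H y =>
    refine ⟨y.1, y.2, ?_⟩
    rw [AddLocalization.mk_eq_addMonoidOf_mk', eq_sub_iff_add_eq]
    exact AddSubmonoid.LocalizationMap.mk'_spec _ _ _

theorem toGp_eq_iff {a b : A} : toGp A a = toGp A b ↔ ∃ c, c + a = c + b := by
  have := AddSubmonoid.LocalizationMap.eq_iff_exists
    (AddLocalization.addMonoidOf (⊤ : AddSubmonoid A)) (x := a) (y := b)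
  constructor
  · intro h
    obtain ⟨c, hc⟩ := this.1 h
    exact ⟨c, hc⟩
  · rintro ⟨c, hc⟩
    exact this.2 ⟨⟨c, trivial⟩, hc⟩

theorem lift_toGp {G : Type*} [AddCommGroup G] (f : A →+ G) (a : A) :
    Algebra.GrothendieckAddGroup.lift f (toGp A a) = f a :=
  DFunLike.congr_fun (Algebra.GrothendieckAddGroup.lift.symm_apply_apply f) a

theorem extendDual_toGp (ρ : A →+ ℕ) (a : A) : extendDual ρ (toGp A a) = ρ a :=
  lift_toGp _ a

end Gp

/-- Gordan's alternative over the integers: finitely many elements of a finitely generated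
abelian group either lie in an open half-space or satisfy a nontrivial relation with coefficients
in `ℕ`. -/
theorem exists_pos_or_relation {ι : Type*} (s : Finset ι) :
    ∀ {L : Type u} [AddCommGroup L] [AddGroup.FG L] (a : ι → L),
      (∃ τ : L →+ ℤ, ∀ i ∈ s, 0 < τ (a i)) ∨
      ∃ c : ι → ℕ, (∃ i ∈ s, c i ≠ 0) ∧ ∑ i ∈ s, c i • a i = 0 := by
  classical
  induction s using Finset.induction_on with
  | empty => intro L _ _ a; exact Or.inl ⟨0, by simp⟩
  | insert j s hj ih =>
    intro L _ _ a
    have extend : ∀ c : ι → ℕ, ∀ d : ℕ, (∑ i ∈ insert j s, (Function.update c j d) i • a i)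
        = d • a j + ∑ i ∈ s, c i • a i := by
      intro c d
      rw [Finset.sum_insert hj, Function.update_self]
      congr 1
      refine Finset.sum_congr rfl fun i hi => ?_
      rw [Function.update_of_ne (by rintro rfl; exact hj hi)]
    have extend_ne : ∀ c : ι → ℕ, ∀ d : ℕ, (∃ i ∈ s, c i ≠ 0) →
        ∃ i ∈ insert j s, (Function.update c j d) i ≠ 0 := by
      rintro c d ⟨i, hi, hc⟩
      refine ⟨i, Finset.mem_insert_of_mem hi, ?_⟩
      rwa [Function.update_of_ne (by rintro rfl; exact hj hi)]
    rcases ih a with ⟨ρ, hρ⟩ | ⟨c, hc, hs⟩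
    swap
    · exact Or.inr ⟨Function.update c j 0, extend_ne c 0 hc, by rw [extend, hs]; simp⟩
    by_cases htor : ∃ n : ℕ, n ≠ 0 ∧ n • a j = 0
    · obtain ⟨n, hn, hna⟩ := htor
      refine Or.inr ⟨Function.update 0 j n, ⟨j, Finset.mem_insert_self _ _, by simpa⟩, ?_⟩
      rw [extend, hna]; simp
    obtain ⟨τ, hτ⟩ : ∃ τ : L →+ ℤ, 0 < τ (a j) := by
      have hfin : Module.Finite ℤ L := Module.Finite.iff_addGroup_fg.2 ‹_›
      let T := Submodule.torsion ℤ L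
      have hne : T.mkQ (a j) ≠ 0 := by
        intro h0
        rw [Submodule.mkQ_apply, Submodule.Quotient.mk_eq_zero] at h0
        obtain ⟨⟨z, hz⟩, hza⟩ := (Submodule.mem_torsion_iff (a j)).1 h0
        refine htor ⟨z.natAbs, by simpa using nonZeroDivisors.ne_zero hz, ?_⟩
        change z • a j = 0 at hza
        rcases Int.natAbs_eq z with h | h
        · rw [h] at hza; simpa using hza
        · rw [h] at hza; simpa using hza
      have : Module.Free ℤ (L ⧸ T) := inferInstance
      obtain ⟨f, hf⟩ : ∃ f : Module.Dual ℤ (L ⧸ T), f (T.mkQ (a j)) ≠ 0 := by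
        by_contra! hcon
        exact hne ((Module.forall_dual_apply_eq_zero_iff ℤ _).1 hcon)
      rcases lt_or_gt_of_ne hf with h | h
      · exact ⟨(-(f ∘ₗ T.mkQ)).toAddMonoidHom, by simpa using h⟩
      · exact ⟨(f ∘ₗ T.mkQ).toAddMonoidHom, by simpa using h⟩
    -- The induction hypothesis is used again in the quotient by a_j. A functional σ positive there
    -- is zero on a_j, so Kσ + τ with K large is positive on everything.
    let N := AddSubgroup.zmultiples (a j)
    have : AddGroup.FG (L ⧸ N) := QuotientAddGroup.fg N
    rcases ih (fun i => (QuotientAddGroup.mk' N) (a i)) with ⟨σ, hσ⟩ | ⟨c, hc, hs⟩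
    · obtain ⟨K, hK⟩ : ∃ K : ℕ, ∀ i ∈ s, -τ (a i) < K := by
        refine ⟨s.sup (fun i => (-τ (a i)).toNat) + 1, fun i hi => ?_⟩
        have := Finset.le_sup (f := fun i => (-τ (a i)).toNat) hi
        have h2 := Int.self_le_toNat (-τ (a i))
        push_cast
        have : ((-τ (a i)).toNat : ℤ) ≤ (s.sup (fun i => (-τ (a i)).toNat) : ℕ) := by
          exact_mod_cast this
        linarith
      refine Or.inl ⟨K • (σ.comp (QuotientAddGroup.mk' N)) + τ, fun i hi => ?_⟩
      rcases Finset.mem_insert.1 hi with rfl | hi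
      · have h0 : (QuotientAddGroup.mk' N) (a i) = 0 :=
          (QuotientAddGroup.eq_zero_iff _).2 (AddSubgroup.mem_zmultiples _)
        simp only [AddMonoidHom.add_apply, AddMonoidHom.nsmul_apply, AddMonoidHom.comp_apply, h0]
        simpa using hτ
      · have h1 := hσ i hi
        have h2 := hK i hi
        simp only [AddMonoidHom.add_apply, AddMonoidHom.nsmul_apply, AddMonoidHom.comp_apply]
        rw [nsmul_eq_mul]
        nlinarith
    · have hs' : QuotientAddGroup.mk' N (∑ i ∈ s, c i • a i) = 0 := by
        rw [map_sum, ← hs]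
        exact Finset.sum_congr rfl fun i _ => map_nsmul _ _ _
      obtain ⟨z, hz⟩ := AddSubgroup.mem_zmultiples_iff.1 ((QuotientAddGroup.eq_zero_iff _).1 hs')
      have hpos : 0 < ∑ i ∈ s, (c i : ℤ) * ρ (a i) := by
        obtain ⟨i, hi, hci⟩ := hc
        refine Finset.sum_pos' (fun i hi => ?_) ⟨i, hi, ?_⟩
        · exact mul_nonneg (Int.natCast_nonneg _) (hρ i hi).le
        · exact mul_pos (by positivity) (hρ i hi)
      have hval : z * ρ (a j) = ∑ i ∈ s, (c i : ℤ) * ρ (a i) := by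
        have := congrArg ρ hz
        rw [map_zsmul, map_sum, smul_eq_mul] at this
        rw [this]
        exact Finset.sum_congr rfl fun i _ => by rw [map_nsmul, nsmul_eq_mul]
      -- Here Σ c_i a_i = z a_j. For z ≤ 0 this is itself a relation with coefficients in ℕ; for z >
      -- 0 it forces ρ(a_j) > 0, so ρ already works.
      rcases le_or_gt z 0 with hz0 | hz0
      · refine Or.inr ⟨Function.update c j z.natAbs, extend_ne c _ hc, ?_⟩
        rw [extend, ← hz, ← natCast_zsmul, Int.ofNat_natAbs_of_nonpos hz0, neg_smul,
          neg_add_cancel]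
      · refine Or.inl ⟨ρ, fun i hi => ?_⟩
        rcases Finset.mem_insert.1 hi with rfl | hi
        · by_contra hneg
          nlinarith
        · exact hρ i hi

/-! ### Toric monoids and their faces -/

section Toric

variable {Q : Type*} [AddCommMonoid Q] [IsToric Q]

theorem toric_cancel {a b c : Q} (h : c + a = c + b) : a = b :=
  IsToric.integral (toGp_eq_iff.2 ⟨c, h⟩)

instance : AddGroup.FG (Gp Q) := by
  have := IsToric.fg (Q := Q)
  exact AddGroup.fg_iff_addMonoid_fg.2 (AddLocalization.fg AddMonoid.FG.fg_top)

instance : IsAddTorsionFree (Gp Q) := IsToric.torsionFree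

instance : Module.Finite ℤ (Gp Q) := Module.Finite.iff_addGroup_fg.2 inferInstance

instance : Module.Free ℤ (Gp Q) := inferInstance

variable (Q) in
/-- A toric monoid has a finite set of nonzero generators. -/
theorem exists_generators : ∃ S : Finset Q, AddSubmonoid.closure (S : Set Q) = ⊤ ∧ 0 ∉ S := by
  classical
  obtain ⟨S, hS⟩ := (AddMonoid.fg_def.1 (IsToric.fg (Q := Q)))
  refine ⟨S.erase 0, ?_, by simp⟩
  rw [Finset.coe_erase, AddSubmonoid.closure_sdiff_singleton_zero, hS]

/-- The morphism `A^gp → B^gp` induced by an injective morphism to a cancellative monoid is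
injective. -/
theorem gp_map_injective {A B : Type*} [AddCommMonoid A] [AddCommMonoid B] (j : A →+ B)
    (hj : Function.Injective j) (hB : Function.Injective (toGp B)) :
    Function.Injective (Algebra.GrothendieckAddGroup.lift ((toGp B).comp j)) := by
  rw [injective_iff_map_eq_zero]
  intro x hx
  obtain ⟨a, b, rfl⟩ := exists_toGp_sub x
  rw [map_sub, lift_toGp, lift_toGp, sub_eq_zero] at hx
  rw [hj (hB hx), sub_self]

/-- A nonnegative morphism to `ℤ`, as a morphism to `ℕ`. -/
def toNatHom {A : Type*} [AddCommMonoid A] (τ : A →+ ℤ) (h : ∀ a, 0 ≤ τ a) : A →+ ℕ where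
  toFun a := (τ a).toNat
  map_zero' := by simp
  map_add' a b := by rw [map_add, Int.toNat_add (h a) (h b)]

theorem toNatHom_cast {A : Type*} [AddCommMonoid A] (τ : A →+ ℤ) (h : ∀ a, 0 ≤ τ a) (a : A) :
    (toNatHom τ h a : ℤ) = τ a := Int.toNat_of_nonneg (h a)

theorem mem_of_nsmul_mem {A : Type*} [AddCommMonoid A] {F : AddSubmonoid A} (hF : IsFace F)
    {c : ℕ} (hc : c ≠ 0) {a : A} (h : c • a ∈ F) : a ∈ F := by
  obtain ⟨d, rfl⟩ := Nat.exists_eq_succ_of_ne_zero hc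
  rw [succ_nsmul] at h
  exact (hF _ _ h).2

theorem mem_of_sum_mem {A ι : Type*} [AddCommMonoid A] {F : AddSubmonoid A} (hF : IsFace F)
    {s : Finset ι} {f : ι → A} (h : ∑ i ∈ s, f i ∈ F) {i : ι} (hi : i ∈ s) : f i ∈ F := by
  classical
  rw [← Finset.add_sum_erase s f hi] at h
  exact (hF _ _ h).1

/-! ### Faces as zero sets of morphisms to ℕ -/

section Faces

variable {F : AddSubmonoid Q}

/-- The faces of a toric monoid are the zero sets of morphisms to `ℕ`. -/
theorem exists_face_hom (hF : IsFace F) : ∃ σ : Q →+ ℕ, ∀ q, σ q = 0 ↔ q ∈ F := by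
  classical
  obtain ⟨S, hS, -⟩ := exists_generators Q
  let N : AddSubgroup (Gp Q) := AddSubgroup.closure (toGp Q '' F)
  have hN : ∀ x ∈ N, ∃ a ∈ F, ∃ b ∈ F, x = toGp Q a - toGp Q b := by
    intro x hx
    induction hx using AddSubgroup.closure_induction with
    | mem x hx =>
      obtain ⟨a, ha, rfl⟩ := hx
      exact ⟨a, ha, 0, F.zero_mem, by simp⟩
    | zero => exact ⟨0, F.zero_mem, 0, F.zero_mem, by simp⟩
    | add x y _ _ hx hy =>
      obtain ⟨a, ha, b, hb, rfl⟩ := hx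
      obtain ⟨c, hc, d, hd, rfl⟩ := hy
      exact ⟨a + c, F.add_mem ha hc, b + d, F.add_mem hb hd, by rw [map_add, map_add]; abel⟩
    | neg x _ hx =>
      obtain ⟨a, ha, b, hb, rfl⟩ := hx
      exact ⟨b, hb, a, ha, by abel⟩
  let π : Q →+ Gp Q ⧸ N := (QuotientAddGroup.mk' N).comp (toGp Q)
  have hπ : ∀ q ∈ F, π q = 0 := fun q hq =>
    (QuotientAddGroup.eq_zero_iff _).2 (AddSubgroup.subset_closure ⟨q, hq, rfl⟩)
  have : AddGroup.FG (Gp Q ⧸ N) := QuotientAddGroup.fg N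
  -- Gordan's alternative for the generators outside F, modulo the group generated by F. A
  -- nontrivial relation would put a sum of such generators into F up to adding an element of F,
  -- against the face property.
  rcases exists_pos_or_relation (S.filter (· ∉ F)) π with ⟨τ, hτ⟩ | ⟨c, ⟨i, hi, hci⟩, hs⟩
  · have key : ∀ q : Q, 0 ≤ τ (π q) ∧ (τ (π q) = 0 → q ∈ F) := by
      intro q
      have hq : q ∈ AddSubmonoid.closure (S : Set Q) := by rw [hS]; trivial
      induction hq using AddSubmonoid.closure_induction with
      | mem q hq =>
        by_cases hqF : q ∈ F
        · exact ⟨by rw [hπ q hqF, map_zero], fun _ => hqF⟩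
        · have := hτ q (Finset.mem_filter.2 ⟨hq, hqF⟩)
          exact ⟨this.le, fun h => absurd h this.ne'⟩
      | zero => exact ⟨by simp, fun _ => F.zero_mem⟩
      | add p q _ _ hp hq =>
        rw [map_add, map_add]
        refine ⟨add_nonneg hp.1 hq.1, fun h => F.add_mem (hp.2 ?_) (hq.2 ?_)⟩
        · linarith [hp.1, hq.1]
        · linarith [hp.1, hq.1]
    refine ⟨toNatHom (τ.comp π) fun q => (key q).1, fun q => ?_⟩
    have := toNatHom_cast (τ.comp π) (fun q => (key q).1) q
    rw [← Nat.cast_eq_zero (R := ℤ), this, AddMonoidHom.comp_apply]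
    exact ⟨(key q).2, fun h => by rw [hπ q h, map_zero]⟩
  · exfalso
    have h1 : π (∑ i ∈ S.filter (· ∉ F), c i • i) = 0 := by
      rw [map_sum, ← hs]
      exact Finset.sum_congr rfl fun i _ => map_nsmul _ _ _
    obtain ⟨a, ha, b, hb, hab⟩ := hN _ ((QuotientAddGroup.eq_zero_iff _).1 h1)
    rw [eq_sub_iff_add_eq, ← map_add] at hab
    have h2 := (hF _ _ (by rw [IsToric.integral hab]; exact ha)).1
    exact (Finset.mem_filter.1 hi).2 (mem_of_nsmul_mem hF hci (mem_of_sum_mem hF h2 hi))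

/-- A morphism to `ℤ` which vanishes on a face of a toric monoid is a difference of morphisms to
`ℕ` which vanish on that face. -/
theorem exists_sub_of_vanish (hF : IsFace F) (τ : Q →+ ℤ) (hτ : ∀ q ∈ F, τ q = 0) :
    ∃ ρ₁ ρ₂ : Q →+ ℕ, (∀ q ∈ F, ρ₁ q = 0) ∧ (∀ q ∈ F, ρ₂ q = 0) ∧
      ∀ q, (ρ₁ q : ℤ) = τ q + ρ₂ q := by
  classical
  obtain ⟨σ, hσ⟩ := exists_face_hom hF
  obtain ⟨S, hS, -⟩ := exists_generators Q
  obtain ⟨K, hK⟩ : ∃ K : ℕ, ∀ q ∈ S, -τ q ≤ K := by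
    refine ⟨S.sup (fun q => (-τ q).toNat), fun q hq => ?_⟩
    have := Finset.le_sup (f := fun q => (-τ q).toNat) hq
    exact (Int.self_le_toNat _).trans (by exact_mod_cast this)
  -- Since σ is at least 1 on generators outside F and 0 on F, adding a large multiple of it makes τ
  -- nonnegative without changing it on F.
  have key : ∀ q : Q, 0 ≤ (τ + (Nat.castAddMonoidHom ℤ).comp (K • σ)) q := by
    intro q
    have hq : q ∈ AddSubmonoid.closure (S : Set Q) := by rw [hS]; trivial
    induction hq using AddSubmonoid.closure_induction with
    | mem q hq =>
      simp only [AddMonoidHom.add_apply, AddMonoidHom.comp_apply, Nat.coe_castAddMonoidHom,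
        AddMonoidHom.nsmul_apply, smul_eq_mul, Nat.cast_mul]
      by_cases hqF : q ∈ F
      · simp [hτ q hqF, (hσ q).2 hqF]
      · have : 1 ≤ (σ q : ℤ) := by
          have := Nat.pos_of_ne_zero (mt (hσ q).1 hqF)
          exact_mod_cast this
        have := hK q hq
        nlinarith
    | zero => simp
    | add p q _ _ hp hq =>
      rw [map_add]
      exact add_nonneg hp hq
  refine ⟨toNatHom _ key, K • σ, fun q hq => ?_, fun q hq => ?_, fun q => toNatHom_cast _ _ _⟩
  · rw [← Nat.cast_eq_zero (R := ℤ), toNatHom_cast]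
    simp [hτ q hq, (hσ q).2 hq]
  · simp [(hσ q).2 hq]

end Faces

theorem isFace_bot : IsFace (⊥ : AddSubmonoid Q) := by
  intro p q h
  rw [AddSubmonoid.mem_bot] at h
  refine ⟨IsToric.sharp p q h, IsToric.sharp q p ?_⟩
  rwa [add_comm]

variable (Q) in
/-- A toric monoid has a morphism to `ℕ` which is positive on nonzero elements. -/
theorem exists_pos_hom : ∃ σ : Q →+ ℕ, ∀ q, σ q = 0 ↔ q = 0 := by
  obtain ⟨σ, hσ⟩ := exists_face_hom (isFace_bot (Q := Q))
  exact ⟨σ, fun q => (hσ q).trans AddSubmonoid.mem_bot⟩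

/-- Morphisms to `ℕ` separate the points of a toric monoid. -/
theorem eq_of_forall_hom {p q : Q} (h : ∀ ρ : Q →+ ℕ, ρ p = ρ q) : p = q := by
  apply IsToric.integral
  rw [← sub_eq_zero]
  -- Functionals separate the points of the free group Q^gp, and each restricts to Q as a difference
  -- of two morphisms to ℕ.
  refine (Module.forall_dual_apply_eq_zero_iff ℤ _).1 fun f => ?_
  obtain ⟨ρ₁, ρ₂, -, -, h12⟩ := exists_sub_of_vanish (isFace_bot (Q := Q))
    (f.toAddMonoidHom.comp (toGp Q)) (by
      intro q hq
      rw [AddSubmonoid.mem_bot.1 hq, map_zero])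
  have h1 := h12 p
  have h2 := h12 q
  rw [h ρ₁, h ρ₂] at h1
  have : f (toGp Q p) = f (toGp Q q) := by
    change (f.toAddMonoidHom.comp (toGp Q)) p = (f.toAddMonoidHom.comp (toGp Q)) q
    linarith
  rw [map_sub, this, sub_self]

/-- Morphisms to `ℝ` extend from submonoids of a toric monoid. -/
theorem exists_extend_real (F : AddSubmonoid Q) (g : F →+ ℝ) :
    ∃ ℓ : Q →+ ℝ, ∀ q : F, ℓ q = g q := by
  have hb : Module.Baer ℤ ℝ := Module.Baer.of_divisible _
  obtain ⟨e, he⟩ := hb.extension_property_addMonoidHom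
    (Algebra.GrothendieckAddGroup.lift ((toGp Q).comp F.subtype))
    (gp_map_injective F.subtype Subtype.val_injective IsToric.integral)
    (Algebra.GrothendieckAddGroup.lift g)
  refine ⟨e.comp (toGp Q), fun q => ?_⟩
  have := DFunLike.congr_fun he (toGp F q)
  rw [AddMonoidHom.comp_apply, lift_toGp, lift_toGp] at this
  exact this

end Toric

/-! ### Points, paths and smooth functions of the model spaces -/

section Points

variable {Q : Type*} [AddCommMonoid Q] {n : ℕ} {E : Type*} [NormedAddCommGroup E]
  [NormedSpace ℝ E] {x : Model Q n}

theorem continuous_lam (q : Q) : Continuous (lam q : Model Q n → ℝ) :=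
  (continuous_apply q).comp (continuous_subtype_val.comp continuous_fst)

theorem continuous_coords (s : Finset Q) : Continuous (coords s : Model Q n → _) :=
  (continuous_pi fun q : s => continuous_lam q.1).prodMk continuous_snd

theorem SmoothAt.continuousAt {f : Model Q n → E} (hf : SmoothAt f x) : ContinuousAt f x := by
  obtain ⟨s, W, g, hW, hg, hfg⟩ := hf
  have h1 : ContinuousAt g (coords s x) :=
    hg.continuousOn.continuousAt (hW.mem_nhds hfg.self_of_nhds.1)
  exact (h1.comp (f := coords s) (continuous_coords s).continuousAt).congr
    (hfg.mono fun u hu => hu.2.symm)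

theorem SmoothAt.eventually {f : Model Q n → E} (hf : SmoothAt f x) :
    ∀ᶠ u in 𝓝 x, SmoothAt f u := by
  obtain ⟨s, W, g, hW, hg, hfg⟩ := hf
  exact (eventually_eventually_nhds.2 hfg).mono fun u hu => ⟨s, W, g, hW, hg, hu⟩

theorem SmoothAt.neg {f : Model Q n → ℝ} (hf : SmoothAt f x) : SmoothAt (fun u => -f u) x :=
  hf.comp isOpen_univ (G := fun y : ℝ => -y) (by fun_prop) trivial

theorem SmoothAt.log {f : Model Q n → ℝ} (hf : SmoothAt f x) (h : f x ≠ 0) :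
    SmoothAt (fun u => Real.log (f u)) x :=
  hf.comp (O := {0}ᶜ) isOpen_compl_singleton (G := Real.log) Real.contDiffOn_log h

theorem lam_nonneg (q : Q) (u : Model Q n) : 0 ≤ lam q u := u.1.2.1 q

theorem lam_nsmul (k : ℕ) (q : Q) (u : Model Q n) : lam (k • q) u = lam q u ^ k := by
  induction k with
  | zero => rw [zero_smul, pow_zero, lam_zero]
  | succ k ih => rw [succ_nsmul, lam_add, ih, pow_succ]

theorem isFace_supp (u : Model Q n) : IsFace (supp u) := by
  intro p q h
  change lam (p + q) u ≠ 0 at h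
  rw [lam_add] at h
  exact ⟨left_ne_zero_of_mul h, right_ne_zero_of_mul h⟩

theorem mem_supp {u : Model Q n} {q : Q} : q ∈ supp u ↔ lam q u ≠ 0 := Iff.rfl

/-- The path `t ↦ exp(ℓ)·|t|^σ` in `X_Q`. -/
def xpath (ℓ : Q →+ ℝ) (σ : Q →+ ℕ) (t : ℝ) : XSpace Q :=
  ⟨fun q => Real.exp (ℓ q) * |t| ^ σ q, fun q => by positivity, by simp, fun p q => by
    dsimp only
    rw [map_add, map_add, Real.exp_add, pow_add]; ring⟩

theorem continuous_xpath (ℓ : Q →+ ℝ) (σ : Q →+ ℕ) : Continuous (xpath ℓ σ) := by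
  refine Continuous.subtype_mk (continuous_pi fun q => ?_) _
  fun_prop

theorem xpath_pos (ℓ : Q →+ ℝ) (σ : Q →+ ℕ) {t : ℝ} (ht : t ≠ 0) (z : Fin n → ℝ) :
    (xpath ℓ σ t, z) ∈ interiorSet Q n := fun q => by
  change 0 < Real.exp (ℓ q) * |t| ^ σ q
  have := abs_pos.2 ht
  positivity

/-- The restriction of `X_Q`-valued data along a morphism of monoids. -/
def xmap {P : Type*} [AddCommMonoid P] (θ : Q →+ P) (x : XSpace P) : XSpace Q :=
  ⟨fun q => x.1 (θ q), fun q => x.2.1 _, by dsimp only; rw [map_zero]; exact x.2.2.1, fun p q => by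
    dsimp only
    rw [map_add]; exact x.2.2.2 _ _⟩

theorem continuous_xmap {P : Type*} [AddCommMonoid P] (θ : Q →+ P) : Continuous (xmap θ) :=
  Continuous.subtype_mk
    (continuous_pi fun q => ((continuous_apply (θ q)).comp continuous_subtype_val :
      Continuous fun x : XSpace P => x.1 (θ q))) _

/-- The action of a morphism `Q → ℝ` on `X_Q` by multiplication with its exponential. -/
def twist (ℓ : Q →+ ℝ) (x : XSpace Q) : XSpace Q :=
  ⟨fun q => x.1 q * Real.exp (ℓ q), fun q => mul_nonneg (x.2.1 q) (Real.exp_pos _).le, by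
    dsimp only
    rw [map_zero, Real.exp_zero, x.2.2.1, mul_one], fun p q => by
    dsimp only
    rw [map_add, Real.exp_add, x.2.2.2]; ring⟩

/-- The logarithm of an interior point, as a morphism on the group completion. -/
def logHom {u : Model Q n} (hu : u ∈ interiorSet Q n) : Gp Q →+ ℝ :=
  Algebra.GrothendieckAddGroup.lift
    { toFun := fun q => Real.log (lam q u)
      map_zero' := by rw [lam_zero, Real.log_one]
      map_add' := fun p q => by rw [lam_add, Real.log_mul (hu p).ne' (hu q).ne'] }

theorem logHom_toGp {u : Model Q n} (hu : u ∈ interiorSet Q n) (q : Q) :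
    logHom hu (toGp Q q) = Real.log (lam q u) := lift_toGp _ _

/-- The restriction of a map on germs of smooth functions is determined by representatives. -/
theorem smoothGerm_ext {a b : smoothGerm x} {f f' : Model Q n → ℝ} (ha : a.1 = f) (hb : b.1 = f')
    (h : f =ᶠ[𝓝 x] f') : a = b := by
  apply Subtype.ext
  rw [ha, hb]
  exact Germ.coe_eq.2 h

theorem interiorGerm_ext {f f' : Model Q n → ℝ} (hf : InteriorAt f x) (hf' : InteriorAt f' x)
    (h : f =ᶠ[𝓝 x] f') : hf.germ = hf'.germ :=
  congrArg Additive.ofMul (Subtype.ext (Germ.coe_eq.2 h))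

end Points

/-! ### Approaching points from the interior -/

section ToricPoints

variable {Q : Type*} [AddCommMonoid Q] [IsToric Q] {n : ℕ}

/-- The logarithm of `u` makes sense only on its support; divisibility of ℝ extends it to Q, as
needed for paths into the interior. -/
theorem exists_log (u : Model Q n) :
    ∃ ℓ : Q →+ ℝ, ∀ q ∈ supp u, lam q u = Real.exp (ℓ q) := by
  have hpos : ∀ q : supp u, 0 < lam q.1 u := fun q => lt_of_le_of_ne (lam_nonneg _ _) q.2.symm
  obtain ⟨ℓ, hℓ⟩ := exists_extend_real (supp u)
    { toFun := fun q => Real.log (lam q.1 u)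
      map_zero' := by
        change Real.log (lam 0 u) = 0
        rw [lam_zero, Real.log_one]
      map_add' := fun p q => by
        change Real.log (lam (p.1 + q.1) u) = _
        rw [lam_add, Real.log_mul (hpos p).ne' (hpos q).ne'] }
  refine ⟨ℓ, fun q hq => ?_⟩
  rw [hℓ ⟨q, hq⟩]
  exact (Real.exp_log (hpos ⟨q, hq⟩)).symm

/-- At t = 0 the convention `0 ^ 0 = 1` leaves exp(ℓ) on the support, and all other coordinates
vanish. -/
theorem xpath_zero {u : Model Q n} {ℓ : Q →+ ℝ} (hℓ : ∀ q ∈ supp u, lam q u = Real.exp (ℓ q))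
    {σ : Q →+ ℕ} (hσ : ∀ q, σ q = 0 ↔ q ∈ supp u) : xpath ℓ σ 0 = u.1 := by
  apply Subtype.ext
  funext q
  change Real.exp (ℓ q) * |0| ^ σ q = lam q u
  by_cases hq : q ∈ supp u
  · rw [(hσ q).2 hq, pow_zero, mul_one, hℓ q hq]
  · rw [abs_zero, zero_pow (mt (hσ q).1 hq), mul_zero]
    exact (not_not.1 (mt mem_supp.2 hq)).symm

theorem tendsto_xpath {u : Model Q n} {ℓ : Q →+ ℝ}
    (hℓ : ∀ q ∈ supp u, lam q u = Real.exp (ℓ q))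
    {σ : Q →+ ℕ} (hσ : ∀ q, σ q = 0 ↔ q ∈ supp u) :
    Tendsto (fun t => ((xpath ℓ σ t, u.2) : Model Q n)) (𝓝[≠] 0) (𝓝 u) := by
  have h : Continuous fun t => ((xpath ℓ σ t, u.2) : Model Q n) :=
    (continuous_xpath ℓ σ).prodMk continuous_const
  have h0 : ((xpath ℓ σ 0, u.2) : Model Q n) = u := Prod.ext (xpath_zero hℓ hσ) rfl
  have := h.tendsto 0
  rw [h0] at this
  exact this.mono_left nhdsWithin_le_nhds

/-- For σ with zero set exactly the support of a point, the path exp(ℓ)·|t|^σ is interior for t ≠ 0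
and tends to that point. -/
theorem dense_interiorSet : Dense (interiorSet Q n) := by
  intro u
  obtain ⟨ℓ, hℓ⟩ := exists_log u
  obtain ⟨σ, hσ⟩ := exists_face_hom (isFace_supp u)
  refine mem_closure_of_tendsto (tendsto_xpath hℓ hσ) ?_
  filter_upwards [self_mem_nhdsWithin] with t ht
  exact xpath_pos ℓ σ ht u.2

/-- If `λ_p` and `λ_q` agree near `u` up to positive smooth factors, then `p` and `q` have the same
image under all morphisms to `ℕ` which vanish on the support of `u`. -/
theorem hom_eq_of_lam_mul_eq {u : Model Q n} {p q : Q} {h h' : Model Q n → ℝ}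
    (hh : ContinuousAt h u) (hh' : ContinuousAt h' u) (hpos : 0 < h u) (hpos' : 0 < h' u)
    (heq : ∀ᶠ v in 𝓝 u, lam p v * h v = lam q v * h' v)
    (ρ : Q →+ ℕ) (hρ : ∀ r ∈ supp u, ρ r = 0) : ρ p = ρ q := by
  obtain ⟨ℓ, hℓ⟩ := exists_log u
  obtain ⟨σ₀, hσ₀⟩ := exists_face_hom (isFace_supp u)
  -- Along the path of σ, λ_p has order σ(p) in t. If σ(p) < σ(q), dividing by |t|^σ(p) would give a
  -- positive limit on one side and zero on the other.
  have key : ∀ (σ : Q →+ ℕ), (∀ q, σ q = 0 ↔ q ∈ supp u) → ∀ (p q : Q) (h h' : Model Q n → ℝ),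
      ContinuousAt h u → ContinuousAt h' u → 0 < h u →
      (∀ᶠ v in 𝓝 u, lam p v * h v = lam q v * h' v) → ¬ σ p < σ q := by
    intro σ hσ p q h h' hh hh' hpos heq hlt
    have ht := tendsto_xpath hℓ hσ
    have habs : Tendsto (fun t : ℝ => |t| ^ (σ q - σ p)) (𝓝[≠] 0) (𝓝 0) := by
      have : Continuous fun t : ℝ => |t| ^ (σ q - σ p) := by fun_prop
      have h0 := this.tendsto 0
      simp only [abs_zero, zero_pow (Nat.sub_ne_zero_of_lt hlt)] at h0
      exact h0.mono_left nhdsWithin_le_nhds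
    have h1 : Tendsto (fun t : ℝ => Real.exp (ℓ p) * h (xpath ℓ σ t, u.2)) (𝓝[≠] 0)
        (𝓝 (Real.exp (ℓ p) * h u)) := (hh.tendsto.comp ht).const_mul _
    have h2 : Tendsto (fun t : ℝ => Real.exp (ℓ q) * |t| ^ (σ q - σ p) * h' (xpath ℓ σ t, u.2))
        (𝓝[≠] 0) (𝓝 (Real.exp (ℓ q) * 0 * h' u)) :=
      (habs.const_mul _).mul (hh'.tendsto.comp ht)
    have h3 : (fun t : ℝ => Real.exp (ℓ p) * h (xpath ℓ σ t, u.2)) =ᶠ[𝓝[≠] 0]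
        fun t : ℝ => Real.exp (ℓ q) * |t| ^ (σ q - σ p) * h' (xpath ℓ σ t, u.2) := by
      filter_upwards [ht.eventually heq, self_mem_nhdsWithin] with t ht ht0
      have hp : (0 : ℝ) < |t| ^ σ p := pow_pos (abs_pos.2 ht0) _
      change Real.exp (ℓ p) * |t| ^ σ p * _ = Real.exp (ℓ q) * |t| ^ σ q * _ at ht
      have hsplit : |t| ^ σ q = |t| ^ (σ q - σ p) * |t| ^ σ p := by
        rw [← pow_add, Nat.sub_add_cancel hlt.le]
      rw [hsplit] at ht
      apply mul_right_cancel₀ hp.ne'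
      linear_combination ht
    have := tendsto_nhds_unique (h1.congr' h3) h2
    rw [mul_zero, zero_mul] at this
    exact (mul_pos (Real.exp_pos _) hpos).ne' this
  have key' : ∀ (σ : Q →+ ℕ), (∀ q, σ q = 0 ↔ q ∈ supp u) → σ p = σ q := fun σ hσ =>
    le_antisymm (not_lt.1 (key σ hσ q p h' h hh' hh hpos' (heq.mono fun _ => Eq.symm)))
      (not_lt.1 (key σ hσ p q h h' hh hh' hpos heq))
  have h1 := key' σ₀ hσ₀
  -- The comparison of orders needs zero set exactly the support. Both σ₀ and σ₀ + ρ have it, and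
  -- their difference is ρ.
  have h2 := key' (σ₀ + ρ) fun r => by
    rw [AddMonoidHom.add_apply, Nat.add_eq_zero_iff, hσ₀]
    exact ⟨fun h => h.1, fun h => ⟨h, hρ r h⟩⟩
  rw [AddMonoidHom.add_apply, AddMonoidHom.add_apply, h1] at h2
  exact Nat.add_left_cancel h2

/-- On the interior λ_p has no zeros and can be cancelled; density and continuity do the rest. -/
theorem eventually_eq_of_lam_mul_eq {u : Model Q n} {p : Q} {h h' : Model Q n → ℝ}
    (hh : SmoothAt h u) (hh' : SmoothAt h' u)
    (heq : ∀ᶠ v in 𝓝 u, lam p v * h v = lam p v * h' v) : h =ᶠ[𝓝 u] h' := by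
  filter_upwards [hh.eventually, hh'.eventually, eventually_eventually_nhds.2 heq]
    with v hv hv' hveq
  have hne : (𝓝[interiorSet Q n] v).NeBot := mem_closure_iff_nhdsWithin_neBot.1
    (dense_interiorSet v)
  refine tendsto_nhds_unique_of_eventuallyEq (l := 𝓝[interiorSet Q n] v)
    (hv.continuousAt.tendsto.mono_left nhdsWithin_le_nhds)
    (hv'.continuousAt.tendsto.mono_left nhdsWithin_le_nhds) ?_
  filter_upwards [hveq.filter_mono nhdsWithin_le_nhds, self_mem_nhdsWithin] with w hw hw'
  exact mul_left_cancel₀ (hw' p).ne' hw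

/-! ### The monoids `M̃_x` in terms of `Q` -/

theorem exists_rep {u : Model Q n} (b : interiorGerm u) :
    ∃ (p : Q) (h : Model Q n → ℝ), SmoothAt h u ∧ 0 < h u ∧
      b.1 = ((fun v => lam p v * h v : Model Q n → ℝ) : Germ (𝓝 u) ℝ) := by
  obtain ⟨b, f, ⟨p, h, hh, hf⟩, rfl⟩ := b
  exact ⟨p, h, hh, hf.self_of_nhds.1, Germ.coe_eq.2 (hf.mono fun v hv => hv.2)⟩

theorem SmoothAt.eventually_pos {u : Model Q n} {h : Model Q n → ℝ} (hh : SmoothAt h u)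
    (hpos : 0 < h u) : ∀ᶠ v in 𝓝 u, 0 < h v :=
  hh.continuousAt.eventually_const_lt hpos

/-- An element of `M̃_u` is determined by its values on the germs of the functions `λ_q`. -/
theorem cornerMonoid_apply {u : Model Q n} (α : cornerMonoid u) {b : interiorGerm u} {p : Q}
    {h : Model Q n → ℝ} (hh : SmoothAt h u) (hpos : 0 < h u)
    (hb : b.1 = ((fun v => lam p v * h v : Model Q n → ℝ) : Germ (𝓝 u) ℝ)) :
    α.1 (Additive.ofMul b) = α.1 (lamGerm u p) := by
  have hi : InteriorAt h u := hh.interiorAt (hh.eventually_pos hpos)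
  have h1 : Additive.ofMul b = lamGerm u p + hi.germ :=
    congrArg Additive.ofMul (Subtype.ext hb)
  have h2 : α.1 hi.germ = 0 := α.2 _ hpos
  rw [h1, map_add, h2, add_zero]

theorem cornerMonoid_ext {u : Model Q n} {α α' : cornerMonoid u}
    (h : ∀ q, α.1 (lamGerm u q) = α'.1 (lamGerm u q)) : α = α' := by
  apply Subtype.ext
  refine AddMonoidHom.ext fun b => ?_
  obtain ⟨p, g, hg, hpos, hb⟩ := exists_rep b.toMul
  exact (cornerMonoid_apply α hg hpos hb).trans
    ((h p).trans (cornerMonoid_apply α' hg hpos hb).symm)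

theorem cornerMonoid_vanish {u : Model Q n} (α : cornerMonoid u) {q : Q} (hq : q ∈ supp u) :
    α.1 (lamGerm u q) = 0 :=
  α.2 _ (lt_of_le_of_ne (lam_nonneg q u) (Ne.symm hq))

/-- A morphism `Q → ℕ` which vanishes on the support of `u` defines an element of `M̃_u`. -/
theorem exists_cornerMonoid {u : Model Q n} (ρ : Q →+ ℕ) (hρ : ∀ q ∈ supp u, ρ q = 0) :
    ∃ α : cornerMonoid u, ∀ q, α.1 (lamGerm u q) = ρ q := by
  choose p h hh hpos hb using fun b : interiorGerm u => exists_rep b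
  -- The exponent p in a representation λ_p·h of a germ need not be unique, but its value under ρ
  -- is, so the choice above is harmless.
  have key : ∀ (b : interiorGerm u) (q : Q) (g : Model Q n → ℝ), SmoothAt g u → 0 < g u →
      b.1 = ((fun v => lam q v * g v : Model Q n → ℝ) : Germ (𝓝 u) ℝ) → ρ (p b) = ρ q := by
    intro b q g hg hgpos hbg
    exact hom_eq_of_lam_mul_eq (hh b).continuousAt hg.continuousAt (hpos b) hgpos
      (Germ.coe_eq.1 ((hb b).symm.trans hbg)) ρ hρ
  have hone : ∀ q (c : interiorGerm u),
      c.1 = ((fun v => lam q v : Model Q n → ℝ) : Germ (𝓝 u) ℝ) → ρ (p c) = ρ q := by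
    intro q c hc
    refine key c q (fun _ => 1) (smoothAt_const 1) one_pos (hc.trans ?_)
    simp only [mul_one]
  refine ⟨⟨{ toFun := fun b : Additive (interiorGerm u) => ρ (p b.toMul)
             map_zero' := ?_
             map_add' := fun b c => ?_ }, ?_⟩, fun q => ?_⟩
  · refine (hone 0 1 ?_).trans ρ.map_zero
    exact Germ.coe_eq.2 (Eventually.of_forall fun v => (lam_zero v).symm)
  · rw [← map_add]
    refine key _ _ (fun v => h b.toMul v * h c.toMul v) ((hh _).mul (hh _))
      (mul_pos (hpos _) (hpos _)) ?_
    rw [toMul_add]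
    change b.toMul.1 * c.toMul.1 = _
    rw [hb, hb]
    refine Germ.coe_eq.2 (Eventually.of_forall fun v => ?_)
    change lam _ v * _ * (lam _ v * _) = lam (_ + _) v * (_ * _)
    rw [lam_add]
    ring
  · intro c hc
    refine hρ _ ?_
    intro h0
    rw [hb c] at hc
    change 0 < lam (p c) u * h c u at hc
    change lam (p c) u = 0 at h0
    rw [h0, zero_mul] at hc
    exact lt_irrefl _ hc
  · exact hone q _ rfl

theorem supp_origin (q : Q) : q ∈ supp (origin Q n) ↔ q = 0 := by
  classical
  rw [mem_supp]
  change (if q = 0 then (1 : ℝ) else 0) ≠ 0 ↔ _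
  split_ifs with h <;> simp [h]

theorem lam_origin_of_ne {q : Q} (hq : q ≠ 0) : lam q (origin Q n) = 0 :=
  not_not.1 (mt mem_supp.2 (mt (supp_origin q).1 hq))

/-- The support of the vertex is {0}, so every morphism Q → ℕ satisfies the vanishing condition. -/
theorem toDual_bijective : Function.Bijective (toDual (origin Q n)) := by
  refine ⟨fun α α' h => cornerMonoid_ext fun q => DFunLike.congr_fun h q, fun ρ => ?_⟩
  obtain ⟨α, hα⟩ := exists_cornerMonoid (u := origin Q n) ρ fun q hq => by
    rw [(supp_origin q).1 hq, map_zero]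
  exact ⟨α, AddMonoidHom.ext hα⟩

end ToricPoints

/-! ### Hadamard's lemma -/

section Hadamard

open MeasureTheory

variable {E : Type*} [NormedAddCommGroup E] [NormedSpace ℝ E]
  {F : Type*} [NormedAddCommGroup F] [NormedSpace ℝ F] [CompleteSpace F]

/-- Integrals of smooth functions over the unit interval depend smoothly on parameters. -/
theorem contDiff_integral_unitInterval {G : ℝ × E → F} (hG : ContDiff ℝ ∞ G) :
    ContDiff ℝ ∞ fun y => ∫ t in Set.Icc (0 : ℝ) 1, G (t, y) := by
  -- The integral is the convolution, evaluated at 0, of the indicator of [0, 1] with s ↦ χ(s)·G(−s,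
  -- y). The cutoff χ is 1 on [−1, 1] and supplies the compact support needed to differentiate in y.
  let χ : ContDiffBump (0 : ℝ) := ⟨1, 2, one_pos, one_lt_two⟩
  have h := contDiffOn_convolution_right_with_param (𝕜 := ℝ) (μ := (volume : Measure ℝ))
    (f := Set.indicator (Set.Icc (0 : ℝ) 1) fun _ => (1 : ℝ)) (n := ⊤)
    (ContinuousLinearMap.lsmul ℝ ℝ) (g := fun (y : E) (s : ℝ) => χ s • G (-s, y))
    (s := Set.univ) (k := Metric.closedBall (0 : ℝ) 2) isOpen_univ (isCompact_closedBall _ _)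
    (by
      intro p s _ hs
      have : χ s = 0 := χ.zero_of_le_dist (by
        rw [Metric.mem_closedBall, not_le] at hs
        exact hs.le)
      simp [this])
    ((locallyIntegrable_const (1 : ℝ)).indicator measurableSet_Icc)
    (by
      have h1 : ContDiff ℝ ∞ fun q : E × ℝ => χ q.2 := χ.contDiff.comp contDiff_snd
      have h2 : ContDiff ℝ ∞ fun q : E × ℝ => G (-q.2, q.1) :=
        hG.comp (contDiff_snd.neg.prodMk contDiff_fst)
      exact (h1.smul h2).contDiffOn)
  rw [Set.univ_prod_univ, contDiffOn_univ] at h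
  have h2 := h.comp ((contDiff_id (E := E) (𝕜 := ℝ)).prodMk (contDiff_const (c := (0 : ℝ))))
  convert! h2 using 2 with y
  simp only [Function.comp, id, convolution_def, zero_sub, neg_neg]
  rw [← integral_indicator measurableSet_Icc]
  refine integral_congr_ae (Eventually.of_forall fun t => ?_)
  by_cases ht : t ∈ Set.Icc (0 : ℝ) 1
  · have : χ (-t) = 1 := χ.one_of_mem_closedBall (by
      rw [Metric.mem_closedBall, dist_zero_right, norm_neg, Real.norm_eq_abs, abs_of_nonneg ht.1]
      exact ht.2)
    simp [ht, this]
  · simp [ht]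

/-- Hadamard's lemma. -/
theorem exists_hadamard {g : E → ℝ} (hg : ContDiff ℝ ∞ g) (y₀ : E) :
    ∃ G : E → E →L[ℝ] ℝ, ContDiff ℝ ∞ G ∧ G y₀ = fderiv ℝ g y₀ ∧
      ∀ y, g y = g y₀ + G y (y - y₀) := by
  have hd : ContDiff ℝ ∞ (fderiv ℝ g) := (contDiff_infty_iff_fderiv.1 hg).2
  have hF : ContDiff ℝ ∞ fun q : ℝ × E => fderiv ℝ g (y₀ + q.1 • (q.2 - y₀)) :=
    hd.comp (contDiff_const.add (contDiff_fst.smul (contDiff_snd.sub contDiff_const)))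
  -- The factor is G(y) = ∫₀¹ dg(y₀ + t(y − y₀)) dt; the identity is the fundamental theorem of
  -- calculus along the segment.
  refine ⟨_, contDiff_integral_unitInterval hF, ?_, fun y => ?_⟩
  · simp
  · have hcont : Continuous fun t : ℝ => fderiv ℝ g (y₀ + t • (y - y₀)) :=
      hF.continuous.comp (continuous_id.prodMk continuous_const)
    have hint : IntegrableOn (fun t : ℝ => fderiv ℝ g (y₀ + t • (y - y₀))) (Set.Icc 0 1) :=
      hcont.continuousOn.integrableOn_compact isCompact_Icc
    rw [ContinuousLinearMap.integral_apply hint, integral_Icc_eq_integral_Ioc,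
      ← intervalIntegral.integral_of_le zero_le_one]
    have hder : ∀ t ∈ Set.uIcc (0 : ℝ) 1, HasDerivAt (fun t : ℝ => g (y₀ + t • (y - y₀)))
        (fderiv ℝ g (y₀ + t • (y - y₀)) (y - y₀)) t := by
      intro t _
      have h1 : HasFDerivAt g (fderiv ℝ g (y₀ + t • (y - y₀))) (y₀ + t • (y - y₀)) :=
        ((contDiff_infty_iff_fderiv.1 hg).1 _).hasFDerivAt
      have h2 : HasDerivAt (fun t : ℝ => y₀ + t • (y - y₀)) (y - y₀) t := by
        simpa using ((hasDerivAt_id t).smul_const (y - y₀)).const_add y₀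
      exact h1.comp_hasDerivAt t h2
    rw [intervalIntegral.integral_eq_sub_of_hasDerivAt hder
      ((hcont.clm_apply continuous_const).intervalIntegrable _ _)]
    simp

/-- Smooth functions agree locally with globally smooth ones. -/
theorem exists_contDiff_eventuallyEq [FiniteDimensional ℝ E] {g : E → ℝ} {W : Set E}
    (hW : IsOpen W) (hg : ContDiffOn ℝ ∞ g W) {y₀ : E} (hy : y₀ ∈ W) :
    ∃ g' : E → ℝ, ContDiff ℝ ∞ g' ∧ g' =ᶠ[𝓝 y₀] g := by
  obtain ⟨ε, hε, hsub⟩ := Metric.nhds_basis_closedBall.mem_iff.1 (hW.mem_nhds hy)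
  let χ : ContDiffBump y₀ := ⟨ε / 2, ε, half_pos hε, half_lt_self hε⟩
  refine ⟨fun y => χ y * g y, contDiff_iff_contDiffAt.2 fun y => ?_, ?_⟩
  · by_cases hyW : y ∈ W
    · exact χ.contDiffAt.mul (hg.contDiffAt (hW.mem_nhds hyW))
    · have h0 : χ =ᶠ[𝓝 y] 0 := by
        refine notMem_tsupport_iff_eventuallyEq.1 fun hmem => hyW (hsub ?_)
        rwa [χ.tsupport_eq] at hmem
      refine (contDiffAt_const (c := (0 : ℝ))).congr_of_eventuallyEq ?_
      filter_upwards [h0] with w hw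
      simp [hw]
  · filter_upwards [χ.eventuallyEq_one] with w hw
    simp [hw]

end Hadamard

/-! ### Derivations -/

section Derivations

variable {Q : Type*} [AddCommMonoid Q] {n : ℕ} {x : Model Q n}
  {v : smoothGerm x →ₗ[ℝ] ℝ}

theorem SmoothAt.sum {ι : Type*} {s : Finset ι} {f : ι → Model Q n → ℝ}
    (hf : ∀ i, SmoothAt (f i) x) : SmoothAt (fun u => ∑ i ∈ s, f i u) x := by
  classical
  induction s using Finset.induction_on with
  | empty => simpa using smoothAt_const (x := x) (0 : ℝ)
  | insert i s hi ih => simpa only [Finset.sum_insert hi] using (hf i).add ih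

theorem smoothGerm_congr {f f' : Model Q n → ℝ} (hf : SmoothAt f x) (hf' : SmoothAt f' x)
    (h : f =ᶠ[𝓝 x] f') : hf.germ = hf'.germ := smoothGerm_ext rfl rfl h

theorem map_germ_sum {ι : Type*} {s : Finset ι} {f : ι → Model Q n → ℝ}
    (hf : ∀ i, SmoothAt (f i) x) :
    v (SmoothAt.sum (s := s) hf).germ = ∑ i ∈ s, v (hf i).germ := by
  classical
  induction s using Finset.induction_on with
  | empty =>
    rw [Finset.sum_empty]
    refine Eq.trans ?_ (map_zero v)
    exact congrArg v (smoothGerm_ext (f := fun u => ∑ i ∈ ∅, f i u) (f' := 0) rfl rfl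
      (Eventually.of_forall fun u => Finset.sum_empty))
  | insert i s hi ih =>
    rw [Finset.sum_insert hi, ← ih, ← map_add]
    exact congrArg v (smoothGerm_ext (f := fun u => ∑ i ∈ insert i s, f i u)
      (f' := fun u => f i u + ∑ i ∈ s, f i u) rfl rfl
      (Eventually.of_forall fun u => Finset.sum_insert hi))

theorem IsDerivation.mul (hv : IsDerivation v) {f f' : Model Q n → ℝ} (hf : SmoothAt f x)
    (hf' : SmoothAt f' x) :
    v (hf.mul hf').germ = v hf.germ * f' x + f x * v hf'.germ :=
  hv hf.germ hf'.germ

theorem IsDerivation.const (hv : IsDerivation v) (c : ℝ) :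
    v (smoothAt_const (x := x) c).germ = 0 := by
  have h1 : v (smoothAt_const (x := x) (1 : ℝ)).germ = 0 := by
    have h := hv.mul (smoothAt_const (x := x) (1 : ℝ)) (smoothAt_const (x := x) (1 : ℝ))
    have h' : ((smoothAt_const (x := x) (1 : ℝ)).mul (smoothAt_const (x := x) (1 : ℝ))).germ =
        (smoothAt_const (x := x) (1 : ℝ)).germ :=
      smoothGerm_congr _ _ (Eventually.of_forall fun _ => one_mul 1)
    rw [h'] at h
    linarith
  have h2 : (smoothAt_const (x := x) c).germ = c • (smoothAt_const (x := x) (1 : ℝ)).germ :=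
    smoothGerm_ext (f := fun _ => c) (f' := fun _ => c * 1) rfl rfl
      (Eventually.of_forall fun _ => (mul_one c).symm)
  rw [h2, map_smul, h1, smul_zero]

theorem map_germ_add {f f' : Model Q n → ℝ} (hf : SmoothAt f x) (hf' : SmoothAt f' x) :
    v (hf.add hf').germ = v hf.germ + v hf'.germ :=
  map_add v hf.germ hf'.germ

/-- The value of a derivation on the coordinates `((λ_q)_{q ∈ s}, z)`. -/
def derivCoords (v : smoothGerm x →ₗ[ℝ] ℝ) (s : Finset Q) : (s → ℝ) × (Fin n → ℝ) :=
  (fun q => v (smoothAt_lam (x := x) q.1).germ, fun a => v (smoothAt_coord (x := x) a).germ)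

/-- The chain rule for derivations of germs of smooth functions. -/
theorem IsDerivation.apply_eq_fderiv (hv : IsDerivation v) {s : Finset Q}
    {f : Model Q n → ℝ} (hf : SmoothAt f x) {W : Set ((s → ℝ) × (Fin n → ℝ))}
    {g : (s → ℝ) × (Fin n → ℝ) → ℝ} (hW : IsOpen W) (hg : ContDiffOn ℝ ∞ g W)
    (hfg : ∀ᶠ u in 𝓝 x, coords s u ∈ W ∧ f u = g (coords s u)) :
    v hf.germ = fderiv ℝ g (coords s x) (derivCoords v s) := by
  classical
  -- Hadamard's lemma gives f = f(x) + Σ G_q·(λ_q − λ_q(x)) + Σ G_a·(z_a − z_a(x)) with smooth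
  -- coefficients. By the Leibniz rule only the values of the coefficients at x matter, and these
  -- are the partial derivatives of g.
  obtain ⟨g', hg', hgg'⟩ := exists_contDiff_eventuallyEq hW hg hfg.self_of_nhds.1
  obtain ⟨G, hG, hG0, hGt⟩ := exists_hadamard hg' (coords s x)
  rw [← hgg'.fderiv_eq, ← hG0]
  have hGs : ∀ e : (s → ℝ) × (Fin n → ℝ), SmoothAt (fun u => G (coords s u) e) x := fun e =>
    ⟨s, Set.univ, fun y => G y e, isOpen_univ, (hG.clm_apply contDiff_const).contDiffOn,
      Eventually.of_forall fun u => ⟨trivial, rfl⟩⟩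
  let eL : s → (s → ℝ) × (Fin n → ℝ) := fun q => (Pi.single q 1, 0)
  let eR : Fin n → (s → ℝ) × (Fin n → ℝ) := fun a => (0, Pi.single a 1)
  have hdecomp : ∀ (L : ((s → ℝ) × (Fin n → ℝ)) →L[ℝ] ℝ) (w : (s → ℝ) × (Fin n → ℝ)),
      L w = ∑ q, L (eL q) * w.1 q + ∑ a, L (eR a) * w.2 a := by
    intro L w
    have hw : w = ∑ q, w.1 q • eL q + ∑ a, w.2 a • eR a := by
      refine Prod.ext ?_ ?_
      · rw [Prod.fst_add, Prod.fst_sum, Prod.fst_sum]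
        simpa [eL, eR] using pi_eq_sum_univ' w.1
      · rw [Prod.snd_add, Prod.snd_sum, Prod.snd_sum]
        simpa [eL, eR] using pi_eq_sum_univ' w.2
    conv_lhs => rw [hw]
    simp only [map_add, map_sum, map_smul, smul_eq_mul, mul_comm]
  have hlam : ∀ q : s, SmoothAt (fun u : Model Q n => lam q.1 u + -lam q.1 x) x := fun q =>
    (smoothAt_lam q.1).add (smoothAt_const _)
  have hz : ∀ a : Fin n, SmoothAt (fun u : Model Q n => u.2 a + -x.2 a) x := fun a =>
    (smoothAt_coord a).add (smoothAt_const _)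
  have hS1 := fun q : s => (hGs (eL q)).mul (hlam q)
  have hS2 := fun a : Fin n => (hGs (eR a)).mul (hz a)
  have htot := (smoothAt_const (x := x) (g' (coords s x))).add
    ((SmoothAt.sum (s := Finset.univ) hS1).add (SmoothAt.sum (s := Finset.univ) hS2))
  have hcont := (continuous_coords s (n := n)).continuousAt (x := x)
  have heq : hf.germ = htot.germ := by
    refine smoothGerm_congr _ _ ?_
    filter_upwards [hfg, hcont.eventually hgg'] with u hu hu'
    rw [hu.2, ← hu', hGt (coords s u), hdecomp]
    simp only [← sub_eq_add_neg]
    rfl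
  rw [heq, map_germ_add (smoothAt_const _) ((SmoothAt.sum hS1).add (SmoothAt.sum hS2)),
    map_germ_add (SmoothAt.sum hS1) (SmoothAt.sum hS2), map_germ_sum hS1, map_germ_sum hS2,
    hv.const, zero_add, hdecomp]
  congr 1
  · refine Finset.sum_congr rfl fun q _ => ?_
    rw [hv.mul (hGs (eL q)) (hlam q), map_germ_add (smoothAt_lam q.1) (smoothAt_const _),
      hv.const, add_neg_cancel, mul_zero, zero_add, add_zero]
    rfl
  · refine Finset.sum_congr rfl fun a _ => ?_
    rw [hv.mul (hGs (eR a)) (hz a), map_germ_add (smoothAt_coord a) (smoothAt_const _),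
      hv.const, add_neg_cancel, mul_zero, zero_add, add_zero]
    rfl

/-- A derivation which vanishes on all coordinates is zero. -/
theorem IsDerivation.eq_zero (hv : IsDerivation v)
    (h1 : ∀ q : Q, v (smoothAt_lam (x := x) q).germ = 0)
    (h2 : ∀ a : Fin n, v (smoothAt_coord (x := x) a).germ = 0) : v = 0 := by
  ext ⟨b, f, hf, rfl⟩
  obtain ⟨s, W, g, hW, hg, hfg⟩ := id hf
  refine (hv.apply_eq_fderiv hf hW hg hfg).trans ?_
  have : derivCoords v s = 0 := Prod.ext (funext fun q => h1 q) (funext h2)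
  rw [this, map_zero]
  rfl

end Derivations

/-! ### The b-cotangent space at the vertex -/

section Pairing

variable {Q : Type*} [AddCommMonoid Q] {n : ℕ} {x : Model Q n}

theorem bCotangentMap_tmul (q : Q) :
    bCotangentMap x (1 ⊗ₜ[ℤ] toGp Q q, 0) = bdiff (interiorAt_lam (x := x) q) := by
  rw [bCotangentMap, LinearMap.coprod_apply, map_zero, add_zero, LinearMap.liftBaseChange_tmul,
    one_smul]
  exact lift_toGp (bdiffLam x) q

theorem bCotangentMap_single (a : Fin n) :
    bCotangentMap x (0, Pi.single a 1) = ddiff (smoothAt_coord (x := x) a) := by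
  classical
  rw [bCotangentMap, LinearMap.coprod_apply, map_zero, zero_add,
    Fintype.linearCombination_apply_single, one_smul]

theorem bCotangentMap_snd (z : Fin n → ℝ) (w : BTangent x) :
    bCotangentMap x (0, z) w = ∑ a, z a * w.1.1 (smoothAt_coord (x := x) a).germ := by
  rw [bCotangentMap, LinearMap.coprod_apply, map_zero, zero_add,
    Fintype.linearCombination_apply, LinearMap.sum_apply]
  rfl

/-- The b-differential of a product of `λ_p` and a positive function. -/
theorem bTangent_apply_eq {f h : Model Q n → ℝ} {p : Q} (hf : InteriorAt f x) (hh : SmoothAt h x)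
    (hpos : 0 < h x) (hfh : ∀ᶠ u in 𝓝 x, f u = lam p u * h u) (w : BTangent x) :
    w.1.2 hf.germ = w.1.2 (lamGerm x p) + w.1.1 (hh.log hpos.ne').germ := by
  have hi : InteriorAt (fun u => Real.exp (Real.log (h u))) x :=
    (hh.log hpos.ne').exp.interiorAt (Eventually.of_forall fun _ => Real.exp_pos _)
  have h1 : hf.germ = lamGerm x p + hi.germ := by
    refine interiorGerm_ext hf ((interiorAt_lam p).mul hi) ?_
    filter_upwards [hfh, hh.continuousAt.eventually_const_lt hpos] with u hu hu'
    rw [hu, Real.exp_log hu']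
  rw [h1, map_add, ← w.2.2.1 (hh.log hpos.ne').germ]
  rfl

theorem bTangent_apply_lam (w : BTangent x) (q : Q) :
    w.1.1 (smoothAt_lam (x := x) q).germ = lam q x * w.1.2 (lamGerm x q) :=
  w.2.2.2 ⟨_, lam q, interiorAt_lam q, rfl⟩

/-- The compatibility v(b) = b(x)·v'(b) gives v(λ_q) from v', so v is determined by these data; then
so is v', being v'(λ_p) + v(log h) on λ_p·h. -/
theorem bTangent_eq_zero (w : BTangent x) (h1 : ∀ q, w.1.2 (lamGerm x q) = 0)
    (h2 : ∀ a : Fin n, w.1.1 (smoothAt_coord (x := x) a).germ = 0) : w = 0 := by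
  have hv : w.1.1 = 0 := w.2.1.eq_zero (fun q => by rw [bTangent_apply_lam, h1, mul_zero]) h2
  refine Subtype.ext (Prod.ext hv (AddMonoidHom.ext fun b => ?_))
  obtain ⟨b, f, hf, rfl⟩ := b
  obtain ⟨p, h, hh, hfh⟩ := id hf
  refine (bTangent_apply_eq hf hh hfh.self_of_nhds.1 (hfh.mono fun u hu => hu.2) w).trans ?_
  rw [h1, hv, LinearMap.zero_apply, add_zero]
  rfl

end Pairing

section Vertex

variable {Q : Type*} [AddCommMonoid Q] [IsToric Q] {n : ℕ}

/-- The derivative at the vertex in a direction `z ∈ ℝⁿ`. -/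
def vertexDeriv (z : Fin n → ℝ) (f : Model Q n → ℝ) : ℝ :=
  deriv (fun t : ℝ => f (vertex Q, t • z)) 0

theorem tendsto_vertexLine (z : Fin n → ℝ) :
    Tendsto (fun t : ℝ => ((vertex Q, t • z) : Model Q n)) (𝓝 0) (𝓝 (origin Q n)) := by
  have h : Continuous fun t : ℝ => ((vertex Q, t • z) : Model Q n) := by fun_prop
  have := h.tendsto 0
  rwa [zero_smul] at this

theorem vertexDeriv_congr (z : Fin n → ℝ) {f f' : Model Q n → ℝ}
    (h : f =ᶠ[𝓝 (origin Q n)] f') : vertexDeriv z f = vertexDeriv z f' :=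
  (h.comp_tendsto (tendsto_vertexLine z)).deriv_eq

theorem SmoothAt.differentiableAt_vertexLine {f : Model Q n → ℝ}
    (hf : SmoothAt f (origin Q n)) (z : Fin n → ℝ) :
    DifferentiableAt ℝ (fun t : ℝ => f (vertex Q, t • z)) 0 := by
  obtain ⟨s, W, g, hW, hg, hfg⟩ := hf
  have h1 : DifferentiableAt ℝ g (coords s (origin Q n)) :=
    (hg.differentiableOn (by simp)).differentiableAt (hW.mem_nhds hfg.self_of_nhds.1)
  have h2 : DifferentiableAt ℝ
      (fun t : ℝ => coords s ((vertex Q, t • z) : Model Q n)) 0 := by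
    unfold coords lam
    fun_prop
  have h0 : coords s ((vertex Q, (0 : ℝ) • z) : Model Q n) = coords s (origin Q n) := by
    rw [zero_smul]; rfl
  rw [← h0] at h1
  refine (h1.comp (0 : ℝ) h2).congr_of_eventuallyEq ?_
  filter_upwards [(tendsto_vertexLine z).eventually hfg] with t ht
  exact ht.2

theorem vertexDeriv_add (z : Fin n → ℝ) {f f' : Model Q n → ℝ}
    (hf : SmoothAt f (origin Q n)) (hf' : SmoothAt f' (origin Q n)) :
    vertexDeriv z (fun u => f u + f' u) = vertexDeriv z f + vertexDeriv z f' :=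
  deriv_fun_add (hf.differentiableAt_vertexLine z) (hf'.differentiableAt_vertexLine z)

theorem vertexDeriv_mul (z : Fin n → ℝ) {f f' : Model Q n → ℝ}
    (hf : SmoothAt f (origin Q n)) (hf' : SmoothAt f' (origin Q n)) :
    vertexDeriv z (fun u => f u * f' u) =
      vertexDeriv z f * f' (origin Q n) + f (origin Q n) * vertexDeriv z f' := by
  have := deriv_fun_mul (hf.differentiableAt_vertexLine z) (hf'.differentiableAt_vertexLine z)
  rw [zero_smul] at this
  exact this

theorem vertexDeriv_log (z : Fin n → ℝ) {f : Model Q n → ℝ}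
    (hf : SmoothAt f (origin Q n)) (hpos : 0 < f (origin Q n)) :
    f (origin Q n) * vertexDeriv z (fun u => Real.log (f u)) = vertexDeriv z f := by
  have h0 : f (vertex Q, (0 : ℝ) • z) = f (origin Q n) := by rw [zero_smul]; rfl
  have := deriv.log (hf.differentiableAt_vertexLine z) (by rw [h0]; exact hpos.ne')
  rw [h0] at this
  change f (origin Q n) * deriv (fun t : ℝ => Real.log (f (vertex Q, t • z))) 0 = _
  rw [this]
  unfold vertexDeriv
  field_simp

theorem vertexDeriv_lam (z : Fin n → ℝ) (q : Q) : vertexDeriv z (lam q : Model Q n → ℝ) = 0 :=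
  deriv_const _ _

/-- A b-tangent vector at the vertex is given by a morphism `Q → ℝ` and a vector of `ℝⁿ`. -/
theorem exists_bTangent (ρ : Q →+ ℝ) (z : Fin n → ℝ) :
    ∃ w : BTangent (origin Q n), (∀ q, w.1.2 (lamGerm _ q) = ρ q) ∧
      ∀ a, w.1.1 (smoothAt_coord (x := origin Q n) a).germ = z a := by
  choose F hF hFa using fun a : smoothGerm (origin Q n) => a.2
  have hv : ∀ (a : smoothGerm (origin Q n)) (f : Model Q n → ℝ),
      a.1 = (f : Germ (𝓝 (origin Q n)) ℝ) → vertexDeriv z (F a) = vertexDeriv z f :=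
    fun a f h => vertexDeriv_congr z (Germ.coe_eq.1 ((hFa a).symm.trans h))
  let v : smoothGerm (origin Q n) →ₗ[ℝ] ℝ :=
    { toFun := fun a => vertexDeriv z (F a)
      map_add' := fun a b => by
        rw [← vertexDeriv_add z (hF a) (hF b)]
        refine hv _ _ ?_
        change a.1 + b.1 = _
        rw [hFa a, hFa b]
        rfl
      map_smul' := fun c a => by
        have h := vertexDeriv_mul z (smoothAt_const (x := origin Q n) c) (hF a)
        have h0 : vertexDeriv z (fun _ : Model Q n => c) = 0 := deriv_const _ _
        rw [h0, zero_mul, zero_add] at h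
        refine Eq.trans (hv _ _ ?_) h
        change c • a.1 = _
        rw [hFa a]
        rfl }
  choose p h hh hpos hb using fun b : interiorGerm (origin Q n) => exists_rep b
  -- On λ_p·h the morphism is to be ρ(p) + ∂_z log h. At the vertex p is unique, because its values
  -- under all morphisms to ℕ are determined, and then the germ of h is unique too.
  have hv' : ∀ (b : interiorGerm (origin Q n)) (q : Q) (g : Model Q n → ℝ),
      SmoothAt g (origin Q n) → 0 < g (origin Q n) →
      b.1 = ((fun v => lam q v * g v : Model Q n → ℝ) : Germ (𝓝 (origin Q n)) ℝ) →
      ρ (p b) + vertexDeriv z (fun u => Real.log (h b u)) =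
        ρ q + vertexDeriv z (fun u => Real.log (g u)) := by
    intro b q g hg hgpos hbg
    have heq := Germ.coe_eq.1 ((hb b).symm.trans hbg)
    have hpq : p b = q := eq_of_forall_hom fun σ =>
      hom_eq_of_lam_mul_eq (hh b).continuousAt hg.continuousAt (hpos b) hgpos heq σ
        fun r hr => by rw [(supp_origin r).1 hr, map_zero]
    rw [← hpq] at heq ⊢
    exact congrArg (ρ (p b) + ·)
      (vertexDeriv_congr z ((eventually_eq_of_lam_mul_eq (hh b) hg heq).fun_comp Real.log))
  have hone : ∀ (b : interiorGerm (origin Q n)) (q : Q),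
      b.1 = ((lam q : Model Q n → ℝ) : Germ (𝓝 (origin Q n)) ℝ) →
      ρ (p b) + vertexDeriv z (fun u => Real.log (h b u)) = ρ q := by
    intro b q hbq
    refine (hv' b q (fun _ => 1) (smoothAt_const 1) one_pos (hbq.trans ?_)).trans ?_
    · simp only [mul_one]
    · have : vertexDeriv z (fun _ : Model Q n => Real.log 1) = 0 := deriv_const _ _
      rw [this, add_zero]
  let v' : Additive (interiorGerm (origin Q n)) →+ ℝ :=
    { toFun := fun b => ρ (p b.toMul) + vertexDeriv z (fun u => Real.log (h b.toMul u))
      map_zero' := (hone 1 0 (Germ.coe_eq.2 (Eventually.of_forall fun u =>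
        (lam_zero u).symm))).trans ρ.map_zero
      map_add' := fun b c => by
        refine (hv' _ (p b.toMul + p c.toMul) (fun u => h b.toMul u * h c.toMul u)
          ((hh _).mul (hh _)) (mul_pos (hpos _) (hpos _)) ?_).trans ?_
        · change b.toMul.1 * c.toMul.1 = _
          rw [hb, hb]
          refine Germ.coe_eq.2 (Eventually.of_forall fun v => ?_)
          change lam _ v * _ * (lam _ v * _) = lam (_ + _) v * (_ * _)
          rw [lam_add]
          ring
        · have h1 := vertexDeriv_add z ((hh b.toMul).log (hpos _).ne')
            ((hh c.toMul).log (hpos _).ne')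
          have h2 : vertexDeriv z (fun u => Real.log (h b.toMul u * h c.toMul u)) =
              vertexDeriv z (fun u => Real.log (h b.toMul u) + Real.log (h c.toMul u)) := by
            refine vertexDeriv_congr z ?_
            filter_upwards [(hh b.toMul).eventually_pos (hpos _),
              (hh c.toMul).eventually_pos (hpos _)] with u hu hu'
            exact Real.log_mul hu.ne' hu'.ne'
          rw [h2, h1, map_add]
          ring }
  refine ⟨⟨(v, v'), fun a b => ?_, fun a => ?_, fun b => ?_⟩, fun q => ?_, fun a => ?_⟩
  · have := vertexDeriv_mul z (hF a) (hF b)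
    have h1 : a.1.value = F a (origin Q n) := by rw [hFa a]; rfl
    have h2 : b.1.value = F b (origin Q n) := by rw [hFa b]; rfl
    rw [h1, h2]
    refine (hv _ _ ?_).trans this
    change a.1 * b.1 = _
    rw [hFa a, hFa b]
    rfl
  · refine (hv' _ 0 (fun u => Real.exp (F a u)) (hF a).exp (Real.exp_pos _) ?_).trans ?_
    · change a.1.map Real.exp = _
      rw [hFa a]
      refine Germ.coe_eq.2 (Eventually.of_forall fun u => ?_)
      change Real.exp (F a u) = lam 0 u * Real.exp (F a u)
      rw [lam_zero, one_mul]
    · rw [map_zero, zero_add]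
      simp only [Real.log_exp]
      rfl
  · have h1 : b.1.value = lam (p b) (origin Q n) * h b (origin Q n) := by rw [hb b]; rfl
    rw [h1]
    refine (hv ⟨b.1, _⟩ _ (hb b)).trans ?_
    rw [vertexDeriv_mul z (smoothAt_lam _) (hh b), vertexDeriv_lam, zero_mul, zero_add,
      ← vertexDeriv_log z (hh b) (hpos b)]
    change _ = _ * (ρ (p b) + vertexDeriv z (fun u => Real.log (h b u)))
    -- For p ≠ 0 both sides vanish, since λ_p(δ₀) = 0.
    by_cases h0 : p b = 0
    · rw [h0, map_zero]; ring
    · rw [lam_origin_of_ne h0]; ring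
  · exact hone _ q rfl
  · refine (hv _ _ rfl).trans ?_
    have : HasDerivAt (fun t : ℝ => t * z a) (z a) 0 := by
      simpa using (hasDerivAt_id (0 : ℝ)).mul_const (z a)
    exact this.deriv

variable (Q n) in
/-- The map `(Q ⊗ ℝ) ⊕ ℝⁿ → ᵇT*` at the vertex is an isomorphism. -/
theorem bCotangentMap_bijective : Function.Bijective (bCotangentMap (origin Q n)) := by
  classical
  -- The transpose, from b-tangent vectors to linear forms on (Q ⊗ ℝ) ⊕ ℝⁿ, is shown to be
  -- bijective. As the latter space is finite-dimensional, dualizing recovers the original map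
  -- through the bidual.
  let T := (bCotangentMap (origin Q n)).flip
  have hinj : Function.Injective T := by
    rw [injective_iff_map_eq_zero]
    intro w hw
    refine bTangent_eq_zero w (fun q => ?_) fun a => ?_
    · exact (DFunLike.congr_fun (bCotangentMap_tmul (x := origin Q n) q) w).symm.trans
        (DFunLike.congr_fun hw (1 ⊗ₜ[ℤ] toGp Q q, 0))
    · exact (DFunLike.congr_fun (bCotangentMap_single (x := origin Q n) a) w).symm.trans
        (DFunLike.congr_fun hw (0, Pi.single a 1))
  have hsurj : Function.Surjective T := by
    intro L
    let ρ : Gp Q →+ ℝ :=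
      { toFun := fun q => L (1 ⊗ₜ[ℤ] q, 0)
        map_zero' := by rw [TensorProduct.tmul_zero]; exact map_zero L
        map_add' := fun p q => by
          rw [TensorProduct.tmul_add, ← map_add]
          congr 1
          exact Prod.ext rfl (add_zero _).symm }
    obtain ⟨w, hw1, hw2⟩ := exists_bTangent (n := n) (ρ.comp (toGp Q)) fun a => L (0, Pi.single a 1)
    refine ⟨w, ?_⟩
    refine LinearMap.prod_ext ?_ ?_
    · refine TensorProduct.AlgebraTensorModule.ext fun r q => ?_
      have h1 : (T w ∘ₗ LinearMap.inl ℝ (ℝ ⊗[ℤ] Gp Q) (Fin n → ℝ)) (1 ⊗ₜ[ℤ] q) = ρ q := by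
        obtain ⟨a, b, rfl⟩ := exists_toGp_sub q
        have h : ∀ q, T w (1 ⊗ₜ[ℤ] toGp Q q, 0) = ρ (toGp Q q) := fun q =>
          (DFunLike.congr_fun (bCotangentMap_tmul (x := origin Q n) q) w).trans (hw1 q)
        rw [TensorProduct.tmul_sub, map_sub, map_sub]
        exact congrArg₂ (· - ·) (h a) (h b)
      have h2 : (r ⊗ₜ[ℤ] q : ℝ ⊗[ℤ] Gp Q) = r • (1 ⊗ₜ[ℤ] q) := by
        rw [TensorProduct.smul_tmul', smul_eq_mul, mul_one]
      rw [h2, map_smul, map_smul, h1]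
      rfl
    · refine (Pi.basisFun ℝ (Fin n)).ext fun a => ?_
      rw [Pi.basisFun_apply]
      exact (DFunLike.congr_fun (bCotangentMap_single (x := origin Q n) a) w).trans (hw2 a)
  let e := LinearEquiv.ofBijective T ⟨hinj, hsurj⟩
  have : (bCotangentMap (origin Q n) : _ → _) =
      (Module.evalEquiv ℝ ((ℝ ⊗[ℤ] Gp Q) × (Fin n → ℝ))).trans e.dualMap := by
    funext m
    ext w
    rfl
  rw [this]
  exact LinearEquiv.bijective _

/-- The differential at the vertex of a smooth function, in terms of partial derivatives. -/
theorem ddiff_origin {f : Model Q n → ℝ} (hf : SmoothAt f (origin Q n)) {s : Finset Q}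
    (hs : 0 ∉ s) {W : Set ((s → ℝ) × (Fin n → ℝ))}
    {g : (s → ℝ) × (Fin n → ℝ) → ℝ} (hW : IsOpen W) (hg : ContDiffOn ℝ ∞ g W)
    (hfg : ∀ᶠ u in 𝓝 (origin Q n), coords s u ∈ W ∧ f u = g (coords s u)) :
    ddiff hf = bCotangentMap (origin Q n)
      (0, fun a => fderiv ℝ g (coords s (origin Q n)) (0, Pi.single a 1)) := by
  classical
  ext w
  rw [bCotangentMap_snd]
  refine (w.2.1.apply_eq_fderiv hf hW hg hfg).trans ?_
  -- Only z-components survive: v(λ_q) = λ_q(δ₀)·v'(λ_q) = 0 for q ∈ s, because 0 ∉ s.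
  have h1 : derivCoords w.1.1 s =
      ∑ a, w.1.1 (smoothAt_coord (x := origin Q n) a).germ •
        ((0, Pi.single a 1) : (s → ℝ) × (Fin n → ℝ)) := by
    refine Prod.ext ?_ ?_
    · rw [Prod.fst_sum]
      simp only [Prod.smul_mk, smul_zero, Finset.sum_const_zero]
      funext q
      refine (bTangent_apply_lam w q.1).trans ?_
      rw [lam_origin_of_ne (fun h => hs (h ▸ q.2)), zero_mul]
      rfl
    · rw [Prod.snd_sum]
      exact pi_eq_sum_univ' _
  rw [h1, map_sum]
  refine Finset.sum_congr rfl fun a _ => ?_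
  rw [map_smul, smul_eq_mul, mul_comm]

/-- The b-differential at the vertex of an interior function. -/
theorem bdiff_origin {f h : Model Q n → ℝ} {p : Q} (hf : InteriorAt f (origin Q n))
    (hh : SmoothAt h (origin Q n)) (hpos : 0 < h (origin Q n))
    (hfh : ∀ᶠ u in 𝓝 (origin Q n), f u = lam p u * h u) :
    bdiff hf = bCotangentMap (origin Q n) (1 ⊗ₜ[ℤ] toGp Q p, 0) + ddiff (hh.log hpos.ne') := by
  ext w
  rw [LinearMap.add_apply, bCotangentMap_tmul]
  exact bTangent_apply_eq hf hh hpos hfh w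

end Vertex

/-! ### Depth strata -/

section Depth

variable {Q : Type*} [AddCommMonoid Q] [IsToric Q] {n : ℕ}

theorem toGp_injective_of_submonoid (F : AddSubmonoid Q) : Function.Injective (toGp F) := by
  intro a b h
  obtain ⟨c, hc⟩ := toGp_eq_iff.1 h
  exact Subtype.ext (toric_cancel (congrArg Subtype.val hc))

/-- A face of a toric monoid contains every larger submonoid of the same rank. -/
theorem le_of_rank_eq {F F' : AddSubmonoid Q} (hF : IsFace F) (hle : F ≤ F')
    (hr : rank F = rank F') : F' ≤ F := by
  let ι := (Algebra.GrothendieckAddGroup.lift ((toGp Q).comp F'.subtype)).toIntLinearMap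
  have hι : Function.Injective ι :=
    gp_map_injective F'.subtype Subtype.val_injective IsToric.integral
  have : Module.Finite ℤ (Gp F') := Module.Finite.of_injective ι hι
  let J := (Algebra.GrothendieckAddGroup.lift
    ((toGp F').comp (AddSubmonoid.inclusion hle))).toIntLinearMap
  have hJ : Function.Injective J := gp_map_injective _ (AddSubmonoid.inclusion_injective hle)
    (toGp_injective_of_submonoid F')
  have h1 : Module.finrank ℤ (LinearMap.range J) = Module.finrank ℤ (Gp F') :=
    (LinearMap.finrank_range_of_inj hJ).trans hr
  have h2 := Submodule.finrank_quotient_add_finrank (LinearMap.range J)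
  -- Equal ranks make the quotient of the group completions torsion, so N·p + b ∈ F for some N ≠ 0
  -- and b ∈ F; the face property then yields p ∈ F.
  have h3 : Module.finrank ℤ (Gp F' ⧸ LinearMap.range J) = 0 := by omega
  intro p hp
  obtain ⟨k, hk⟩ := (Module.finrank_eq_zero_iff (R := ℤ)).1 h3
    ((LinearMap.range J).mkQ (toGp F' ⟨p, hp⟩))
  obtain ⟨hk0, hk⟩ := hk
  obtain ⟨N, hN, hNJ⟩ : ∃ N : ℕ, N ≠ 0 ∧ N • toGp F' ⟨p, hp⟩ ∈ LinearMap.range J := by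
    refine ⟨k.natAbs, Int.natAbs_ne_zero.2 hk0, ?_⟩
    rw [← map_smul, Submodule.mkQ_apply, Submodule.Quotient.mk_eq_zero] at hk
    rw [← natCast_zsmul]
    rcases Int.natAbs_eq k with h | h
    · rwa [h] at hk
    · rw [h, neg_smul] at hk
      exact (Submodule.neg_mem_iff _).1 hk
  obtain ⟨x, hx⟩ := hNJ
  obtain ⟨a, b, rfl⟩ := exists_toGp_sub x
  have hJt : ∀ a : F, J (toGp F a) = toGp F' (AddSubmonoid.inclusion hle a) := fun a =>
    lift_toGp _ a
  rw [map_sub, hJt, hJt, sub_eq_iff_eq_add, ← map_nsmul, ← map_add] at hx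
  have hx' : (a : Q) = N • p + b := congrArg Subtype.val (toGp_injective_of_submonoid F' hx)
  exact mem_of_nsmul_mem hF hN (hF _ _ (hx' ▸ a.2)).1

/-- Nonvanishing is open, and since supports are faces it need only be tested on finitely many
generators. -/
theorem eventually_supp_le (x : Model Q n) : ∀ᶠ u in 𝓝 x, supp x ≤ supp u := by
  classical
  obtain ⟨S, hS, -⟩ := exists_generators Q
  have hev : ∀ᶠ u in 𝓝 x, ∀ q ∈ S, lam q x ≠ 0 → lam q u ≠ 0 := by
    rw [Filter.eventually_all_finset]
    intro q _
    by_cases h : lam q x = 0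
    · exact Eventually.of_forall fun u h' => absurd h h'
    · exact ((continuous_lam q).continuousAt.eventually_ne h).mono fun u hu _ => hu
  filter_upwards [hev] with u hu q
  have hq : q ∈ AddSubmonoid.closure (S : Set Q) := by rw [hS]; trivial
  induction hq using AddSubmonoid.closure_induction with
  | mem q hq => exact hu q hq
  | zero => exact fun _ => (supp u).zero_mem
  | add p q _ _ hp hq =>
    intro h
    have := isFace_supp x p q h
    exact (supp u).add_mem (hp this.1) (hq this.2)

/-- Supports can only grow near `x`, and a face has no strictly larger submonoid of the same rank,
so nearby points of equal depth have the same support. Hence vectors tangent to the stratum kill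
λ_p. -/
theorem eventually_lam_eq_zero_of_depth {x : Model Q n} {p : Q} (hp : lam p x = 0) :
    ∀ᶠ u in 𝓝 x, depth u = depth x → lam p u = 0 := by
  filter_upwards [eventually_supp_le x] with u hu hd
  by_contra hne
  have hr : rank (supp x) = rank (supp u) := by
    have : (rank Q : ℤ) - rank (supp u) = (rank Q : ℤ) - rank (supp x) := hd
    omega
  exact le_of_rank_eq (isFace_supp x) hu hr hne hp

end Depth

/-! ### A criterion for interior immersions -/

section Immersion

variable {Q : Type*} [AddCommMonoid Q] [IsToric Q] {n : ℕ}
  {P : Type*} [AddCommMonoid P] [IsToric P] {m : ℕ} {φ : Model P m → Model Q n} {y : Model P m}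

/-- Elements of `cornerMonoid y` ignore positive smooth factors, so only the exponent of the
pull-back of λ_q counts. -/
theorem cornerMap_lamGerm (hφ : InteriorMapAt φ y) {q : Q} {p : P} {h : Model P m → ℝ}
    (hh : SmoothAt h y) (hpos : 0 < h y) (heq : ∀ᶠ u in 𝓝 y, lam q (φ u) = lam p u * h u)
    (α : cornerMonoid y) : (cornerMap hφ α).1 (lamGerm (φ y) q) = α.1 (lamGerm y p) :=
  cornerMonoid_apply α (b := (pullInterior hφ (lamGerm (φ y) q)).toMul) hh hpos
    (Germ.coe_eq.2 heq)

/-- This is the power rule, multiplied by λ_p(y) to avoid the exponent k − 1. -/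
theorem lam_deriv_nsmul {v : smoothGerm y →ₗ[ℝ] ℝ} (hv : IsDerivation v) (k : ℕ) (p : P) :
    lam p y * v (smoothAt_lam (x := y) (k • p)).germ =
      k * lam p y ^ k * v (smoothAt_lam (x := y) p).germ := by
  induction k with
  | zero =>
    have : (smoothAt_lam (x := y) (0 • p)).germ = (smoothAt_const (x := y) (1 : ℝ)).germ :=
      smoothGerm_congr _ _ (Eventually.of_forall fun u => by rw [zero_smul, lam_zero])
    rw [this, hv.const]
    simp
  | succ k ih =>
    have : (smoothAt_lam (x := y) ((k + 1) • p)).germ =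
        ((smoothAt_lam (x := y) (k • p)).mul (smoothAt_lam (x := y) p)).germ :=
      smoothGerm_congr _ _ (Eventually.of_forall fun u => by rw [succ_nsmul, lam_add])
    rw [this, hv.mul (smoothAt_lam _) (smoothAt_lam _), mul_add, ← mul_assoc, mul_comm _ (lam p y), ← mul_assoc, mul_assoc _ _ (v _),
      lam_nsmul, pow_succ]
    push_cast
    linear_combination (lam p y) * ih

theorem eq_of_nsmul_hom {θ : Q →+ P} (hsat : ∀ p, ∃ N : ℕ, N ≠ 0 ∧ ∃ q, N • p = θ q)
    {ρ ρ' : P →+ ℕ} (h : ∀ q, ρ (θ q) = ρ' (θ q)) (p : P) : ρ p = ρ' p := by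
  obtain ⟨N, hN, q, hq⟩ := hsat p
  have := h q
  rw [← hq, map_nsmul, map_nsmul, smul_eq_mul, smul_eq_mul] at this
  exact Nat.eq_of_mul_eq_mul_left (Nat.pos_of_ne_zero hN) this

theorem cornerMap_injective {θ : Q →+ P} (hsat : ∀ p, ∃ N : ℕ, N ≠ 0 ∧ ∃ q, N • p = θ q)
    (hφ : InteriorMapAt φ y)
    (hlam : ∀ q, ∃ h : Model P m → ℝ, SmoothAt h y ∧ 0 < h y ∧
      ∀ᶠ u in 𝓝 y, lam q (φ u) = lam (θ q) u * h u) :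
    Function.Injective (cornerMap hφ) := by
  intro α α' hα
  refine cornerMonoid_ext fun p => ?_
  refine eq_of_nsmul_hom hsat (ρ := α.1.comp (lamGerm y)) (ρ' := α'.1.comp (lamGerm y))
    (fun q => ?_) p
  obtain ⟨h, hh, hpos, heq⟩ := hlam q
  change α.1 (lamGerm y (θ q)) = α'.1 (lamGerm y (θ q))
  rw [← cornerMap_lamGerm hφ hh hpos heq, ← cornerMap_lamGerm hφ hh hpos heq, hα]

/-- A criterion for the group completion of a quotient monoid to be torsion-free. -/
theorem gp_quotCon_torsionFree {A : Type*} [AddCommMonoid A] {S : AddSubmonoid A}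
    (h : ∀ k : ℕ, k ≠ 0 → ∀ a b c s s' : A, s ∈ S → s' ∈ S →
      c + k • a + s = c + k • b + s' → ∃ t ∈ S, ∃ t' ∈ S, a + t = b + t') :
    IsAddTorsionFree (Gp (quotCon S).Quotient) := by
  suffices key : ∀ k : ℕ, k ≠ 0 → ∀ x : Gp (quotCon S).Quotient, k • x = 0 → x = 0 by
    refine ⟨fun k hk x x' hxx => ?_⟩
    rw [← sub_eq_zero]
    refine key k hk _ ?_
    rw [smul_sub, sub_eq_zero]
    exact hxx
  intro k hk x hx
  obtain ⟨a', b', rfl⟩ := exists_toGp_sub x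
  obtain ⟨a, rfl⟩ := AddCon.mk'_surjective a'
  obtain ⟨b, rfl⟩ := AddCon.mk'_surjective b'
  have hx' : toGp _ ((quotCon S).mk' (k • a)) = toGp _ ((quotCon S).mk' (k • b)) := by
    rw [smul_sub, sub_eq_zero] at hx
    simpa only [map_nsmul] using hx
  obtain ⟨c', hc⟩ := toGp_eq_iff.1 hx'
  obtain ⟨c, rfl⟩ := AddCon.mk'_surjective c'
  rw [← map_add, ← map_add] at hc
  obtain ⟨s, hs, s', hs', heq⟩ := (AddCon.eq (quotCon S)).1 hc
  have hab : (quotCon S).mk' a = (quotCon S).mk' b :=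
    (AddCon.eq (quotCon S)).2 (h k hk a b c s s' hs hs' heq)
  rw [hab, sub_self]

/-- If k·a and k·b agree modulo the image, via s and s', then s' − s is divisible by k on θ(Q),
hence on P, which θ(Q) generates as a group. The quotient by k still vanishes on the support of `y`,
so it is a difference of two elements of M̃_y, and these identify a with b. -/
theorem cornerMap_torsionFree {θ : Q →+ P} (hgen : ∀ p, ∃ q q', p + θ q' = θ q)
    (hφ : InteriorMapAt φ y)
    (hlam : ∀ q, ∃ h : Model P m → ℝ, SmoothAt h y ∧ 0 < h y ∧
      ∀ᶠ u in 𝓝 y, lam q (φ u) = lam (θ q) u * h u) :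
    IsAddTorsionFree (Gp (quotCon (AddMonoidHom.mrange (cornerMap hφ))).Quotient) := by
  have hcm : ∀ (α : cornerMonoid y) (q : Q),
      (cornerMap hφ α).1 (lamGerm (φ y) q) = α.1 (lamGerm y (θ q)) := by
    intro α q
    obtain ⟨h, hh, hpos, heq⟩ := hlam q
    exact cornerMap_lamGerm hφ hh hpos heq α
  refine gp_quotCon_torsionFree fun k hk a b c _ _ hs hs' heq => ?_
  obtain ⟨s, rfl⟩ := hs
  obtain ⟨s', rfl⟩ := hs'
  have hval : ∀ q, (s'.1 (lamGerm y (θ q)) : ℤ) - s.1 (lamGerm y (θ q)) =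
      k * (a.1 (lamGerm (φ y) q) - b.1 (lamGerm (φ y) q)) := by
    intro q
    have := congrArg (fun α : cornerMonoid (φ y) => α.1 (lamGerm (φ y) q)) heq
    change c.1 (lamGerm (φ y) q) + k • a.1 (lamGerm (φ y) q) +
        (cornerMap hφ s).1 (lamGerm (φ y) q) =
      c.1 (lamGerm (φ y) q) + k • b.1 (lamGerm (φ y) q) +
        (cornerMap hφ s').1 (lamGerm (φ y) q) at this
    rw [hcm, hcm, smul_eq_mul, smul_eq_mul] at this
    zify at this
    linear_combination -this
  let δ : P →+ ℤ := (Nat.castAddMonoidHom ℤ).comp (s'.1.comp (lamGerm y)) -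
    (Nat.castAddMonoidHom ℤ).comp (s.1.comp (lamGerm y))
  have hδ : ∀ p, δ p = s'.1 (lamGerm y p) - s.1 (lamGerm y p) := fun p => rfl
  have hdvd : ∀ p, (k : ℤ) ∣ δ p := by
    intro p
    obtain ⟨q, q', hq⟩ := hgen p
    have h1 : δ p = δ (θ q) - δ (θ q') := by rw [← hq, map_add]; ring
    rw [h1, hδ, hδ, hval, hval, ← mul_sub]
    exact dvd_mul_right _ _
  have hk' : (k : ℤ) ≠ 0 := by exact_mod_cast hk
  let τ : P →+ ℤ :=
    { toFun := fun p => δ p / k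
      map_zero' := by simp
      map_add' := fun p q => by rw [map_add, Int.add_ediv_of_dvd_left (hdvd p)] }
  have hτ : ∀ p, k * τ p = δ p := fun p => Int.mul_ediv_cancel' (hdvd p)
  obtain ⟨ρ₁, ρ₂, h1, h2, h12⟩ := exists_sub_of_vanish (isFace_supp y) τ fun p hp => by
    apply mul_left_cancel₀ hk'
    rw [hτ, hδ, cornerMonoid_vanish s' hp, cornerMonoid_vanish s hp]
    simp
  obtain ⟨α₁, hα₁⟩ := exists_cornerMonoid ρ₁ h1
  obtain ⟨α₂, hα₂⟩ := exists_cornerMonoid ρ₂ h2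
  refine ⟨_, ⟨α₂, rfl⟩, _, ⟨α₁, rfl⟩, cornerMonoid_ext fun q => ?_⟩
  change a.1 (lamGerm (φ y) q) + (cornerMap hφ α₂).1 (lamGerm (φ y) q) =
    b.1 (lamGerm (φ y) q) + (cornerMap hφ α₁).1 (lamGerm (φ y) q)
  rw [hcm, hcm, hα₁, hα₂]
  have h3 := h12 (θ q)
  have h4 : τ (θ q) = a.1 (lamGerm (φ y) q) - b.1 (lamGerm (φ y) q) := by
    apply mul_left_cancel₀ hk'
    rw [hτ, hδ, hval]
  zify
  rw [h3, h4]
  ring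

theorem pullSmooth_germ (hφ : InteriorMapAt φ y) {F : Model Q n → ℝ} (hF : SmoothAt F (φ y))
    {f : Model P m → ℝ} (hf : SmoothAt f y) (h : ∀ᶠ u in 𝓝 y, F (φ u) = f u) :
    pullSmooth hφ hF.germ = hf.germ :=
  smoothGerm_ext (f := fun u => F (φ u)) rfl rfl h

/-- A criterion for interior immersions. -/
theorem interiorImmersionAt_of {θ : Q →+ P}
    (hsat : ∀ p, ∃ N : ℕ, N ≠ 0 ∧ ∃ q, N • p = θ q) (hgen : ∀ p, ∃ q q', p + θ q' = θ q)
    (hφ : InteriorMapAt φ y)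
    (hlam : ∀ q, ∃ h : Model P m → ℝ, SmoothAt h y ∧ 0 < h y ∧
      ∀ᶠ u in 𝓝 y, lam q (φ u) = lam (θ q) u * h u)
    (hpull : ∀ q, ∃ F : Model Q n → ℝ, SmoothAt F (φ y) ∧ ∀ᶠ u in 𝓝 y, F (φ u) = lam (θ q) u)
    (hz : ∀ a, ∃ F : Model Q n → ℝ, SmoothAt F (φ y) ∧ ∀ᶠ u in 𝓝 y, F (φ u) = u.2 a) :
    InteriorImmersionAt φ y := by
  refine ⟨hφ, fun v hv v' hv' hvv => ?_, cornerMap_injective hsat hφ hlam,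
    cornerMap_torsionFree hgen hφ hlam⟩
  obtain ⟨hd, hzero⟩ := (stratumTangent y).sub_mem hv hv'
  have hpb : ∀ a, (v - v') (pullSmooth hφ a) = 0 := fun a => by
    rw [LinearMap.sub_apply, sub_eq_zero]
    exact DFunLike.congr_fun hvv a
  rw [← sub_eq_zero]
  refine hd.eq_zero (fun p => ?_) fun a => ?_
  -- If λ_p(y) = 0, then λ_p vanishes on the stratum near y. Otherwise some power of λ_p is a
  -- pull-back, hence killed, and the power rule applies because λ_p(y) ≠ 0.
  · by_cases hp : lam p y = 0
    · exact hzero _ _ (eventually_lam_eq_zero_of_depth hp)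
    · obtain ⟨N, hN, q, hq⟩ := hsat p
      obtain ⟨F, hF, hFq⟩ := hpull q
      have h1 : (v - v') (smoothAt_lam (x := y) (N • p)).germ = 0 := by
        rw [← pullSmooth_germ hφ hF (smoothAt_lam (N • p)) (by rw [hq]; exact hFq)]
        exact hpb _
      have h2 := lam_deriv_nsmul hd N p
      rw [h1, mul_zero] at h2
      have h3 : (N : ℝ) * lam p y ^ N ≠ 0 :=
        mul_ne_zero (Nat.cast_ne_zero.2 hN) (pow_ne_zero _ hp)
      exact (mul_eq_zero.1 h2.symm).resolve_left h3
  · obtain ⟨F, hF, hFz⟩ := hz a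
    rw [← pullSmooth_germ hφ hF (smoothAt_coord a) hFz]
    exact hpb _

end Immersion

/-! ### Saturations -/

section Saturation

variable {Q : Type*} [AddCommMonoid Q] [IsToric Q] {L : Type*} [AddCommGroup L]

/-- The saturation of the image of a morphism from a monoid to an abelian group. -/
def saturation (π : Q →+ L) : AddSubmonoid L where
  carrier := {x | ∃ N : ℕ, N ≠ 0 ∧ ∃ q, N • x = π q}
  zero_mem' := ⟨1, one_ne_zero, 0, by simp⟩
  add_mem' := by
    rintro x y ⟨N, hN, q, hq⟩ ⟨N', hN', q', hq'⟩
    refine ⟨N * N', mul_ne_zero hN hN', N' • q + N • q', ?_⟩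
    rw [map_add, map_nsmul, map_nsmul, ← hq, ← hq', smul_add, mul_comm, mul_smul, mul_comm,
      mul_smul]

/-- The corestriction of a morphism to the saturation of its image. -/
def toSaturation (π : Q →+ L) : Q →+ saturation π :=
  π.codRestrict (saturation π) fun q => ⟨1, one_ne_zero, q, one_smul _ _⟩

variable (π : Q →+ L)

theorem nsmul_eq_zero_toric {N : ℕ} (hN : N ≠ 0) {q : Q} (h : N • q = 0) : q = 0 := by
  obtain ⟨d, rfl⟩ := Nat.exists_eq_succ_of_ne_zero hN
  rw [succ_nsmul, add_comm] at h
  exact IsToric.sharp _ _ h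

variable [IsAddTorsionFree L]

/-- Gordan's lemma. -/
theorem saturation_fg [AddGroup.FG L] : (saturation π).FG := by
  classical
  obtain ⟨S, hS, -⟩ := exists_generators Q
  have : Module.Finite ℤ L := Module.Finite.iff_addGroup_fg.2 inferInstance
  let b := Module.Free.chooseBasis ℤ L
  -- The group elements in the zonotope Σ [0, 1]·π(s) with rational coefficients. Their coordinates
  -- in a basis are bounded by C, so there are finitely many.
  let T : Set L := {x | ∃ (N : ℕ) (r : Q → ℕ), N ≠ 0 ∧ (∀ s, r s ≤ N) ∧ N • x = ∑ s ∈ S, r s • π s}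
  let C := fun i => ∑ s ∈ S, |b.equivFun (π s) i|
  have hT : T.Finite := by
    refine Set.Finite.of_finite_image (f := b.equivFun) ?_ b.equivFun.injective.injOn
    refine (Set.finite_Icc (-C) C).subset ?_
    rintro _ ⟨x, ⟨N, r, hN, hr, hx⟩, rfl⟩
    rw [Set.mem_Icc, Pi.le_def, Pi.le_def, ← forall_and]
    intro i
    rw [Pi.neg_apply, ← abs_le]
    have h1 : (N : ℤ) * b.equivFun x i = ∑ s ∈ S, (r s : ℤ) * b.equivFun (π s) i := by
      have := congrFun (congrArg b.equivFun hx) i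
      simpa only [map_nsmul, map_sum, Pi.smul_apply, Finset.sum_apply, nsmul_eq_mul,
        Pi.mul_apply, Pi.natCast_apply] using this
    have hN' : (0 : ℤ) < N := by exact_mod_cast Nat.pos_of_ne_zero hN
    have h2 : (N : ℤ) * |b.equivFun x i| ≤ N * C i := by
      rw [← abs_of_pos hN', ← abs_mul, h1, Finset.mul_sum, abs_of_pos hN']
      refine (Finset.abs_sum_le_sum_abs _ _).trans (Finset.sum_le_sum fun s _ => ?_)
      rw [abs_mul, Nat.abs_cast]
      exact mul_le_mul_of_nonneg_right (by exact_mod_cast hr s) (abs_nonneg _)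
    exact le_of_mul_le_mul_left h2 hN'
  have hπT : ∀ s ∈ S, π s ∈ T := fun s hs => by
    refine ⟨1, Pi.single s 1, one_ne_zero, fun t => ?_, ?_⟩
    · by_cases h : t = s
      · subst h; simp
      · simp [h]
    · rw [Finset.sum_eq_single_of_mem s hs (fun t _ h => by simp [h])]
      simp
  refine ⟨hT.toFinset, le_antisymm (AddSubmonoid.closure_le.2 ?_) ?_⟩
  · rw [Set.Finite.coe_toFinset]
    rintro x ⟨N, r, hN, -, hx⟩
    refine ⟨N, hN, ∑ s ∈ S, r s • s, ?_⟩
    rw [hx, map_sum]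
    exact Finset.sum_congr rfl fun s _ => (map_nsmul _ _ _).symm
  · rintro x ⟨N, hN, q, hq⟩
    rw [Set.Finite.coe_toFinset]
    have hqS : q ∈ AddSubmonoid.closure (S : Set Q) := by rw [hS]; trivial
    obtain ⟨c, -, hc⟩ := AddSubmonoid.mem_closure_finset.1 hqS
    -- Split each coefficient c_s / N into integer and fractional part: the fractional parts give an
    -- element of T, the integer parts a sum of the π(s), which also lie in T.
    have hx : x = (x - ∑ s ∈ S, (c s / N) • π s) + ∑ s ∈ S, (c s / N) • π s := by abel
    rw [hx]
    refine AddSubmonoid.add_mem _ (AddSubmonoid.subset_closure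
      ⟨N, fun s => c s % N, hN, fun s => (Nat.mod_lt _ (Nat.pos_of_ne_zero hN)).le, ?_⟩)
      (AddSubmonoid.sum_mem _ fun s hs =>
        AddSubmonoid.nsmul_mem _ (AddSubmonoid.subset_closure (hπT s hs)) _)
    rw [smul_sub, hq, ← hc, map_sum, Finset.smul_sum, ← Finset.sum_sub_distrib]
    refine Finset.sum_congr rfl fun s _ => ?_
    rw [map_nsmul, smul_smul, sub_eq_iff_eq_add, ← add_smul, Nat.mod_add_div]

variable {π}

/-- The group completion of the saturation is the ambient group. -/
theorem saturation_lift_bijective (hgen : ∀ x, ∃ q q', x = π q - π q') :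
    Function.Bijective (Algebra.GrothendieckAddGroup.lift (saturation π).subtype) := by
  constructor
  · rw [injective_iff_map_eq_zero]
    intro x hx
    obtain ⟨a, b, rfl⟩ := exists_toGp_sub x
    rw [map_sub, lift_toGp, lift_toGp, sub_eq_zero] at hx
    rw [Subtype.ext hx, sub_self]
  · intro x
    obtain ⟨q, q', rfl⟩ := hgen x
    refine ⟨toGp _ (toSaturation π q) - toGp _ (toSaturation π q'), ?_⟩
    rw [map_sub, lift_toGp, lift_toGp]
    rfl

theorem rank_saturation (hgen : ∀ x, ∃ q q', x = π q - π q') :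
    rank (saturation π) = Module.finrank ℤ L :=
  (LinearEquiv.ofBijective
    (Algebra.GrothendieckAddGroup.lift (saturation π).subtype).toIntLinearMap
    (saturation_lift_bijective hgen)).finrank_eq

theorem isToric_saturation [AddGroup.FG L] (hgen : ∀ x, ∃ q q', x = π q - π q')
    (hsharp : ∀ q, π q = 0 → q = 0) : IsToric (saturation π) := by
  have hJ := saturation_lift_bijective hgen
  refine ⟨?_, fun a b h => ?_, fun N x hN hx => ?_, ?_, fun p p' h => ?_⟩
  · exact (AddMonoid.fg_iff_addSubmonoid_fg _).2 (saturation_fg π)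
  · obtain ⟨c, hc⟩ := toGp_eq_iff.1 h
    exact Subtype.ext (add_left_cancel (congrArg Subtype.val hc))
  · obtain ⟨⟨p, M, hM, q, hq⟩, hp⟩ := hx
    have h1 := congrArg (Algebra.GrothendieckAddGroup.lift (saturation π).subtype) hp
    rw [lift_toGp, map_nsmul] at h1
    change p = N • _ at h1
    refine ⟨⟨Algebra.GrothendieckAddGroup.lift (saturation π).subtype x, M * N,
      mul_ne_zero hM hN.ne', q, ?_⟩, hJ.1 ?_⟩
    · rw [mul_smul, ← h1, hq]
    · rw [lift_toGp]
      rfl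
  · exact hJ.1.isAddTorsionFree (Algebra.GrothendieckAddGroup.lift (saturation π).subtype)
  · obtain ⟨p, N, hN, q, hq⟩ := p
    obtain ⟨p', N', hN', q', hq'⟩ := p'
    have h' : p + p' = 0 := congrArg Subtype.val h
    have h1 : N' • q + N • q' = 0 := by
      refine hsharp _ ?_
      rw [map_add, map_nsmul, map_nsmul, ← hq, ← hq', smul_smul, smul_smul, mul_comm, ← smul_add,
        h', smul_zero]
    have h2 := nsmul_eq_zero_toric hN' (IsToric.sharp _ _ h1)
    rw [h2, map_zero] at hq
    exact Subtype.ext ((nsmul_eq_zero_iff_right hN).1 hq)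

end Saturation

/-! ### The quotient of a toric monoid by a real subspace -/

section Quotient

variable {A : Type*} [AddCommGroup A]

/-- The real-linear extension of a morphism from an abelian group to `ℝ`. -/
def realExt (g : A →+ ℝ) : ℝ ⊗[ℤ] A →ₗ[ℝ] ℝ := LinearMap.liftBaseChange ℝ g.toIntLinearMap

theorem realExt_tmul (g : A →+ ℝ) (x : A) : realExt g (1 ⊗ₜ[ℤ] x) = g x := by
  rw [realExt, LinearMap.liftBaseChange_tmul, one_smul]
  rfl

/-- The elements of an abelian group which lie in a subspace of its real extension. -/
def latticeOf (B : Submodule ℝ (ℝ ⊗[ℤ] A)) : Submodule ℤ A :=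
  (B.restrictScalars ℤ).comap (TensorProduct.mk ℤ ℝ A 1)

theorem mem_latticeOf {B : Submodule ℝ (ℝ ⊗[ℤ] A)} {x : A} :
    x ∈ latticeOf B ↔ (1 : ℝ) ⊗ₜ[ℤ] x ∈ B := Iff.rfl

variable {ι : Type*} {β : ι → A}

/-- The real subspace spanned by a family of elements of an abelian group. -/
def realSpan (β : ι → A) : Submodule ℝ (ℝ ⊗[ℤ] A) :=
  Submodule.span ℝ (Set.range fun i => (1 : ℝ) ⊗ₜ[ℤ] β i)

theorem hom_eq_zero_of_mem_realSpan {g : A →+ ℝ} (hg : ∀ i, g (β i) = 0) {x : A}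
    (hx : (1 : ℝ) ⊗ₜ[ℤ] x ∈ realSpan β) : g x = 0 := by
  have hle : realSpan β ≤ LinearMap.ker (realExt g) := by
    refine Submodule.span_le.2 ?_
    rintro _ ⟨i, rfl⟩
    exact (realExt_tmul g _).trans (hg i)
  exact (realExt_tmul g x).symm.trans (hle hx)

/-- A real subspace is closed under division by nonzero integers. -/
theorem isAddTorsionFree_quotient_latticeOf (B : Submodule ℝ (ℝ ⊗[ℤ] A)) :
    IsAddTorsionFree (A ⧸ latticeOf B) := by
  suffices key : ∀ k : ℕ, k ≠ 0 → ∀ x : A ⧸ latticeOf B, k • x = 0 → x = 0 by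
    refine ⟨fun k hk x x' hxx => ?_⟩
    rw [← sub_eq_zero]
    refine key k hk _ ?_
    rw [smul_sub, sub_eq_zero]
    exact hxx
  intro k hk x hx
  obtain ⟨x, rfl⟩ := (latticeOf B).mkQ_surjective x
  rw [← map_nsmul, Submodule.mkQ_apply, Submodule.Quotient.mk_eq_zero, mem_latticeOf,
    TensorProduct.tmul_smul, ← Nat.cast_smul_eq_nsmul ℝ] at hx
  rw [Submodule.mkQ_apply, Submodule.Quotient.mk_eq_zero, mem_latticeOf]
  exact (Submodule.smul_mem_iff _ (Nat.cast_ne_zero.2 hk)).1 hx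

/-- The lattice contains the β_i, so it spans the subspace over ℝ; flatness of ℝ over ℤ makes its
base change embed with that image. -/
theorem finrank_latticeOf [Module.Finite ℤ A] [Module.Free ℤ A] (β : ι → A) :
    Module.finrank ℤ (latticeOf (realSpan β)) = Module.finrank ℝ (realSpan β) := by
  have hspan : (latticeOf (realSpan β)).baseChange ℝ = realSpan β := by
    rw [Submodule.baseChange_eq_span]
    refine le_antisymm (Submodule.span_le.2 ?_) (Submodule.span_le.2 ?_)
    · rintro _ ⟨x, hx, rfl⟩
      exact hx
    · rintro _ ⟨i, rfl⟩
      exact Submodule.subset_span ⟨β i, Submodule.subset_span ⟨i, rfl⟩, rfl⟩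
  have hinj : Function.Injective ((latticeOf (realSpan β)).subtype.baseChange ℝ) :=
    Module.Flat.lTensor_preserves_injective_linearMap (M := ℝ)
      (latticeOf (realSpan β)).subtype Subtype.val_injective
  rw [← Module.finrank_baseChange (R := ℝ) (S := ℤ) (M' := latticeOf (realSpan β)),
    ← LinearMap.finrank_range_of_inj hinj]
  change Module.finrank ℝ ((latticeOf (realSpan β)).baseChange ℝ) = _
  rw [hspan]

end Quotient

/-- The toric monoid obtained from `Q` by imposing the relations `β = 0`. -/
theorem exists_quotient_monoid {Q : Type u} [AddCommMonoid Q] [IsToric Q] {k : ℕ}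
    (β : Fin k → Gp Q)
    (hsharp : ∀ q : Q, (1 : ℝ) ⊗ₜ[ℤ] toGp Q q ∈ realSpan β → q = 0) :
    ∃ (P : Type u) (_ : AddCommMonoid P) (_ : IsToric P) (θ : Q →+ P),
      (∀ p, ∃ N : ℕ, N ≠ 0 ∧ ∃ q, N • p = θ q) ∧ (∀ p, ∃ q q', p + θ q' = θ q) ∧
      (∀ q, θ q = 0 → q = 0) ∧
      rank P + Module.finrank ℝ (realSpan β) = rank Q ∧
      (∀ q q', θ q = θ q' ↔ (1 : ℝ) ⊗ₜ[ℤ] (toGp Q q - toGp Q q') ∈ realSpan β) ∧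
      (∀ ℓ : Gp Q →+ ℝ, (∀ i, ℓ (β i) = 0) → ∃ ℓ' : P →+ ℝ, ∀ q, ℓ' (θ q) = ℓ (toGp Q q)) ∧
      (∀ ρ ∈ annihilator β, ∃ ρ' : P →+ ℕ, ∀ q, ρ' (θ q) = ρ q) := by
  -- Dividing by all lattice points of the real span, rather than by the subgroup generated by the
  -- β_i, makes the quotient torsion-free.
  let N := latticeOf (realSpan β)
  let π : Q →+ Gp Q ⧸ N := N.mkQ.toAddMonoidHom.comp (toGp Q)
  have hπ : ∀ q, π q = N.mkQ (toGp Q q) := fun q => rfl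
  have : IsAddTorsionFree (Gp Q ⧸ N) := isAddTorsionFree_quotient_latticeOf _
  have : AddGroup.FG (Gp Q ⧸ N) := Module.Finite.iff_addGroup_fg.1 inferInstance
  have hgen : ∀ x, ∃ q q', x = π q - π q' := by
    intro x
    obtain ⟨x, rfl⟩ := N.mkQ_surjective x
    obtain ⟨a, b, rfl⟩ := exists_toGp_sub x
    exact ⟨a, b, map_sub _ _ _⟩
  have hlift : ∀ {G : Type} [AddCommGroup G] (ℓ : Gp Q →+ G), (∀ x ∈ N, ℓ x = 0) →
      ∃ ℓ' : (Gp Q ⧸ N) →+ G, ∀ q, ℓ' (π q) = ℓ (toGp Q q) := by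
    intro G _ ℓ hℓ
    exact ⟨(N.liftQ ℓ.toIntLinearMap fun x hx => hℓ x hx).toAddMonoidHom, fun q => rfl⟩
  refine ⟨saturation π, inferInstance, isToric_saturation hgen ?_, toSaturation π,
    ?_, ?_, ?_, ?_, ?_, ?_, ?_⟩
  · intro q hq
    rw [hπ, Submodule.mkQ_apply, Submodule.Quotient.mk_eq_zero] at hq
    exact hsharp q hq
  · rintro ⟨p, M, hM, q, hq⟩
    exact ⟨M, hM, q, Subtype.ext hq⟩
  · rintro ⟨p, hp⟩
    obtain ⟨q, q', rfl⟩ := hgen p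
    exact ⟨q, q', Subtype.ext (sub_add_cancel _ _)⟩
  · intro q hq
    have hq' : π q = 0 := congrArg Subtype.val hq
    rw [hπ, Submodule.mkQ_apply, Submodule.Quotient.mk_eq_zero] at hq'
    exact hsharp q hq'
  · rw [rank_saturation hgen, ← finrank_latticeOf]
    exact Submodule.finrank_quotient_add_finrank N
  · intro q q'
    rw [← mem_latticeOf, ← Submodule.Quotient.mk_eq_zero, ← Submodule.mkQ_apply, map_sub,
      sub_eq_zero]
    exact Subtype.ext_iff
  · intro ℓ hℓ
    obtain ⟨ℓ', hℓ'⟩ := hlift ℓ fun x hx => hom_eq_zero_of_mem_realSpan hℓ hx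
    exact ⟨ℓ'.comp (saturation π).subtype, hℓ'⟩
  · intro ρ hρ
    obtain ⟨ℓ', hℓ'⟩ := hlift (extendDual ρ) fun x hx => by
      have := hom_eq_zero_of_mem_realSpan (g := (Int.castAddHom ℝ).comp (extendDual ρ))
        (fun i => by rw [AddMonoidHom.comp_apply, hρ i, map_zero]) hx
      simpa using this
    -- A multiple of each element of the saturation comes from Q, where ρ is nonnegative.
    have hpos : ∀ p : saturation π, 0 ≤ (ℓ'.comp (saturation π).subtype) p := by
      rintro ⟨p, M, hM, q, hq⟩
      change 0 ≤ ℓ' p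
      have h1 : M • ℓ' p = ρ q := by rw [← map_nsmul, hq, hℓ', extendDual_toGp]
      rw [nsmul_eq_mul] at h1
      refine nonneg_of_mul_nonneg_right (a := (M : ℤ)) ?_ (by positivity)
      rw [h1]
      positivity
    refine ⟨toNatHom _ hpos, fun q => ?_⟩
    zify
    rw [toNatHom_cast]
    exact (hℓ' q).trans (extendDual_toGp _ _)

/-- The dual of the quotient monoid is the annihilator of the relations. -/
theorem exists_dual_equiv_annihilator {Q P : Type*} [AddCommMonoid Q] [AddCommMonoid P] {k : ℕ}
    [IsToric Q] [IsToric P]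
    {β : Fin k → Gp Q} {θ : Q →+ P} (hsat : ∀ p, ∃ N : ℕ, N ≠ 0 ∧ ∃ q, N • p = θ q)
    (hker : ∀ q q', θ q = θ q' ↔ (1 : ℝ) ⊗ₜ[ℤ] (toGp Q q - toGp Q q') ∈ realSpan β)
    (hfac : ∀ ρ ∈ annihilator β, ∃ ρ' : P →+ ℕ, ∀ q, ρ' (θ q) = ρ q) :
    ∃ e : (P →+ ℕ) ≃+ annihilator β, ∀ ρ, (e ρ : Q →+ ℕ) = ρ.comp θ := by
  have hmem : ∀ ρ : P →+ ℕ, ρ.comp θ ∈ annihilator β := by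
    intro ρ i
    obtain ⟨a, b, hab⟩ := exists_toGp_sub (β i)
    have h : θ a = θ b := by
      rw [hker, ← hab]
      exact Submodule.subset_span ⟨i, rfl⟩
    rw [hab, map_sub, extendDual_toGp, extendDual_toGp, AddMonoidHom.comp_apply,
      AddMonoidHom.comp_apply, h, sub_self]
  let F : (P →+ ℕ) →+ annihilator β :=
    { toFun := fun ρ => ⟨ρ.comp θ, hmem ρ⟩
      map_zero' := rfl
      map_add' := fun _ _ => rfl }
  refine ⟨AddEquiv.ofBijective F ⟨fun ρ ρ' h => ?_, fun ρ => ?_⟩, fun ρ => rfl⟩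
  · exact AddMonoidHom.ext (eq_of_nsmul_hom hsat fun q =>
      DFunLike.congr_fun (congrArg Subtype.val h) q)
  · obtain ⟨ρ', hρ'⟩ := hfac ρ.1 ρ.2
    exact ⟨ρ', Subtype.ext (AddMonoidHom.ext hρ')⟩

/-- The map `X_P → X_Q` of a morphism `Q → P` which is surjective up to saturation is a closed
embedding. -/
theorem isClosedEmbedding_xmap {Q P : Type*} [AddCommMonoid Q] [AddCommMonoid P] {θ : Q →+ P}
    (hsat : ∀ p, ∃ N : ℕ, N ≠ 0 ∧ ∃ q, N • p = θ q) : IsClosedEmbedding (xmap θ) := by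
  choose N hN r hr using hsat
  -- A continuous inverse on the image: x(p) is the N-th root of x(N·p) = x(θ(r p)).
  let R : XSpace Q → P → ℝ := fun y p => y.1 (r p) ^ ((N p : ℝ)⁻¹)
  have hR : Continuous R := by
    refine continuous_pi fun p => ?_
    have h1 : Continuous fun y : XSpace Q => y.1 (r p) :=
      (continuous_apply (r p)).comp continuous_subtype_val
    exact h1.rpow_const fun y => Or.inr (by positivity)
  have hpow : ∀ (x : XSpace P) (k : ℕ) (p : P), x.1 (k • p) = x.1 p ^ k := fun x k p =>
    lam_nsmul (n := 0) k p (x, 0)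
  have hRx : ∀ x, R (xmap θ x) = x.1 := by
    intro x
    funext p
    change x.1 (θ (r p)) ^ ((N p : ℝ)⁻¹) = x.1 p
    rw [← hr, hpow, Real.pow_rpow_inv_natCast (x.2.1 p) (hN p)]
  have hemb : IsEmbedding (xmap θ) := by
    refine IsEmbedding.of_comp (continuous_xmap θ) hR ?_
    have : R ∘ xmap θ = Subtype.val := funext hRx
    rw [this]
    exact IsEmbedding.subtypeVal
  refine ⟨hemb, ?_⟩
  have hRp : ∀ p, Continuous fun y => R y p := fun p => (continuous_apply p).comp hR
  -- The image is cut out by the closed conditions that R y is a morphism and that it pulls back to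
  -- y along θ.
  have hrange : Set.range (xmap θ) = {y | R y 0 = 1} ∩ ((⋂ p, ⋂ p', {y | R y (p + p') =
      R y p * R y p'}) ∩ ⋂ q, {y | R y (θ q) = y.1 q}) := by
    ext y
    constructor
    · rintro ⟨x, rfl⟩
      simp only [Set.mem_inter_iff, Set.mem_iInter, Set.mem_ofPred_eq, hRx]
      exact ⟨x.2.2.1, x.2.2.2, fun q => rfl⟩
    · rintro ⟨h1, h2, h3⟩
      simp only [Set.mem_iInter] at h2 h3
      exact ⟨⟨R y, fun p => Real.rpow_nonneg (y.2.1 _) _, h1, h2⟩, Subtype.ext (funext h3)⟩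
  rw [hrange]
  refine (isClosed_eq (hRp 0) continuous_const).inter
    ((isClosed_iInter fun p => isClosed_iInter fun p' =>
      isClosed_eq (hRp _) ((hRp p).mul (hRp p'))).inter
    (isClosed_iInter fun q => isClosed_eq (hRp _) ?_))
  exact (continuous_apply q).comp continuous_subtype_val

/-! ### Coordinates with respect to a generating set -/

section Generators

variable {Q : Type*} [AddCommMonoid Q] {n : ℕ} {S : Finset Q}

theorem exists_monomial (hS : AddSubmonoid.closure (S : Set Q) = ⊤) (q : Q) :
    ∃ c : S → ℕ, ∀ u : Model Q n, lam q u = ∏ s, (coords S u).1 s ^ c s := by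
  classical
  have hq : q ∈ AddSubmonoid.closure (S : Set Q) := by rw [hS]; trivial
  induction hq using AddSubmonoid.closure_induction with
  | mem q hq =>
    refine ⟨Pi.single ⟨q, hq⟩ 1, fun u => ?_⟩
    rw [Finset.prod_eq_single_of_mem ⟨q, hq⟩ (Finset.mem_univ _) fun t _ h => by simp [h]]
    simp [coords]
  | zero => exact ⟨0, fun u => by simp [lam_zero]⟩
  | add p q _ _ hp hq =>
    obtain ⟨c, hc⟩ := hp
    obtain ⟨d, hd⟩ := hq
    refine ⟨c + d, fun u => ?_⟩
    rw [lam_add, hc, hd, ← Finset.prod_mul_distrib]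
    exact Finset.prod_congr rfl fun s _ => (pow_add _ _ _).symm

/-- Every λ_q is a monomial in those of the generators, so finitely many coordinates carry both the
points and the topology. -/
theorem isEmbedding_coords (hS : AddSubmonoid.closure (S : Set Q) = ⊤) :
    IsEmbedding (coords S : Model Q n → _) := by
  choose c hc using fun q => exists_monomial (n := n) hS q
  let C : (S → ℝ) × (Fin n → ℝ) → (Q → ℝ) × (Fin n → ℝ) :=
    fun y => (fun q => ∏ s, y.1 s ^ c q s, y.2)
  have hC : Continuous C := by fun_prop
  refine IsEmbedding.of_comp (continuous_coords S) hC ?_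
  have : C ∘ coords S = Prod.map Subtype.val id :=
    funext fun u => Prod.ext (funext fun q => (hc q u).symm) rfl
  rw [this]
  exact IsEmbedding.subtypeVal.prodMap IsEmbedding.id

/-- Neighbourhoods in terms of the coordinates with respect to a generating set. -/
theorem exists_open_coords (hS : AddSubmonoid.closure (S : Set Q) = ⊤) {x : Model Q n}
    {p : Model Q n → Prop} (h : ∀ᶠ u in 𝓝 x, p u) :
    ∃ O : Set ((S → ℝ) × (Fin n → ℝ)), IsOpen O ∧ coords S x ∈ O ∧ ∀ u, coords S u ∈ O → p u := by
  rw [(isEmbedding_coords hS).isInducing.nhds_eq_comap, eventually_comap] at h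
  obtain ⟨O, hO, hOo, hx⟩ := eventually_nhds_iff.1 h
  exact ⟨O, hOo, hx, fun u hu => hO _ hu u rfl⟩

/-- Smooth functions are locally smooth functions of the coordinates with respect to a given
generating set. -/
theorem SmoothAt.exists_rep (hS : AddSubmonoid.closure (S : Set Q) = ⊤) {x : Model Q n}
    {f : Model Q n → ℝ} (hf : SmoothAt f x) :
    ∃ (O : Set ((S → ℝ) × (Fin n → ℝ))) (g : (S → ℝ) × (Fin n → ℝ) → ℝ), IsOpen O ∧
      coords S x ∈ O ∧ ContDiffOn ℝ ∞ g O ∧ ∀ u, coords S u ∈ O → f u = g (coords S u) := by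
  obtain ⟨s, W, g, hW, hg, hfg⟩ := hf
  choose c hc using fun q => exists_monomial (n := n) hS q
  let M : (S → ℝ) × (Fin n → ℝ) → (s → ℝ) × (Fin n → ℝ) :=
    fun y => (fun q => ∏ t, y.1 t ^ c q.1 t, y.2)
  have hM : ContDiff ℝ ∞ M := by
    refine ContDiff.prodMk (contDiff_pi.2 fun q => contDiff_prod fun t _ => ?_) contDiff_snd
    exact ContDiff.pow (by fun_prop) _
  have hMc : ∀ u, M (coords S u) = coords s u := fun u =>
    Prod.ext (funext fun q => (hc q.1 u).symm) rfl
  obtain ⟨O, hO, hx, hOp⟩ := exists_open_coords hS hfg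
  refine ⟨O ∩ M ⁻¹' W, g ∘ M, hO.inter (hW.preimage hM.continuous), ⟨hx, ?_⟩,
    hg.comp hM.contDiffOn fun y hy => hy.2, fun u hu => ?_⟩
  · change M _ ∈ W
    rw [hMc]
    exact hfg.self_of_nhds.1
  · rw [(hOp u hu.1).2, Function.comp_apply, hMc]

theorem coords_origin [IsToric Q] (h0 : 0 ∉ S) : coords S (origin Q n) = 0 :=
  Prod.ext (funext fun q => lam_origin_of_ne (n := n) fun h => h0 (h ▸ q.2)) rfl

theorem smoothAt_comp_coords {x : Model Q n} {O : Set ((S → ℝ) × (Fin n → ℝ))} (hO : IsOpen O)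
    {g : (S → ℝ) × (Fin n → ℝ) → ℝ} (hg : ContDiffOn ℝ ∞ g O) (hx : coords S x ∈ O) :
    SmoothAt (fun u => g (coords S u)) x :=
  ⟨S, O, g, hO, hg, ((continuous_coords S).continuousAt.eventually_mem (hO.mem_nhds hx)).mono
    fun _ hu => ⟨hu, rfl⟩⟩

end Generators

/-! ### Local diffeomorphisms and linear algebra -/

/-- The inverse function theorem for smooth functions on open sets. -/
theorem exists_local_diffeo {E F : Type*} [NormedAddCommGroup E] [NormedSpace ℝ E]
    [CompleteSpace E] [NormedAddCommGroup F] [NormedSpace ℝ F] {G : E → F} {O : Set E}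
    (hO : IsOpen O) (hG : ContDiffOn ℝ ∞ G O) {a : E} (ha : a ∈ O) {G' : E ≃L[ℝ] F}
    (hG' : HasFDerivAt G (G' : E →L[ℝ] F) a) :
    ∃ T : OpenPartialHomeomorph E F, a ∈ T.source ∧ T.source ⊆ O ∧ (∀ y, T y = G y) ∧
      ContDiffOn ℝ ∞ T.symm T.target := by
  have hGa : ContDiffAt ℝ ∞ G a := hG.contDiffAt (hO.mem_nhds ha)
  let T₀ := hGa.toOpenPartialHomeomorph G hG' (by simp)
  have hcont : ContinuousOn (fderiv ℝ G) O := hG.continuousOn_fderiv_of_isOpen hO (by simp)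
  -- Shrinking to the open set where the derivative is invertible makes the inverse smooth on its
  -- whole target, not only near the image of a.
  let O' := O ∩ fderiv ℝ G ⁻¹' Set.range ((↑) : (E ≃L[ℝ] F) → E →L[ℝ] F)
  have hO' : IsOpen O' := hcont.isOpen_inter_preimage hO (ContinuousLinearEquiv.isOpen)
  refine ⟨T₀.restrOpen O' hO', ⟨hGa.mem_toOpenPartialHomeomorph_source hG' (by simp), ha, G',
    hG'.fderiv.symm⟩, fun y hy => hy.2.1, fun y => rfl, fun y hy => ?_⟩
  have hs := (T₀.restrOpen O' hO').map_target hy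
  obtain ⟨e, he⟩ := hs.2.2
  have hd : HasFDerivAt G (e : E →L[ℝ] F) ((T₀.restrOpen O' hO').symm y) := by
    rw [he]
    exact ((hG.differentiableOn (by simp)).differentiableAt
      (hO.mem_nhds hs.2.1)).hasFDerivAt
  exact ((T₀.restrOpen O' hO').contDiffAt_symm hy hd
    (hG.contDiffAt (hO.mem_nhds hs.2.1))).contDiffWithinAt

/-- Independent linear functionals on `ℝⁿ` extend to linear coordinates. -/
theorem exists_complement {n : ℕ} {κ : Type*} [Fintype κ] (D : (Fin n → ℝ) →ₗ[ℝ] κ → ℝ)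
    (hD : LinearIndependent ℝ fun j a => D (Pi.single a 1) j) :
    ∃ (m : ℕ) (r : (Fin n → ℝ) →ₗ[ℝ] Fin m → ℝ), m + Fintype.card κ = n ∧
      ∀ z, D z = 0 → r z = 0 → z = 0 := by
  classical
  have hsurj : Function.Surjective D := by
    rw [← LinearMap.dualMap_injective_iff, injective_iff_map_eq_zero]
    intro L hL
    have h1 : ∑ j, L (Pi.single j 1) • (fun a => D (Pi.single a 1) j) = 0 := by
      funext a
      have h2 : L (D (Pi.single a 1)) = 0 := DFunLike.congr_fun hL (Pi.single a 1)
      rw [pi_eq_sum_univ' (D (Pi.single a 1)), map_sum] at h2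
      simpa [mul_comm] using h2
    have h3 := Fintype.linearIndependent_iff.1 hD _ h1
    refine (Pi.basisFun ℝ κ).ext fun j => ?_
    rw [Pi.basisFun_apply, h3 j]
    rfl
  -- The complementary coordinates are linear coordinates on ker D composed with a projection onto
  -- it.
  obtain ⟨p, hp⟩ := LinearMap.exists_leftInverse_of_injective (LinearMap.ker D).subtype
    (Submodule.ker_subtype _)
  let e := (Module.finBasis ℝ (LinearMap.ker D)).equivFun
  refine ⟨_, e.toLinearMap ∘ₗ p, ?_, fun z hz hr => ?_⟩
  · have := LinearMap.finrank_range_add_finrank_ker D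
    rw [LinearMap.range_eq_top.2 hsurj, finrank_top, Module.finrank_fintype_fun_eq_card,
      Module.finrank_fin_fun] at this
    rw [add_comm]
    exact this
  · have h1 : p z = 0 := e.map_eq_zero_iff.1 hr
    have h2 : p z = ⟨z, hz⟩ := DFunLike.congr_fun hp ⟨z, hz⟩
    rw [h1] at h2
    exact (congrArg Subtype.val h2).symm

/-- Independent elements of the real extension of an abelian group have dual morphisms to `ℝ`. -/
theorem exists_dual_homs {A : Type*} [AddCommGroup A] {ι : Type*} [DecidableEq ι] {b : ι → A}
    (hb : LinearIndependent ℝ fun i => (1 : ℝ) ⊗ₜ[ℤ] b i) :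
    ∃ e : ι → A →+ ℝ, ∀ i j, e i (b j) = if i = j then 1 else 0 := by
  obtain ⟨p, hp⟩ := LinearMap.exists_leftInverse_of_injective
    (Finsupp.linearCombination ℝ fun i => (1 : ℝ) ⊗ₜ[ℤ] b i) (LinearMap.ker_eq_bot.2 hb)
  refine ⟨fun i => ((Finsupp.lapply i ∘ₗ p).toAddMonoidHom).comp
    (TensorProduct.mk ℤ ℝ A 1).toAddMonoidHom, fun i j => ?_⟩
  have h1 := DFunLike.congr_fun hp (Finsupp.single j 1)
  rw [LinearMap.comp_apply, Finsupp.linearCombination_single, one_smul] at h1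
  change (p (1 ⊗ₜ[ℤ] b j)) i = _
  rw [h1]
  simp [Finsupp.single_apply, eq_comm]

/-! ### Normal forms -/

/-- The morphism `∑ c_i e_i`. -/
def sumHom {A ι : Type*} [AddCommGroup A] [Fintype ι] (e : ι → A →+ ℝ) (c : ι → ℝ) : A →+ ℝ where
  toFun x := ∑ i, e i x * c i
  map_zero' := by simp
  map_add' x y := by simp only [map_add, add_mul, Finset.sum_add_distrib]

theorem sumHom_apply {A ι : Type*} [AddCommGroup A] [Fintype ι] (e : ι → A →+ ℝ) (c : ι → ℝ)
    (x : A) : sumHom e c x = ∑ i, e i x * c i := rfl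

/-- Data for a change of coordinates near the vertex of `X_Q × ℝⁿ` which straightens equations
`log λ_{b_i} + H_i = 0` and `K_j = 0`. -/
structure Straightening (Q P : Type*) [AddCommMonoid Q] [AddCommMonoid P] (n m : ℕ) (S : Finset Q)
    (ι κ : Type*) [Fintype ι] [Fintype κ] where
  /-- the morphism to the monoid of the solution space -/
  θ : Q →+ P
  /-- the weights of the change of coordinates -/
  e : ι → Gp Q →+ ℝ
  /-- the corrections -/
  H : ι → (S → ℝ) × (Fin n → ℝ) → ℝ
  /-- the smooth equations -/
  K : κ → (S → ℝ) × (Fin n → ℝ) → ℝ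
  /-- the remaining linear coordinates -/
  r : (Fin n → ℝ) →L[ℝ] (Fin m → ℝ)
  /-- the domain of the equations -/
  O : Set ((S → ℝ) × (Fin n → ℝ))
  /-- the change of coordinates -/
  T : OpenPartialHomeomorph ((S → ℝ) × (Fin n → ℝ)) ((S → ℝ) × ((κ → ℝ) × (Fin m → ℝ)))
  isOpen_O : IsOpen O
  source_subset : T.source ⊆ O
  contDiffOn_H : ∀ i, ContDiffOn ℝ ∞ (H i) O
  contDiffOn_K : ∀ j, ContDiffOn ℝ ∞ (K j) O
  contDiffOn_symm : ContDiffOn ℝ ∞ T.symm T.target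
  T_apply : ∀ y, T y = (fun s => y.1 s * Real.exp (sumHom e (fun i => H i y) (toGp Q s.1)),
    (fun j => K j y, r y.2))

namespace Straightening

variable {Q P : Type*} [AddCommMonoid Q] [AddCommMonoid P] {n m : ℕ} {S : Finset Q}
  {ι κ : Type*} [Fintype ι] [Fintype κ] (D : Straightening Q P n m S ι κ)

/-- The straightened `X_Q`-coordinate of a point. -/
def straighten (u : Model Q n) : XSpace Q :=
  twist ((sumHom D.e fun i => D.H i (coords S u)).comp (toGp Q)) u.1

/-- The ambient coordinates of a point of `X_P × ℝᵐ`. -/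
def amb (y : Model P m) : (S → ℝ) × ((κ → ℝ) × (Fin m → ℝ)) :=
  (fun s => lam (D.θ s.1) y, (0, y.2))

/-- The corrections in terms of the straightened coordinates. -/
def corr (y : Model P m) : Gp Q →+ ℝ := sumHom D.e fun i => -D.H i (D.T.symm (D.amb y))

/-- The parametrization of the solution space. -/
def param (y : Model P m) : Model Q n :=
  (twist ((D.corr y).comp (toGp Q)) (xmap D.θ y.1), (D.T.symm (D.amb y)).2)

/-- The domain of the parametrization. -/
def dom : Set (Model P m) := {y | D.amb y ∈ D.T.target}

/-- The domain of the straightening. -/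
def codom : Set (Model Q n) := {u | coords S u ∈ D.T.source}

theorem continuous_amb : Continuous D.amb := by
  refine Continuous.prodMk (continuous_pi fun s => continuous_lam _) ?_
  exact continuous_const.prodMk continuous_snd

theorem isOpen_dom : IsOpen D.dom := D.T.open_target.preimage D.continuous_amb

theorem isOpen_codom : IsOpen D.codom := D.T.open_source.preimage (continuous_coords S)

theorem lam_param (q : Q) (y : Model P m) :
    lam q (D.param y) = lam (D.θ q) y * Real.exp (D.corr y (toGp Q q)) := rfl

theorem corr_eq (y : Model P m) (x : Gp Q) :
    D.corr y x = -sumHom D.e (fun i => D.H i (D.T.symm (D.amb y))) x := by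
  simp [corr, sumHom_apply]

variable {D}

theorem T_symm_spec {y : Model P m} (hy : y ∈ D.dom) :
    (∀ s : S, (D.T.symm (D.amb y)).1 s * Real.exp (-D.corr y (toGp Q s.1)) = lam (D.θ s.1) y) ∧
      (∀ j, D.K j (D.T.symm (D.amb y)) = 0) ∧ D.r (D.T.symm (D.amb y)).2 = y.2 := by
  have h := D.T.right_inv hy
  rw [D.T_apply] at h
  refine ⟨fun s => ?_, fun j => ?_, ?_⟩
  · rw [corr_eq, neg_neg]
    exact congrFun (congrArg Prod.fst h) s
  · exact congrFun (congrArg (fun w => w.2.1) h) j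
  · exact congrArg (fun w => w.2.2) h

/-- The parametrization is a twisted morphism, so it lies in X_Q × ℝⁿ by construction, whereas the
inverse diffeomorphism lives in the ambient space. The correction is chosen to make the two agree.
-/
theorem coords_param {y : Model P m} (hy : y ∈ D.dom) :
    coords S (D.param y) = D.T.symm (D.amb y) := by
  refine Prod.ext (funext fun s => ?_) rfl
  change lam s.1 (D.param y) = _
  rw [lam_param, ← (T_symm_spec hy).1 s, mul_assoc, ← Real.exp_add, neg_add_cancel, Real.exp_zero,
    mul_one]

theorem param_mem_codom {y : Model P m} (hy : y ∈ D.dom) : D.param y ∈ D.codom := by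
  change coords S (D.param y) ∈ D.T.source
  rw [coords_param hy]
  exact D.T.map_target hy

theorem lam_param_mul {y : Model P m} (hy : y ∈ D.dom) (q : Q) :
    lam q (D.param y) *
      Real.exp (sumHom D.e (fun i => D.H i (coords S (D.param y))) (toGp Q q)) =
      lam (D.θ q) y := by
  rw [lam_param, coords_param hy, corr_eq, mul_assoc, ← Real.exp_add, neg_add_cancel,
    Real.exp_zero, mul_one]

theorem straighten_param {y : Model P m} (hy : y ∈ D.dom) :
    D.straighten (D.param y) = xmap D.θ y.1 :=
  Subtype.ext (funext fun q => lam_param_mul hy q)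

theorem r_param {y : Model P m} (hy : y ∈ D.dom) : D.r (D.param y).2 = y.2 :=
  (T_symm_spec hy).2.2

theorem K_param {y : Model P m} (hy : y ∈ D.dom) (j : κ) : D.K j (coords S (D.param y)) = 0 := by
  rw [coords_param hy]
  exact (T_symm_spec hy).2.1 j

/-- Points of the solution space are parametrized. -/
theorem mem_dom_and_param_eq (hS : AddSubmonoid.closure (S : Set Q) = ⊤) {u : Model Q n}
    (hu : u ∈ D.codom) {x : XSpace P} (hx : xmap D.θ x = D.straighten u)
    (hK : ∀ j, D.K j (coords S u) = 0) :
    (x, D.r u.2) ∈ D.dom ∧ D.param (x, D.r u.2) = u := by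
  have hamb : D.amb (x, D.r u.2) = D.T (coords S u) := by
    rw [D.T_apply]
    refine Prod.ext (funext fun s => ?_) (Prod.ext (funext fun j => (hK j).symm) rfl)
    exact congrFun (congrArg Subtype.val hx) s.1
  have hdom : (x, D.r u.2) ∈ D.dom := by
    change D.amb _ ∈ D.T.target
    rw [hamb]
    exact D.T.map_source hu
  refine ⟨hdom, (isEmbedding_coords hS).injective ?_⟩
  rw [coords_param hdom, hamb, D.T.left_inv hu]

section Smooth

variable {y : Model P m}

theorem smoothAt_amb : SmoothAt D.amb y :=
  (SmoothAt.pi fun _ => smoothAt_lam _).prodMk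
    ((smoothAt_const (E := κ → ℝ) 0).prodMk smoothAt_snd)

theorem smoothAt_symm (hy : y ∈ D.dom) : SmoothAt (fun u => D.T.symm (D.amb u)) y :=
  smoothAt_amb.comp D.T.open_target D.contDiffOn_symm hy

theorem smoothAt_corr (hy : y ∈ D.dom) (x : Gp Q) : SmoothAt (fun u => D.corr u x) y := by
  refine SmoothAt.sum fun i => ?_
  refine (smoothAt_const _).mul (SmoothAt.neg ?_)
  exact (smoothAt_symm hy).comp D.isOpen_O (D.contDiffOn_H i)
    (D.source_subset (D.T.map_target hy))

theorem continuousAt_param (hS : AddSubmonoid.closure (S : Set Q) = ⊤) (hy : y ∈ D.dom) :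
    ContinuousAt D.param y := by
  rw [(isEmbedding_coords hS).isInducing.continuousAt_iff]
  refine (smoothAt_symm hy).continuousAt.congr ?_
  filter_upwards [D.isOpen_dom.mem_nhds hy] with u hu
  exact (coords_param hu).symm

theorem interiorMapAt_param (hS : AddSubmonoid.closure (S : Set Q) = ⊤) (hy : y ∈ D.dom) :
    InteriorMapAt D.param y where
  continuousAt := continuousAt_param hS hy
  interior q := ⟨D.θ q, _, (smoothAt_corr hy (toGp Q q)).exp,
    Eventually.of_forall fun _ => ⟨Real.exp_pos _, rfl⟩⟩
  smooth := (smoothAt_symm hy).comp isOpen_univ (G := Prod.snd) contDiff_snd.contDiffOn trivial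

theorem smoothAt_sumHom {u : Model Q n} (hu : coords S u ∈ D.O) (x : Gp Q) :
    SmoothAt (fun v => sumHom D.e (fun i => D.H i (coords S v)) x) u :=
  SmoothAt.sum fun i => (smoothAt_const _).mul
    (smoothAt_comp_coords D.isOpen_O (D.contDiffOn_H i) hu)

theorem continuousAt_straighten {u : Model Q n} (hu : coords S u ∈ D.O) :
    ContinuousAt D.straighten u := by
  refine IsInducing.subtypeVal.continuousAt_iff.2 (continuousAt_pi.2 fun q => ?_)
  exact ((smoothAt_lam q).mul (smoothAt_sumHom hu (toGp Q q)).exp).continuousAt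

theorem coords_param_mem (hy : y ∈ D.dom) : coords S (D.param y) ∈ D.O :=
  D.source_subset (param_mem_codom hy)

end Smooth

/-- Each λ_q pulls back to λ_{θ q} times a positive function; conversely the straightened λ_q and
the linear map r exhibit λ_{θ q} and z as pull-backs. -/
theorem interiorImmersionAt_param [IsToric Q] [IsToric P]
    (hS : AddSubmonoid.closure (S : Set Q) = ⊤)
    (hsat : ∀ p, ∃ N : ℕ, N ≠ 0 ∧ ∃ q, N • p = D.θ q) (hgen : ∀ p, ∃ q q', p + D.θ q' = D.θ q)
    {y : Model P m} (hy : y ∈ D.dom) : InteriorImmersionAt D.param y := by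
  have hev : ∀ᶠ u in 𝓝 y, u ∈ D.dom := D.isOpen_dom.mem_nhds hy
  refine interiorImmersionAt_of hsat hgen (interiorMapAt_param hS hy)
    (fun q => ⟨_, (smoothAt_corr hy (toGp Q q)).exp, Real.exp_pos _,
      Eventually.of_forall fun _ => rfl⟩)
    (fun q => ⟨_, (smoothAt_lam q).mul (smoothAt_sumHom (coords_param_mem hy) (toGp Q q)).exp,
      hev.mono fun u hu => lam_param_mul hu q⟩)
    fun a => ⟨fun u => D.r u.2 a, ?_, hev.mono fun u hu => congrFun (r_param hu) a⟩
  exact smoothAt_snd.comp isOpen_univ (G := fun z => D.r z a)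
    ((contDiff_apply ℝ ℝ a).comp D.r.contDiff).contDiffOn trivial

/-- Followed by the straightening and r, the parametrization becomes `xmap D.θ` times the identity,
which is an embedding; both factors being continuous, the first is one as well. -/
theorem isEmbedding_param (hS : AddSubmonoid.closure (S : Set Q) = ⊤)
    (hsat : ∀ p, ∃ N : ℕ, N ≠ 0 ∧ ∃ q, N • p = D.θ q) :
    IsEmbedding (D.dom.domRestrict D.param) := by
  let f : D.dom → D.codom := fun y => ⟨D.param y.1, param_mem_codom y.2⟩
  let g : D.codom → XSpace Q × (Fin m → ℝ) := fun u => (D.straighten u.1, D.r u.1.2)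
  have hf : Continuous f := by
    refine Continuous.subtype_mk (continuous_iff_continuousAt.2 fun y => ?_) _
    exact (continuousAt_param hS y.2).comp continuous_subtype_val.continuousAt
  have hg : Continuous g := by
    refine Continuous.prodMk (continuous_iff_continuousAt.2 fun u => ?_) ?_
    · exact (continuousAt_straighten (D.source_subset u.2)).comp
        continuous_subtype_val.continuousAt
    · exact D.r.continuous.comp (continuous_snd.comp continuous_subtype_val)
  have hgf : g ∘ f = Prod.map (xmap D.θ) id ∘ Subtype.val :=
    funext fun y => Prod.ext (straighten_param y.2) (r_param y.2)
  have hemb : IsEmbedding (g ∘ f) := by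
    rw [hgf]
    exact ((isClosedEmbedding_xmap hsat).isEmbedding.prodMap IsEmbedding.id).comp
      IsEmbedding.subtypeVal
  exact IsEmbedding.subtypeVal.comp (IsEmbedding.of_comp hf hg hemb)

variable (D) in
/-- The interior solutions of the equations `log λ_{b_i} + H_i = 0` and `K_j = 0`. -/
def sol (b : ι → Gp Q) : Set (Model Q n) :=
  {u | coords S u ∈ D.O ∧ ∃ hu : u ∈ interiorSet Q n,
    (∀ i, logHom hu (b i) + D.H i (coords S u) = 0) ∧ ∀ j, D.K j (coords S u) = 0}

/-- The image of the parametrization is the closure of the set of interior solutions. -/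
theorem image_param [IsToric Q] [IsToric P] [DecidableEq ι]
    (hS : AddSubmonoid.closure (S : Set Q) = ⊤)
    (hsat : ∀ p, ∃ N : ℕ, N ≠ 0 ∧ ∃ q, N • p = D.θ q) {b : ι → Gp Q}
    (he : ∀ i j, D.e i (b j) = if i = j then 1 else 0)
    (hker : ∀ i q q', b i = toGp Q q - toGp Q q' → D.θ q = D.θ q')
    (hext : ∀ ℓ : Gp Q →+ ℝ, (∀ i, ℓ (b i) = 0) → ∃ ℓ' : P →+ ℝ, ∀ q, ℓ' (D.θ q) = ℓ (toGp Q q)) :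
    D.param '' D.dom = closure (D.sol b) ∩ D.codom := by
  have hsum : ∀ (c : ι → ℝ) i, sumHom D.e c (b i) = c i := fun c i => by
    simp [sumHom_apply, he]
  ext u
  constructor
  · rintro ⟨y, hy, rfl⟩
    refine ⟨?_, param_mem_codom hy⟩
    -- Interior points are dense in X_P × ℝᵐ and go to interior solutions, so all other values are
    -- limits of interior solutions.
    have hne : (𝓝[interiorSet P m] y).NeBot :=
      mem_closure_iff_nhdsWithin_neBot.1 (dense_interiorSet y)
    refine mem_closure_of_tendsto (f := D.param) (b := 𝓝[interiorSet P m] y)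
      ((continuousAt_param hS hy).mono_left nhdsWithin_le_nhds) ?_
    filter_upwards [mem_nhdsWithin_of_mem_nhds (D.isOpen_dom.mem_nhds hy), self_mem_nhdsWithin]
      with v hv hvi
    have hint : D.param v ∈ interiorSet Q n := fun q => mul_pos (hvi _) (Real.exp_pos _)
    refine ⟨coords_param_mem hv, hint, fun i => ?_, K_param hv⟩
    obtain ⟨q, q', hq⟩ := exists_toGp_sub (b i)
    have hθ := hker i q q' hq
    have hval : ∀ q, Real.log (lam (D.θ q) v) = (logHom hint +
        sumHom D.e fun i => D.H i (coords S (D.param v))) (toGp Q q) := fun q => by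
      rw [← lam_param_mul hv q, Real.log_mul (hint q).ne' (Real.exp_pos _).ne', Real.log_exp,
        AddMonoidHom.add_apply, logHom_toGp]
    have h1 : (logHom hint + sumHom D.e fun i => D.H i (coords S (D.param v))) (b i) = 0 := by
      rw [hq, map_sub, ← hval, ← hval, hθ, sub_self]
    rwa [AddMonoidHom.add_apply, hsum] at h1
  · rintro ⟨hcl, hu⟩
    have hO := D.source_subset hu
    have hne : (𝓝[D.sol b] u).NeBot := mem_closure_iff_nhdsWithin_neBot.1 hcl
    have hK : ∀ j, D.K j (coords S u) = 0 := fun j => by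
      refine tendsto_nhds_unique_of_eventuallyEq (l := 𝓝[D.sol b] u)
        ((smoothAt_comp_coords D.isOpen_O (D.contDiffOn_K j) hO).continuousAt.mono_left
          nhdsWithin_le_nhds) (tendsto_const_nhds (x := (0 : ℝ))) ?_
      filter_upwards [self_mem_nhdsWithin] with v hv
      exact hv.2.2.2 j
    -- On interior solutions the straightened logarithm kills the b_i and so factors through P; the
    -- limit stays in the range of `xmap D.θ` because that range is closed.
    have hrange : D.straighten u ∈ Set.range (xmap D.θ) := by
      refine (isClosedEmbedding_xmap hsat).isClosed_range.mem_of_tendsto (b := 𝓝[D.sol b] u)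
        ((continuousAt_straighten hO).mono_left nhdsWithin_le_nhds) ?_
      filter_upwards [self_mem_nhdsWithin] with v hv
      obtain ⟨-, hvi, hb, -⟩ := hv
      obtain ⟨ℓ', hℓ'⟩ := hext (logHom hvi + sumHom D.e fun i => D.H i (coords S v)) fun i => by
        rw [AddMonoidHom.add_apply, hsum, hb]
      -- With σ = 0 and t = 1 the path is just the point exp(ℓ').
      refine ⟨xpath ℓ' 0 1, Subtype.ext (funext fun q => ?_)⟩
      change Real.exp (ℓ' (D.θ q)) * |1| ^ 0 = lam q v * Real.exp _
      rw [pow_zero, mul_one, hℓ', AddMonoidHom.add_apply, logHom_toGp, Real.exp_add,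
        Real.exp_log (hvi q)]
      rfl
    obtain ⟨x, hx⟩ := hrange
    obtain ⟨h1, h2⟩ := mem_dom_and_param_eq hS hu hx hK
    exact ⟨_, h1, h2⟩

/-- The straightening keeps λ_s = 0 whatever the values H_i(0), and θ(s) ≠ 0 gives the vertex of X_P
the same coordinates. Thus only the K_j are required to vanish at 0. -/
theorem origin_mem_dom [IsToric Q] [IsToric P] (h0 : 0 ∉ S) (hθ : ∀ q, D.θ q = 0 → q = 0)
    (hT : (0 : (S → ℝ) × (Fin n → ℝ)) ∈ D.T.source) (hK : ∀ j, D.K j 0 = 0) :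
    origin P m ∈ D.dom ∧ coords S (D.param (origin P m)) = 0 := by
  have hamb : D.amb (origin P m) = D.T 0 := by
    rw [D.T_apply]
    refine Prod.ext (funext fun s => ?_) (Prod.ext (funext fun j => (hK j).symm)
      (map_zero D.r).symm)
    have : D.θ s.1 ≠ 0 := fun h => h0 (hθ _ h ▸ s.2)
    exact (lam_origin_of_ne (n := m) this).trans (zero_mul _).symm
  have hdom : origin P m ∈ D.dom := by
    change D.amb _ ∈ D.T.target
    rw [hamb]
    exact D.T.map_source hT
  exact ⟨hdom, by rw [coords_param hdom, hamb, D.T.left_inv hT]⟩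

theorem param_origin [IsToric Q] [IsToric P] (hS : AddSubmonoid.closure (S : Set Q) = ⊤)
    (h0 : 0 ∉ S) (hθ : ∀ q, D.θ q = 0 → q = 0)
    (hT : (0 : (S → ℝ) × (Fin n → ℝ)) ∈ D.T.source) (hK : ∀ j, D.K j 0 = 0) :
    D.param (origin P m) = origin Q n :=
  (isEmbedding_coords hS).injective
    ((origin_mem_dom h0 hθ hT hK).2.trans (coords_origin h0).symm)

end Straightening

/-! ### Existence of straightenings -/

/-- At 0, where λ_s = 0, the exponential factors contribute only their values. So the derivative is
block triangular: positive diagonal in the λ_s, and (∂_z K, r) in z, which is injective by the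
choice of r. -/
theorem exists_straightening {Q P : Type*} [AddCommMonoid Q] [AddCommMonoid P] {n : ℕ}
    {S : Finset Q} {ι κ : Type*} [Fintype ι] [Fintype κ] (θ : Q →+ P) (e : ι → Gp Q →+ ℝ)
    {H : ι → (S → ℝ) × (Fin n → ℝ) → ℝ} {K : κ → (S → ℝ) × (Fin n → ℝ) → ℝ}
    {O : Set ((S → ℝ) × (Fin n → ℝ))} (hO : IsOpen O) (h0 : 0 ∈ O)
    (hH : ∀ i, ContDiffOn ℝ ∞ (H i) O) (hK : ∀ j, ContDiffOn ℝ ∞ (K j) O)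
    (hind : LinearIndependent ℝ fun j a => fderiv ℝ (K j) 0 (0, Pi.single a 1)) :
    ∃ (m : ℕ) (D : Straightening Q P n m S ι κ), m + Fintype.card κ = n ∧ D.θ = θ ∧ D.e = e ∧
      D.H = H ∧ D.K = K ∧ D.O = O ∧ 0 ∈ D.T.source := by
  obtain ⟨m, r, hm, hr⟩ := exists_complement
    (LinearMap.pi fun j => (fderiv ℝ (K j) 0 : (S → ℝ) × (Fin n → ℝ) →L[ℝ] ℝ).toLinearMap ∘ₗ
      LinearMap.inr ℝ (S → ℝ) (Fin n → ℝ)) hind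
  let R : (Fin n → ℝ) →L[ℝ] (Fin m → ℝ) := r.toContinuousLinearMap
  let E : S → (S → ℝ) × (Fin n → ℝ) → ℝ :=
    fun s y => Real.exp (sumHom e (fun i => H i y) (toGp Q s.1))
  have hE : ∀ s, ContDiffOn ℝ ∞ (E s) O := fun s =>
    Real.contDiff_exp.comp_contDiffOn (ContDiffOn.sum fun i _ => contDiffOn_const.mul (hH i))
  let G : (S → ℝ) × (Fin n → ℝ) → (S → ℝ) × ((κ → ℝ) × (Fin m → ℝ)) :=
    fun y => (fun s => y.1 s * E s y, (fun j => K j y, R y.2))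
  have hG : ContDiffOn ℝ ∞ G O := by
    refine ContDiffOn.prodMk (contDiffOn_pi.2 fun s => ContDiffOn.mul ?_ (hE s))
      ((contDiffOn_pi.2 hK).prodMk (R.contDiff.comp contDiff_snd).contDiffOn)
    exact ContDiff.contDiffOn (by fun_prop)
  have hdiff : ∀ {f : (S → ℝ) × (Fin n → ℝ) → ℝ}, ContDiffOn ℝ ∞ f O → DifferentiableAt ℝ f 0 :=
    fun hf => (hf.differentiableOn (by simp)).differentiableAt (hO.mem_nhds h0)
  let G' : (S → ℝ) × (Fin n → ℝ) →L[ℝ] (S → ℝ) × ((κ → ℝ) × (Fin m → ℝ)) :=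
    (ContinuousLinearMap.pi fun s => E s 0 • ((ContinuousLinearMap.proj s).comp
      (ContinuousLinearMap.fst ℝ (S → ℝ) (Fin n → ℝ)))).prod
      ((ContinuousLinearMap.pi fun j => fderiv ℝ (K j) 0).prod
        (R.comp (ContinuousLinearMap.snd ℝ (S → ℝ) (Fin n → ℝ))))
  have hG' : HasFDerivAt G G' 0 := by
    refine HasFDerivAt.prodMk (hasFDerivAt_pi.2 fun s => ?_)
      (HasFDerivAt.prodMk (hasFDerivAt_pi.2 fun j => (hdiff (hK j)).hasFDerivAt)
        (R.comp (ContinuousLinearMap.snd ℝ (S → ℝ) (Fin n → ℝ))).hasFDerivAt)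
    have h1 : HasFDerivAt (fun y : (S → ℝ) × (Fin n → ℝ) => y.1 s)
        ((ContinuousLinearMap.proj s).comp (ContinuousLinearMap.fst ℝ (S → ℝ) (Fin n → ℝ))) 0 :=
      ((ContinuousLinearMap.proj (R := ℝ) (φ := fun _ : S => ℝ) s).comp
        (ContinuousLinearMap.fst ℝ (S → ℝ) (Fin n → ℝ))).hasFDerivAt
    refine (h1.fun_mul (hdiff (hE s)).hasFDerivAt).congr_fderiv ?_
    ext w <;> simp
  have hinj : Function.Injective G' := by
    rw [injective_iff_map_eq_zero]
    intro w hw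
    have h1 : w.1 = 0 := funext fun s => by
      have : E s 0 * w.1 s = 0 := congrFun (congrArg Prod.fst hw) s
      exact (mul_eq_zero.1 this).resolve_left (Real.exp_pos _).ne'
    have hw' : w = (0, w.2) := Prod.ext h1 rfl
    refine Prod.ext h1 (hr w.2 (funext fun j => ?_) (congrArg (fun w => w.2.2) hw))
    have : fderiv ℝ (K j) 0 w = 0 := congrFun (congrArg (fun w => w.2.1) hw) j
    rw [hw'] at this
    exact this
  have hdim : Module.finrank ℝ ((S → ℝ) × (Fin n → ℝ)) =
      Module.finrank ℝ ((S → ℝ) × ((κ → ℝ) × (Fin m → ℝ))) := by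
    simp only [Module.finrank_prod, Module.finrank_fintype_fun_eq_card, Fintype.card_fin]
    omega
  let L := (LinearMap.linearEquivOfInjective G'.toLinearMap hinj hdim).toContinuousLinearEquiv
  have hL : (L : (S → ℝ) × (Fin n → ℝ) →L[ℝ] (S → ℝ) × ((κ → ℝ) × (Fin m → ℝ))) = G' :=
    ContinuousLinearMap.ext fun _ => rfl
  obtain ⟨T, hT0, hTO, hT, hTs⟩ := exists_local_diffeo hO hG h0 (G' := L) (by rw [hL]; exact hG')
  exact ⟨m, ⟨θ, e, H, K, R, O, T, hO, hTO, hH, hK, hTs, hT⟩, hm, rfl, rfl, rfl, rfl, rfl, hT0⟩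

/-! ### Reduction to independent equations -/

/-- If the vectors `(v_i, γ_i)` and `(0, ε_j)` are independent and `v_i = ∑ c_{it} v_{a(t)}` for all
`i`, then the vectors `γ_i - ∑ c_{it} γ_{a(t)}`, for `i` outside the range of `a`, and `ε_j` are
independent. -/
theorem linearIndependent_reduce {V W ι τ κ : Type*} [AddCommGroup V] [Module ℝ V]
    [AddCommGroup W] [Module ℝ W] [Fintype ι] [Fintype τ] [Fintype κ] {v : ι → V} {γ : ι → W}
    {ε : κ → W} (h : LinearIndependent ℝ (Sum.elim (fun i => (v i, γ i)) fun j => ((0 : V), ε j)))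
    (a : τ → ι) (c : ι → τ → ℝ) (hc : ∀ i, v i = ∑ t, c i t • v (a t)) :
    LinearIndependent ℝ (Sum.elim
      (fun i : {i // i ∉ Set.range a} => γ i - ∑ t, c i t • γ (a t)) ε) := by
  classical
  rw [Fintype.linearIndependent_iff] at h ⊢
  intro x hx
  rw [Fintype.sum_sum_type] at hx
  simp only [Sum.elim_inl, Sum.elim_inr] at hx
  -- The coefficients obtained by expanding the given relation in the original vectors. Its V-part
  -- cancels by `hc`, so X = 0; an index outside the range of a occurs only in its own combination,
  -- so there X equals x.
  let X : ι ⊕ κ → ℝ := Sum.elim (fun i => ∑ i' : {i // i ∉ Set.range a},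
    x (Sum.inl i') * ((if i = i'.1 then 1 else 0) - ∑ t, if i = a t then c i' t else 0))
    fun j => x (Sum.inr j)
  have key : ∀ {M : Type _} [AddCommGroup M] [Module ℝ M] (w : ι → M),
      ∑ i, X (Sum.inl i) • w i = ∑ i' : {i // i ∉ Set.range a},
        x (Sum.inl i') • (w i' - ∑ t, c i' t • w (a t)) := by
    intro M _ _ w
    simp only [X, Sum.elim_inl, Finset.sum_smul]
    rw [Finset.sum_comm]
    refine Finset.sum_congr rfl fun i' _ => ?_
    simp only [mul_smul, ← Finset.smul_sum, sub_smul, Finset.sum_sub_distrib, Finset.sum_smul,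
      ite_smul, one_smul, zero_smul]
    congr 2
    · simp
    · rw [Finset.sum_comm]
      simp
  have h0 : ∀ i, X i = 0 := by
    refine h X ?_
    rw [Fintype.sum_sum_type]
    simp only [Sum.elim_inl, Sum.elim_inr]
    rw [key]
    refine Prod.ext ?_ ?_
    · rw [Prod.fst_add, Prod.fst_sum, Prod.fst_sum]
      simp only [Prod.smul_fst, Prod.fst_sub, Prod.fst_sum, ← hc]
      simp
    · rw [Prod.snd_add, Prod.snd_sum, Prod.snd_sum]
      simp only [Prod.smul_snd, Prod.snd_sub, Prod.snd_sum]
      exact hx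
  rintro (i | j)
  · have h1 := h0 (Sum.inl i.1)
    simp only [X, Sum.elim_inl] at h1
    rw [Finset.sum_eq_single_of_mem i (Finset.mem_univ _)] at h1
    · have h2 : ∀ t, i.1 ≠ a t := fun t ht => i.2 ⟨t, ht.symm⟩
      simpa [h2] using h1
    · intro i' _ hne
      have h2 : ∀ t, i.1 ≠ a t := fun t ht => i.2 ⟨t, ht.symm⟩
      have h3 : i.1 ≠ i'.1 := fun h => hne (Subtype.ext h.symm)
      simp [h2, h3]
  · exact h0 (Sum.inr j)

/-! ### The local structure of solution sets -/

section Local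

variable {Q : Type u} [AddCommMonoid Q] [IsToric Q] {n k l : ℕ} {S : Finset Q}

/-- The interior solutions of the equations `log λ_{β_i} + H_i = 0` and `K_j = 0`, for functions of
the coordinates with respect to `S`. -/
def logSolutions (O : Set ((S → ℝ) × (Fin n → ℝ))) (β : Fin k → Gp Q)
    (H : Fin k → (S → ℝ) × (Fin n → ℝ) → ℝ) (K : Fin l → (S → ℝ) × (Fin n → ℝ) → ℝ) :
    Set (Model Q n) :=
  {u | coords S u ∈ O ∧ ∃ hu : u ∈ interiorSet Q n,
    (∀ i, logHom hu (β i) + H i (coords S u) = 0) ∧ ∀ j, K j (coords S u) = 0}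

theorem map_eq_sum_of_tmul_eq {A : Type*} [AddCommGroup A] {ι : Type*} [Fintype ι] {b : ι → A}
    {x : A} {c : ι → ℝ} (h : (1 : ℝ) ⊗ₜ[ℤ] x = ∑ i, c i • (1 : ℝ) ⊗ₜ[ℤ] b i) (g : A →+ ℝ) :
    g x = ∑ i, c i * g (b i) := by
  rw [← realExt_tmul g x, h, map_sum]
  simp only [map_smul, realExt_tmul, smul_eq_mul]

/-- Membership of the vertex in the closure is not assumed: sharpness and the compatibility of the
constants H_i(0) with the linear relations among the β_i suffice. This serves both the description
of X and the converse direction of the face criterion. -/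
theorem exists_local_param (hS : AddSubmonoid.closure (S : Set Q) = ⊤) (hS0 : 0 ∉ S)
    {O : Set ((S → ℝ) × (Fin n → ℝ))} (hO : IsOpen O) (h0 : 0 ∈ O) {β : Fin k → Gp Q}
    {H : Fin k → (S → ℝ) × (Fin n → ℝ) → ℝ} {K : Fin l → (S → ℝ) × (Fin n → ℝ) → ℝ}
    (hH : ∀ i, ContDiffOn ℝ ∞ (H i) O) (hK : ∀ j, ContDiffOn ℝ ∞ (K j) O)
    (hind : LinearIndependent ℝ (Sum.elim
      (fun i => ((1 : ℝ) ⊗ₜ[ℤ] β i, fun a => fderiv ℝ (H i) 0 (0, Pi.single a 1)))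
      fun j => ((0 : ℝ ⊗[ℤ] Gp Q), fun a : Fin n => fderiv ℝ (K j) 0 (0, Pi.single a 1))))
    (hsharp : ∀ q : Q, (1 : ℝ) ⊗ₜ[ℤ] toGp Q q ∈ realSpan β → q = 0)
    (hH0 : ∀ c : Fin k → ℝ, ∑ i, c i • (1 : ℝ) ⊗ₜ[ℤ] β i = 0 → ∑ i, c i * H i 0 = 0)
    (hK0 : ∀ j, K j 0 = 0) :
    ∃ (P : Type u) (_ : AddCommMonoid P) (_ : IsToric P) (m : ℕ) (U : Set (Model P m))
      (φ : Model P m → Model Q n) (V' : Set (Model Q n)),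
      rank P + m + k + l = rank Q + n ∧ IsOpen U ∧ origin P m ∈ U ∧ IsInteriorEmbeddingOn φ U ∧
      φ (origin P m) = origin Q n ∧ IsOpen V' ∧ origin Q n ∈ V' ∧ (∀ u ∈ V', coords S u ∈ O) ∧
      φ '' U = closure (logSolutions O β H K) ∩ V' ∧
      ∃ (e : (P →+ ℕ) ≃+ annihilator β) (hφ : InteriorMapAt φ (origin P m)),
        ∀ α : cornerMonoid (origin P m),
          toDual (φ (origin P m)) (cornerMap hφ α) = (e (toDual (origin P m) α) : Q →+ ℕ) := by
  classical
  obtain ⟨P, _, _, θ, hsat, hgen, hθ, hrank, hker, hext, hfac⟩ := exists_quotient_monoid β hsharp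
  obtain ⟨τ, a, ha, hspan, hli⟩ := exists_linearIndependent' ℝ fun i => (1 : ℝ) ⊗ₜ[ℤ] β i
  have : Finite τ := Finite.of_injective a ha
  have : Fintype τ := Fintype.ofFinite τ
  obtain ⟨c, hc⟩ : ∃ c : Fin k → τ → ℝ, ∀ i,
      (1 : ℝ) ⊗ₜ[ℤ] β i = ∑ t, c i t • (1 : ℝ) ⊗ₜ[ℤ] β (a t) := by
    have h1 : ∀ i, ∃ c : τ → ℝ, ∑ t, c t • (1 : ℝ) ⊗ₜ[ℤ] β (a t) = (1 : ℝ) ⊗ₜ[ℤ] β i := fun i => by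
      refine (Submodule.mem_span_range_iff_exists_fun ℝ).1 ?_
      have : (1 : ℝ) ⊗ₜ[ℤ] β i ∈ Submodule.span ℝ (Set.range fun i => (1 : ℝ) ⊗ₜ[ℤ] β i) :=
        Submodule.subset_span ⟨i, rfl⟩
      rwa [← hspan] at this
    choose c hc using h1
    exact ⟨c, fun i => (hc i).symm⟩
  obtain ⟨e, he⟩ := exists_dual_homs (b := fun t => β (a t)) hli
  -- Given the equations of the basis, each remaining logarithmic equation is equivalent to a smooth
  -- one, since the logarithms cancel by linearity.
  let K' : {i // i ∉ Set.range a} ⊕ Fin l → (S → ℝ) × (Fin n → ℝ) → ℝ :=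
    Sum.elim (fun i y => H i y - ∑ t, c i t * H (a t) y) K
  have hK' : ∀ j, ContDiffOn ℝ ∞ (K' j) O := by
    rintro (i | j)
    · exact (hH i).sub (ContDiffOn.sum fun t _ => contDiffOn_const.mul (hH (a t)))
    · exact hK j
  have hK'0 : ∀ j, K' j 0 = 0 := by
    rintro (i | j)
    -- The coefficients express the relation β_i − Σ c_{it} β_{a(t)} = 0.
    · have h1 := hH0 (fun i' => (if i' = i.1 then 1 else 0) - ∑ t, if i' = a t then c i t else 0) (by
        simp only [sub_smul, Finset.sum_smul, ite_smul, one_smul, zero_smul,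
          Finset.sum_sub_distrib]
        rw [Finset.sum_comm]
        simp [← hc])
      simp only [sub_mul, Finset.sum_mul, ite_mul, one_mul, zero_mul,
          Finset.sum_sub_distrib] at h1
      rw [Finset.sum_comm] at h1
      simpa [K'] using h1
    · exact hK0 j
  have hdiff : ∀ i, DifferentiableAt ℝ (H i) 0 := fun i =>
    ((hH i).differentiableOn (by simp)).differentiableAt (hO.mem_nhds h0)
  have hind' : LinearIndependent ℝ fun j b => fderiv ℝ (K' j) 0 (0, Pi.single b 1) := by
    have h1 := linearIndependent_reduce hind a c hc
    have h2 : (fun j b => fderiv ℝ (K' j) 0 (0, Pi.single b 1)) = Sum.elim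
        (fun i : {i // i ∉ Set.range a} => (fun b => fderiv ℝ (H i) 0 (0, Pi.single b 1)) -
          ∑ t, c i t • fun b => fderiv ℝ (H (a t)) 0 (0, Pi.single b 1))
        fun j b => fderiv ℝ (K j) 0 (0, Pi.single b 1) := by
      funext j
      rcases j with i | j
      · funext b
        change fderiv ℝ (fun y => H i y - ∑ t, c i t * H (a t) y) 0 _ = _
        rw [fderiv_fun_sub (hdiff i)
            (DifferentiableAt.fun_sum fun t _ => (hdiff (a t)).const_mul _),
          fderiv_fun_sum fun t _ => (hdiff (a t)).const_mul _]
        simp [fderiv_const_mul (hdiff _)]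
      · rfl
    rw [h2]
    exact h1
  obtain ⟨m, D, hm, rfl, rfl, hDH, hDK, rfl, hT⟩ :=
    exists_straightening (P := P) θ e (H := fun t => H (a t)) hO h0 (fun t => hH (a t)) hK' hind'
  have hsol : D.sol (fun t => β (a t)) = logSolutions D.O β H K := by
    ext u
    refine and_congr_right fun _ => exists_congr fun hu => ?_
    rw [hDH, hDK]
    have hlog : ∀ i, logHom hu (β i) = ∑ t, c i t * logHom hu (β (a t)) := fun i =>
      map_eq_sum_of_tmul_eq (b := fun t => β (a t)) (hc i) (logHom hu)
    constructor
    · rintro ⟨h1, h2⟩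
      refine ⟨fun i => ?_, fun j => h2 (Sum.inr j)⟩
      by_cases hi : i ∈ Set.range a
      · obtain ⟨t, rfl⟩ := hi
        exact h1 t
      · have h3 : H i (coords S u) - ∑ t, c i t * H (a t) (coords S u) = 0 := h2 (Sum.inl ⟨i, hi⟩)
        have h4 : ∀ t, logHom hu (β (a t)) = -H (a t) (coords S u) := fun t => by
          have := h1 t
          linarith
        rw [hlog, sub_eq_zero.1 h3, ← Finset.sum_add_distrib]
        refine Finset.sum_eq_zero fun t _ => ?_
        rw [h4]
        ring
    · rintro ⟨h1, h2⟩
      refine ⟨fun t => h1 (a t), ?_⟩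
      rintro (i | j)
      · have h3 := h1 i
        have h4 : ∀ t, H (a t) (coords S u) = -logHom hu (β (a t)) := fun t => by
          have := h1 (a t)
          linarith
        change H i (coords S u) - ∑ t, c i t * H (a t) (coords S u) = 0
        simp only [h4, mul_neg, Finset.sum_neg_distrib, ← hlog]
        linarith
      · exact h2 j
  have hspan' : realSpan (fun t => β (a t)) = realSpan β := hspan
  -- Dimension count: passing to P lowers the rank by the size of the basis, and the leftover
  -- equations together with the K_j use up as many real coordinates.
  have hcardτ : Module.finrank ℝ (realSpan β) = Fintype.card τ := by
    rw [← hspan']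
    exact finrank_span_eq_card hli
  have hcard : Fintype.card {i // i ∉ Set.range a} = k - Fintype.card τ := by
    rw [Fintype.card_subtype_compl, Fintype.card_fin]
    congr 1
    exact Set.card_range_of_injective ha
  have hle : Fintype.card τ ≤ k := by
    simpa using Fintype.card_le_of_injective a ha
  rw [Fintype.card_sum, Fintype.card_fin, hcard] at hm
  have hDK0 : ∀ j, D.K j 0 = 0 := by rw [hDK]; exact hK'0
  have horig := Straightening.param_origin (D := D) hS hS0 hθ hT hDK0
  have hdom := (Straightening.origin_mem_dom (D := D) hS0 hθ hT hDK0).1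
  have himm : ∀ y ∈ D.dom, InteriorImmersionAt D.param y := fun y hy =>
    Straightening.interiorImmersionAt_param hS hsat hgen hy
  obtain ⟨e', he'⟩ := exists_dual_equiv_annihilator hsat hker hfac
  refine ⟨P, inferInstance, inferInstance, m, D.dom, D.param, D.codom, by omega, D.isOpen_dom, hdom,
    ⟨himm, Straightening.isEmbedding_param hS hsat⟩, horig, D.isOpen_codom, ?_,
    fun u hu => D.source_subset hu, ?_, e', Straightening.interiorMapAt_param hS hdom, fun α => ?_⟩
  · change coords S (origin Q n) ∈ D.T.source
    rw [coords_origin hS0]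
    exact hT
  · rw [← hsol]
    refine Straightening.image_param hS hsat he (fun t q q' hq => ?_) fun ℓ hℓ => ?_
    · rw [hker, ← hq]
      exact Submodule.subset_span ⟨a t, rfl⟩
    · refine hext ℓ fun i => hom_eq_zero_of_mem_realSpan hℓ ?_
      rw [hspan']
      exact Submodule.subset_span ⟨i, rfl⟩
  · rw [he']
    refine AddMonoidHom.ext fun q => ?_
    exact cornerMap_lamGerm _ (Straightening.smoothAt_corr hdom (toGp Q q)).exp (Real.exp_pos _)
      (Eventually.of_forall fun u => rfl) α

/-- If the vertex is in the closure of the solution set, then real relations between the `β_i` and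
elements of `Q` give relations between the values of the `H_i` at the vertex. -/
theorem lam_origin_eq_exp {O : Set ((S → ℝ) × (Fin n → ℝ))} (hO : IsOpen O) (hS0 : 0 ∉ S)
    (h0 : 0 ∈ O) {β : Fin k → Gp Q} {H : Fin k → (S → ℝ) × (Fin n → ℝ) → ℝ}
    {K : Fin l → (S → ℝ) × (Fin n → ℝ) → ℝ}
    (hH : ∀ i, ContDiffOn ℝ ∞ (H i) O) (hcl : origin Q n ∈ closure (logSolutions O β H K))
    {q : Q} {c : Fin k → ℝ} (hq : (1 : ℝ) ⊗ₜ[ℤ] toGp Q q = ∑ i, c i • (1 : ℝ) ⊗ₜ[ℤ] β i) :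
    lam q (origin Q n) = Real.exp (-∑ i, c i * H i 0) := by
  have hne : (𝓝[logSolutions O β H K] (origin Q n)).NeBot := mem_closure_iff_nhdsWithin_neBot.1 hcl
  have hc0 : coords S (origin Q n) ∈ O := by rwa [coords_origin (n := n) hS0]
  have h1 : SmoothAt (fun u => Real.exp (-∑ i, c i * H i (coords S u))) (origin Q n) :=
    (SmoothAt.sum fun i => (smoothAt_const _).mul (smoothAt_comp_coords hO (hH i) hc0)).neg.exp
  have h2 := tendsto_nhds_unique_of_eventuallyEq (l := 𝓝[logSolutions O β H K] (origin Q n))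
    ((continuous_lam q).continuousAt.mono_left nhdsWithin_le_nhds)
    (h1.continuousAt.mono_left nhdsWithin_le_nhds) (by
      filter_upwards [self_mem_nhdsWithin] with u hu
      obtain ⟨-, hui, hb, -⟩ := hu
      have h3 := map_eq_sum_of_tmul_eq hq (logHom hui)
      rw [logHom_toGp] at h3
      have h4 : ∀ i, logHom hui (β i) = -H i (coords S u) := fun i => by
        have := hb i
        linarith
      simp only [h4, mul_neg, Finset.sum_neg_distrib] at h3
      rw [← h3, Real.exp_log (hui q)])
  refine h2.trans ?_
  change Real.exp (-∑ i, c i * H i (coords S (origin Q n))) = _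
  rw [coords_origin hS0]

end Local

/-! ### Annihilators and faces of the dual monoid -/

section Annihilator

variable {Q : Type u} [AddCommMonoid Q] [IsToric Q] {k : ℕ} {β : Fin k → Gp Q}

/-- A strictly positive morphism on the sharp quotient monoid pulls back to some ρ in the
annihilator that is positive on all nonzero q. A multiple of ρ dominates any given τ, so a face
containing ρ contains τ. -/
theorem eq_top_of_annihilator_le
    (hsharp : ∀ q : Q, (1 : ℝ) ⊗ₜ[ℤ] toGp Q q ∈ realSpan β → q = 0) {F : AddSubmonoid (Q →+ ℕ)}
    (hF : IsFace F) (hle : annihilator β ≤ F) : F = ⊤ := by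
  obtain ⟨P, _, _, θ, hsat, -, hθ, -, hker, -, hfac⟩ := exists_quotient_monoid β hsharp
  obtain ⟨e, he⟩ := exists_dual_equiv_annihilator hsat hker hfac
  obtain ⟨σ, hσ⟩ := exists_pos_hom P
  have hρ : σ.comp θ ∈ annihilator β := he σ ▸ (e σ).2
  refine (AddSubmonoid.eq_top_iff' F).2 fun τ => ?_
  obtain ⟨S, hS, hS0⟩ := exists_generators Q
  have hK : ∀ q, τ q ≤ (∑ s ∈ S, τ s) * σ (θ q) := fun q => by
    have hq : q ∈ AddSubmonoid.closure (S : Set Q) := by rw [hS]; trivial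
    induction hq using AddSubmonoid.closure_induction with
    | mem q hq =>
      have h1 : τ q ≤ ∑ s ∈ S, τ s :=
        Finset.single_le_sum (f := fun s => τ s) (fun _ _ => Nat.zero_le _) hq
      have h2 : 0 < σ (θ q) := Nat.pos_of_ne_zero fun h =>
        hS0 (hθ q ((hσ _).1 h) ▸ hq)
      exact h1.trans (Nat.le_mul_of_pos_right _ h2)
    | zero => simp
    | add p q _ _ hp hq =>
      rw [map_add, map_add, map_add, mul_add]
      exact add_le_add hp hq
  let τ' : Q →+ ℕ := toNatHom ((∑ s ∈ S, τ s) • (Nat.castAddMonoidHom ℤ).comp (σ.comp θ) -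
    (Nat.castAddMonoidHom ℤ).comp τ) fun q => by
      have := hK q
      simp only [AddMonoidHom.sub_apply, AddMonoidHom.smul_apply, AddMonoidHom.comp_apply,
        Nat.coe_castAddMonoidHom, nsmul_eq_mul]
      rw [sub_nonneg]
      exact_mod_cast this
  have h1 : τ + τ' = (∑ s ∈ S, τ s) • σ.comp θ := by
    refine AddMonoidHom.ext fun q => Nat.cast_injective (R := ℤ) ?_
    rw [AddMonoidHom.add_apply, Nat.cast_add, toNatHom_cast]
    simp
  refine (hF τ τ' ?_).1
  rw [h1]
  exact F.nsmul_mem (hle hρ) _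

/-- If the smallest face containing the annihilator is everything, it contains a strictly positive
σ, and some σ + τ lies in the annihilator. This sum kills the real span of the β_i but is positive
on nonzero elements of Q. -/
theorem eq_zero_of_not_annihilator_le
    (h : ∀ F : AddSubmonoid (Q →+ ℕ), IsFace F → F ≠ ⊤ → ¬ annihilator β ≤ F) {q : Q}
    (hq : (1 : ℝ) ⊗ₜ[ℤ] toGp Q q ∈ realSpan β) : q = 0 := by
  -- The face generated by the annihilator.
  let F : AddSubmonoid (Q →+ ℕ) :=
    { carrier := {ρ | ∃ σ, ρ + σ ∈ annihilator β}
      zero_mem' := ⟨0, by rw [add_zero]; exact (annihilator β).zero_mem⟩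
      add_mem' := by
        rintro ρ ρ' ⟨σ, hσ⟩ ⟨σ', hσ'⟩
        refine ⟨σ + σ', ?_⟩
        rw [add_add_add_comm]
        exact (annihilator β).add_mem hσ hσ' }
  have hF : IsFace F := by
    rintro ρ ρ' ⟨σ, hσ⟩
    refine ⟨⟨ρ' + σ, by rwa [← add_assoc]⟩, ⟨ρ + σ, ?_⟩⟩
    rwa [← add_assoc, add_comm ρ' ρ]
  have htop : F = ⊤ := by
    by_contra hne
    exact h F hF hne fun ρ hρ => ⟨0, by rwa [add_zero]⟩
  obtain ⟨σ, hσ⟩ := exists_pos_hom Q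
  obtain ⟨τ, hτ⟩ : σ ∈ F := htop ▸ AddSubmonoid.mem_top σ
  have h1 : (Int.castAddHom ℝ).comp (extendDual (σ + τ)) (toGp Q q) = 0 :=
    hom_eq_zero_of_mem_realSpan (fun i => by
      rw [AddMonoidHom.comp_apply, hτ i, map_zero]) hq
  rw [AddMonoidHom.comp_apply, extendDual_toGp] at h1
  change ((((σ q + τ q : ℕ) : ℤ)) : ℝ) = 0 at h1
  rw [Int.cast_natCast, Nat.cast_eq_zero] at h1
  exact (hσ q).1 (Nat.eq_zero_of_add_eq_zero_right h1)

end Annihilator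

/-! ### Logarithmic form of the equations -/

section Equations

variable {Q : Type u} [AddCommMonoid Q] [IsToric Q] {n k l : ℕ}

/-- Taking logarithms of λ_p·a = λ_q·a' in the interior gives the exponent p − q and the smooth
function log a − log a'. -/
theorem exists_log_rep {f g : Model Q n → ℝ} (hf : InteriorAt f (origin Q n))
    (hg : InteriorAt g (origin Q n)) :
    ∃ (b : Gp Q) (F : Model Q n → ℝ) (hF : SmoothAt F (origin Q n)),
      bdiff hf - bdiff hg = bCotangentMap (origin Q n) (1 ⊗ₜ[ℤ] b, 0) + ddiff hF ∧
      ∀ᶠ u in 𝓝 (origin Q n), ∀ hu : u ∈ interiorSet Q n,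
        (f u = g u ↔ logHom hu b + F u = 0) := by
  obtain ⟨p, a, ha, hfa⟩ := id hf
  obtain ⟨q, b, hb, hgb⟩ := id hg
  have ha0 := hfa.self_of_nhds.1
  have hb0 := hgb.self_of_nhds.1
  refine ⟨toGp Q p - toGp Q q, _, (ha.log ha0.ne').add (hb.log hb0.ne').neg, ?_, ?_⟩
  · rw [bdiff_origin hf ha ha0 (hfa.mono fun u hu => hu.2),
      bdiff_origin hg hb hb0 (hgb.mono fun u hu => hu.2)]
    have h1 : ddiff ((ha.log ha0.ne').add (hb.log hb0.ne').neg) =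
        ddiff (ha.log ha0.ne') - ddiff (hb.log hb0.ne') := by
      ext w
      refine (map_germ_add (v := w.1.1) (ha.log ha0.ne') (hb.log hb0.ne').neg).trans ?_
      rw [LinearMap.sub_apply, sub_eq_add_neg]
      exact congrArg _ (w.1.1.map_neg (hb.log hb0.ne').germ)
    have h2 : ((1 : ℝ) ⊗ₜ[ℤ] (toGp Q p - toGp Q q), (0 : Fin n → ℝ)) =
        ((1 : ℝ) ⊗ₜ[ℤ] toGp Q p, 0) - ((1 : ℝ) ⊗ₜ[ℤ] toGp Q q, 0) := by
      rw [TensorProduct.tmul_sub, Prod.mk_sub_mk, sub_zero]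
    rw [h1, h2, map_sub]
    abel
  · filter_upwards [hfa, hgb] with u hu hu' hui
    rw [hu.2, hu'.2, map_sub, logHom_toGp, logHom_toGp,
      ← Real.log_injOn_pos.eq_iff (mul_pos (hui p) hu.1) (mul_pos (hui q) hu'.1),
      Real.log_mul (hui p).ne' hu.1.ne', Real.log_mul (hui q).ne' hu'.1.ne']
    constructor <;> intro h <;> linarith

/-- Near the vertex, the equations `f_i = g_i` and `h_j = 0` in the interior are equivalent to
equations `log λ_{β_i} + H_i = 0` and `K_j = 0`. -/
theorem exists_equations {S : Finset Q} (hS : AddSubmonoid.closure (S : Set Q) = ⊤) (hS0 : 0 ∉ S)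
    {V : Set (Model Q n)} (hV : V ∈ 𝓝 (origin Q n)) {f g : Fin k → Model Q n → ℝ}
    {h : Fin l → Model Q n → ℝ} (hf : ∀ i, InteriorAt (f i) (origin Q n))
    (hg : ∀ i, InteriorAt (g i) (origin Q n)) (hh : ∀ j, SmoothAt (h j) (origin Q n))
    (hh0 : ∀ j, h j (origin Q n) = 0) :
    ∃ (O : Set ((S → ℝ) × (Fin n → ℝ))) (β : Fin k → Gp Q)
      (H : Fin k → (S → ℝ) × (Fin n → ℝ) → ℝ) (K : Fin l → (S → ℝ) × (Fin n → ℝ) → ℝ),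
      IsOpen O ∧ 0 ∈ O ∧ (∀ u, coords S u ∈ O → u ∈ V) ∧ (∀ i, ContDiffOn ℝ ∞ (H i) O) ∧
      (∀ j, ContDiffOn ℝ ∞ (K j) O) ∧ (∀ j, K j 0 = 0) ∧
      (∀ i, bCotangentMap (origin Q n)
        (1 ⊗ₜ[ℤ] β i, fun a => fderiv ℝ (H i) 0 (0, Pi.single a 1)) = bdiff (hf i) - bdiff (hg i)) ∧
      (∀ j, bCotangentMap (origin Q n) (0, fun a => fderiv ℝ (K j) 0 (0, Pi.single a 1)) =
        ddiff (hh j)) ∧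
      logSolutions O β H K = interiorSolutions V f g h ∩ coords S ⁻¹' O := by
  choose β F hF hbF hFe using fun i => exists_log_rep (hf i) (hg i)
  choose OH H hOH hH0 hH hHF using fun i => (hF i).exists_rep hS
  choose OK K hOK hK0 hK hKh using fun j => (hh j).exists_rep hS
  obtain ⟨O₁, hO₁, h0O₁, hO₁e⟩ := exists_open_coords hS
    (Filter.Eventually.and hV (eventually_all.2 hFe))
  have hc := coords_origin (n := n) hS0
  rw [hc] at h0O₁
  simp only [hc] at hH0 hK0
  let O := O₁ ∩ ((⋂ i, OH i) ∩ ⋂ j, OK j)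
  have hOHs : ∀ i, O ⊆ OH i := fun i y hy => Set.mem_iInter.1 hy.2.1 i
  have hOKs : ∀ j, O ⊆ OK j := fun j y hy => Set.mem_iInter.1 hy.2.2 j
  have hO : IsOpen O :=
    hO₁.inter ((isOpen_iInter_of_finite hOH).inter (isOpen_iInter_of_finite hOK))
  have h0O : (0 : (S → ℝ) × (Fin n → ℝ)) ∈ O :=
    ⟨h0O₁, Set.mem_iInter.2 hH0, Set.mem_iInter.2 hK0⟩
  have hev : ∀ᶠ u in 𝓝 (origin Q n), coords S u ∈ O :=
    (continuous_coords S).continuousAt.eventually_mem (hO.mem_nhds (by rwa [hc]))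
  refine ⟨O, β, H, K, hO, h0O, fun u hu => (hO₁e u hu.1).1, fun i => (hH i).mono (hOHs i),
    fun j => (hK j).mono (hOKs j), fun j => ?_, fun i => ?_, fun j => ?_, ?_⟩
  · rw [← hh0 j, hKh j (origin Q n) (by rw [hc]; exact hK0 j), hc]
  · rw [hbF, ddiff_origin (hF i) hS0 (hOH i) (hH i)
      (hev.mono fun u hu => ⟨hOHs i hu, hHF i u (hOHs i hu)⟩), ← map_add, hc, Prod.mk_add_mk,
      add_zero, zero_add]
  · rw [ddiff_origin (hh j) hS0 (hOK j) (hK j)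
      (hev.mono fun u hu => ⟨hOKs j hu, hKh j u (hOKs j hu)⟩), hc]
  · ext u
    constructor
    · rintro ⟨hu, hui, h1, h2⟩
      refine ⟨⟨(hO₁e u hu.1).1, hui, fun i => ((hO₁e u hu.1).2 i hui).2 ?_, fun j => ?_⟩, hu⟩
      · rw [hHF i u (hOHs i hu)]
        exact h1 i
      · rw [hKh j u (hOKs j hu)]
        exact h2 j
    · rintro ⟨⟨-, hui, h1, h2⟩, hu⟩
      refine ⟨hu, hui, fun i => ?_, fun j => ?_⟩
      · rw [← hHF i u (hOHs i hu)]
        exact ((hO₁e u hu.1).2 i hui).1 (h1 i)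
      · rw [← hKh j u (hOKs j hu)]
        exact h2 j

/-- Closures can be computed inside an open set, so near the vertex X depends only on the local form
of the equations. -/
theorem closure_inter_eq_solutions_inter {V V' W A : Set (Model Q n)}
    {f g : Fin k → Model Q n → ℝ} {h : Fin l → Model Q n → ℝ}
    (hA : A = interiorSolutions V f g h ∩ W) (hV' : IsOpen V') (hW : V' ⊆ W) (hV : V' ⊆ V) :
    closure A ∩ V' = solutions V f g h ∩ V' := by
  refine Set.Subset.antisymm ?_ ?_
  · rintro u ⟨hu, huV'⟩
    rw [hA] at hu
    exact ⟨⟨closure_mono Set.inter_subset_left hu, hV huV'⟩, huV'⟩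
  · rintro u ⟨⟨hu, -⟩, huV'⟩
    refine ⟨?_, huV'⟩
    rw [hA]
    exact closure_mono (Set.inter_subset_inter_right _ hW) (hV'.closure_inter ⟨hu, huV'⟩)

end Equations

end GCorners

end

/-! ### The main theorem -/

theorem theorem4p15 {Q : Type u} [AddCommMonoid Q] [IsToric Q] (n k l : ℕ)
    (V : Set (Model Q n)) (hV : IsOpen V) (h0V : origin Q n ∈ V)
    (f g : Fin k → Model Q n → ℝ) (h : Fin l → Model Q n → ℝ)
    (hf : ∀ i, ∀ v ∈ V, InteriorAt (f i) v) (hg : ∀ i, ∀ v ∈ V, InteriorAt (g i) v)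
    (hh : ∀ j, ∀ v ∈ V, SmoothAt (h j) v)
    (hfg0 : ∀ i, f i (origin Q n) = g i (origin Q n)) (hh0 : ∀ j, h j (origin Q n) = 0)
    (hind : LinearIndependent ℝ (Sum.elim
      (fun i => bdiff (hf i _ h0V) - bdiff (hg i _ h0V)) (fun j => ddiff (hh j _ h0V)))) :
    -- the isomorphism `(Q ⊗ ℝ) ⊕ ℝⁿ ≅ ᵇT*` at `(δ₀, 0)`, and the elements `β i` and `γ i`
    Function.Bijective (bCotangentMap (origin Q n)) ∧
    ∃ (β : Fin k → Gp Q) (γ : Fin k → Fin n → ℝ),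
      (∀ i, bCotangentMap (origin Q n) (1 ⊗ₜ[ℤ] β i, γ i) =
        bdiff (hf i _ h0V) - bdiff (hg i _ h0V)) ∧
      -- the local structure of `X` near `(δ₀, 0)`
      (origin Q n ∈ solutions V f g h →
        ∃ (P : Type u) (_ : AddCommMonoid P) (_ : IsToric P) (m : ℕ) (U : Set (Model P m))
          (φ : Model P m → Model Q n) (V' : Set (Model Q n)),
          rank P + m + k + l = rank Q + n ∧
          IsOpen U ∧ origin P m ∈ U ∧ Set.MapsTo φ U V ∧ IsInteriorEmbeddingOn φ U ∧
          φ (origin P m) = origin Q n ∧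
          IsOpen V' ∧ origin Q n ∈ V' ∧ V' ⊆ V ∧ φ '' U = solutions V f g h ∩ V' ∧
          -- the identifications of the monoids at the vertices with `P^∨` and `Q^∨`, and of the
          -- map between them with the inclusion of `annihilator β`
          Function.Bijective (toDual (origin P m)) ∧
          Function.Bijective (toDual (origin Q n)) ∧
          ∃ (e : (P →+ ℕ) ≃+ annihilator β) (hφ : InteriorMapAt φ (origin P m)),
            ∀ α : cornerMonoid (origin P m),
              toDual (φ (origin P m)) (cornerMap hφ α) = (e (toDual (origin P m) α) : Q →+ ℕ)) ∧
      -- the criterion for `(δ₀, 0) ∈ X`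
      (LinearIndependent ℝ (fun i => (1 : ℝ) ⊗ₜ[ℤ] β i) →
        (origin Q n ∈ solutions V f g h ↔
          ∀ F : AddSubmonoid (Q →+ ℕ), IsFace F → F ≠ ⊤ → ¬ annihilator β ≤ F)) := by
  classical
  obtain ⟨S, hS, hS0⟩ := exists_generators Q
  obtain ⟨O, β, H, K, hO, h0O, hOV, hH, hK, hK0, hβ, hε, hsol⟩ :=
    exists_equations hS hS0 (hV.mem_nhds h0V) (fun i => hf i _ h0V) (fun i => hg i _ h0V)
      (fun j => hh j _ h0V) hh0
  have hind' : LinearIndependent ℝ (Sum.elim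
      (fun i => ((1 : ℝ) ⊗ₜ[ℤ] β i, fun a => fderiv ℝ (H i) 0 (0, Pi.single a 1)))
      fun j => ((0 : ℝ ⊗[ℤ] Gp Q), fun a : Fin n => fderiv ℝ (K j) 0 (0, Pi.single a 1))) := by
    refine LinearIndependent.of_comp (bCotangentMap (origin Q n)) ?_
    convert hind using 1
    funext x
    rcases x with i | j
    · exact hβ i
    · exact hε j
  have hcl : ∀ V' : Set (Model Q n), IsOpen V' → (∀ u ∈ V', coords S u ∈ O) →
      closure (logSolutions O β H K) ∩ V' = solutions V f g h ∩ V' := fun V' hV' hV'O =>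
    closure_inter_eq_solutions_inter hsol hV' hV'O fun u hu => hOV u (hV'O u hu)
  have h0cl : origin Q n ∈ solutions V f g h ↔ origin Q n ∈ closure (logSolutions O β H K) := by
    have h1 := Set.ext_iff.1 (hcl (coords S ⁻¹' O) (hO.preimage (continuous_coords S))
      fun u hu => hu) (origin Q n)
    have h2 : origin Q n ∈ coords S ⁻¹' O := by
      rw [Set.mem_preimage, coords_origin hS0]
      exact h0O
    exact ⟨fun h => (h1.2 ⟨h, h2⟩).1, fun h => (h1.1 ⟨h, h2⟩).1⟩
  -- If a nonzero q lay in the real span, λ_q(δ₀) = 0 would be the value of an exponential.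
  have hsharp : origin Q n ∈ solutions V f g h →
      ∀ q : Q, (1 : ℝ) ⊗ₜ[ℤ] toGp Q q ∈ realSpan β → q = 0 := by
    intro h0 q hq
    obtain ⟨c, hc⟩ := (Submodule.mem_span_range_iff_exists_fun ℝ).1 hq
    by_contra hne
    have h1 := lam_origin_eq_exp hO hS0 h0O hH (h0cl.1 h0) hc.symm
    rw [lam_origin_of_ne hne] at h1
    exact (Real.exp_pos _).ne h1
  refine ⟨bCotangentMap_bijective Q n, β, _, hβ, fun h0 => ?_, fun hli => ⟨fun h0 F hF hne hle =>
    hne (eq_top_of_annihilator_le (hsharp h0) hF hle), fun hface => ?_⟩⟩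
  · obtain ⟨P, _, _, m, U, φ, V', hrank, hU, h0U, hφ, hφ0, hV', h0V', hV'O, himage, e, hφi, he⟩ :=
      exists_local_param hS hS0 hO h0O hH hK hind' (hsharp h0) (fun c hc => by
        -- A relation Σ c_i β_i = 0 is the case q = 0, where λ_0 = 1 forces the exponent to vanish.
        have h1 := lam_origin_eq_exp (q := 0) hO hS0 h0O hH (h0cl.1 h0) (c := c) (by
          rw [hc, map_zero, TensorProduct.tmul_zero])
        rw [lam_zero, eq_comm, Real.exp_eq_one_iff, neg_eq_zero] at h1
        exact h1) hK0
    rw [hcl V' hV' hV'O] at himage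
    have hV'V : V' ⊆ V := fun u hu => hOV u (hV'O u hu)
    exact ⟨P, inferInstance, inferInstance, m, U, φ, V', hrank, hU, h0U,
      fun u hu => hV'V (himage.subset (Set.mem_image_of_mem φ hu)).2, hφ, hφ0, hV', h0V', hV'V,
      himage, toDual_bijective, toDual_bijective, e, hφi, he⟩
  -- Here the face condition provides sharpness, and independence leaves only the trivial relation.
  -- The parametrization therefore exists, and its value at the vertex lies in the closure of the
  -- solutions.
  · obtain ⟨P, _, _, m, U, φ, V', -, -, h0U, -, hφ0, -, -, -, himage, -⟩ :=
      exists_local_param hS hS0 hO h0O hH hK hind'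
        (fun q hq => eq_zero_of_not_annihilator_le hface hq) (fun c hc => by
          have h1 := Fintype.linearIndependent_iff.1 hli c hc
          simp [h1]) hK0
    rw [h0cl, ← hφ0]
    exact (himage.subset (Set.mem_image_of_mem φ h0U)).1
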